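/- Let $d\in\{1,2,3\}$, $\Omega=\prod_{j=1}^d(a_j,b_j)$ with $a_j<b_j$, $\lambda\in\mathbb R$, $T>0$, $\kappa\in\mathbb R$. For real-valued $V\in L^\infty(\Omega)$ consider the logarithmic Schrödinger equation with periodic boundary conditions $$ i\partial_t\psi=-\Delta\psi+B(\psi),\quad B(\phi):=V\phi+\lambda\ln(|\phi|^2)\phi \quad (0<t\le T),\qquad \psi(0)=\psi_0, $$ where $z\ln|z|^2:=0$ at $z=0$. An exact solution means $\psi\in C([0,T];H^2_{\rm per}(\Omega))\cap C^1([0,T];L^2(\Omega))$ satisfying this equation in $L^2(\Omega)$. Put $$ M(\psi,V):=\max\{\|\psi\|_{L^\infty([0,T];H^2)},\ \|\partial_t\psi\|_{L^\infty([0,T];L^2)},\ \|\psi\|_{L^\infty([0,T];L^\infty)},\ \|V\|_{L^\infty}\}. $$ For even positive integers $N_1,\dots,N_d$ let $h_j=(b_j-a_j)/N_j$ and $h=\max_j h_j$, and let $\mathcal T_N=\{l\in\mathbb Z^d:\ -N_j/2\le l_j\le N_j/2-1 \text{ for all } j\}$. Put $\mu_l=(2\pi l_j/(b_j-a_j))_{j=1}^d$,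 $\widehat\phi_l=|\Omega|^{-1}\int_\Omega\phi(x)e^{-i\mu_l\cdot(x-a)}\,dx$, and $\varphi_1(z)=(e^z-1)/z$ with $\varphi_1(0)=1$. For a time step $\tau>0$ and $t_n=n\tau$, the exponential wave integrator Fourier spectral (EWI-FS) approximations $\psi^n=\sum_{l\in\mathcal T_N}\widehat{(\psi^n)}_l\,e^{i\mu_l\cdot(x-a)}$ are defined by $$ \widehat{(\psi^0)}_l=\widehat{(\psi_0)}_l,\qquad \widehat{(\psi^{n+1})}_l=e^{-i\tau|\mu_l|^2}\widehat{(\psi^n)}_l-i\tau\varphi_1(-i\tau|\mu_l|^2)\,\widehat{B(\psi^n)}_l,\qquad l\in\mathcal T_N,\ n\ge0. $$ Theorem. For every $V\in L^\infty(\Omega)$ and every exact solution $\psi$ one has $M(\psi,V)<\infty$. Moreover, for every $M$ there are $\tau_0,h_0\in(0,e^{-1})$, depending only on $M$ and $T$ (and on the fixed data $\Omega,\lambda,\kappa$), such that for every $\tilde C>0$ there is a constant $C>0$, depending only on $M$, $T$, $\tilde C$ (and $\Omega,\lambda,\kappa$), for which the following holds. For all $V\in L^\infty(\Omega)$ and all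 exact solutions $\psi$ with $M(\psi,V)\le M$, and all meshes and time steps with $h\le\kappa\min_j h_j$ (when $d=1$, take $\kappa=1$ and this always holds), $$ 0<\tau<\tau_0,\qquad 0<h<h_0,\qquad \tau|\ln\tau|\le\tilde C\,h^2/|\ln h|, $$ one has for all integers $0\le n\le T/\tau$ $$ \|\psi(t_n)-\psi^n\|_{L^2}\le C\big(\tau|\ln\tau|^2+h^2|\ln h|\big),\qquad \|\psi^n\|_{H^2}\le C|\ln h|, $$ $$ \|\psi(t_n)-\psi^n\|_{H^1}\le C\big(\sqrt\tau\,|\ln\tau|+h|\ln h|\big). $$ -/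

import Mathlib

open MeasureTheory Filter Topology Set
open scoped ENNReal ContDiff

noncomputable section

namespace LogSE

/-- The open box `Ω = ∏ⱼ (aⱼ, bⱼ)` in `ℝ^d`. -/
def box {d : ℕ} (a b : Fin d → ℝ) : Set (Fin d → ℝ) :=
  Set.pi Set.univ fun j => Set.Ioo (a j) (b j)

/-- Lebesgue measure on the box. -/
def boxMeasure {d : ℕ} (a b : Fin d → ℝ) : Measure (Fin d → ℝ) :=
  volume.restrict (box a b)

/-- The space `L²(Ω)` of complex valued functions. -/
abbrev L2 {d : ℕ} (a b : Fin d → ℝ) : Type :=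
  Lp ℂ 2 (boxMeasure a b)

/-- Smooth functions on `ℝ^d` that are periodic with period `bⱼ - aⱼ` in the `j`-th variable. -/
def IsPeriodicTest {d : ℕ} (a b : Fin d → ℝ) (η : (Fin d → ℝ) → ℂ) : Prop :=
  ContDiff ℝ ∞ η ∧ ∀ (j : Fin d) (x : Fin d → ℝ), η (x + Pi.single j (b j - a j)) = η x

/-- `v ∈ L²(Ω)` is the weak derivative `∂_{s 0} ⋯ ∂_{s (k-1)} u` of `u ∈ L²(Ω)` on the box with
opposite faces identified. All smooth periodic functions are admitted as test functions (not only
those supported inside the box), so that the boundary values of `u` and of its derivatives have to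
match periodically. -/
def IsPerWeakDeriv {d : ℕ} (a b : Fin d → ℝ) {k : ℕ} (s : Fin k → Fin d)
    (u v : (Fin d → ℝ) → ℂ) : Prop :=
  MemLp u 2 (boxMeasure a b) ∧ MemLp v 2 (boxMeasure a b) ∧
    ∀ η : (Fin d → ℝ) → ℂ, IsPeriodicTest a b η →
      ∫ x, u x * iteratedFDeriv ℝ k η x (fun i => Pi.single (s i) (1 : ℝ)) ∂(boxMeasure a b)
        = (-1) ^ k * ∫ x, v x * η x ∂(boxMeasure a b)

/-- The norm of `H^m_per(Ω)` as an extended nonnegative number: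
`‖u‖²_{H^m} = ∑_{k ≤ m} ∑_{j₁, …, j_k} ‖∂_{j₁} ⋯ ∂_{j_k} u‖²_{L²}`.
Weak derivatives are unique almost everywhere, and an infimum over the empty set is `∞`, so the
value is finite exactly when `u ∈ H^m_per(Ω)`. -/
def sobolevNorm {d : ℕ} (a b : Fin d → ℝ) (m : ℕ) (u : (Fin d → ℝ) → ℂ) : ℝ≥0∞ :=
  (∑ k ∈ Finset.range (m + 1), ∑ s : Fin k → Fin d,
    ⨅ (v : (Fin d → ℝ) → ℂ) (_ : IsPerWeakDeriv a b s u v),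
      eLpNorm v 2 (boxMeasure a b) ^ 2) ^ (1 / 2 : ℝ)

/-- `w = Δ u` in the weak sense, with periodic boundary condition. -/
def IsPerLaplacian {d : ℕ} (a b : Fin d → ℝ) (u w : (Fin d → ℝ) → ℂ) : Prop :=
  ∃ D : Fin d → (Fin d → ℝ) → ℂ,
    (∀ j, IsPerWeakDeriv a b ![j, j] u (D j)) ∧ ∀ x, w x = ∑ j, D j x

/-- `B(φ) = V φ + λ ln(|φ|²) φ`, with `z ln |z|² = 0` at `z = 0`. -/
def opB {d : ℕ} (V : (Fin d → ℝ) → ℝ) (lam : ℝ) (φ : (Fin d → ℝ) → ℂ) :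
    (Fin d → ℝ) → ℂ :=
  fun x => (V x : ℂ) * φ x + (lam : ℂ) * (Real.log (‖φ x‖ ^ 2) : ℂ) * φ x

/-- `ψ ∈ C([0,T]; H²_per(Ω)) ∩ C¹([0,T]; L²(Ω))` solves
`i ∂ₜψ = -Δψ + V ψ + λ ln(|ψ|²) ψ` in `L²(Ω)` for `0 < t ≤ T`, with `ψ(0) = ψ₀`. -/
structure IsExactSolution {d : ℕ} (a b : Fin d → ℝ) (V : (Fin d → ℝ) → ℝ) (lam T : ℝ)
    (ψ₀ : L2 a b) (ψ : ℝ → L2 a b) : Prop where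
  mem_H2 : ∀ t ∈ Icc 0 T, sobolevNorm a b 2 (ψ t) < ⊤
  continuous_H2 : ∀ t ∈ Icc 0 T,
    Tendsto (fun s => sobolevNorm a b 2 (ψ s - ψ t)) (𝓝[Icc 0 T] t) (𝓝 0)
  contDiff_L2 : ContDiffOn ℝ 1 ψ (Icc 0 T)
  equation : ∀ t ∈ Ioc 0 T, ∃ w : (Fin d → ℝ) → ℂ, IsPerLaplacian a b (ψ t) w ∧
    ∀ᵐ x ∂(boxMeasure a b),
      Complex.I * (derivWithin ψ (Icc 0 T) t) x = -w x + opB V lam (ψ t) x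
  initial : ψ 0 = ψ₀

/-- `max {‖ψ‖_{L^∞([0,T];H²)}, ‖∂ₜψ‖_{L^∞([0,T];L²)}, ‖ψ‖_{L^∞([0,T];L^∞)}, ‖V‖_{L^∞}}`. -/
def solutionBound {d : ℕ} (a b : Fin d → ℝ) (V : (Fin d → ℝ) → ℝ) (T : ℝ)
    (ψ : ℝ → L2 a b) : ℝ≥0∞ :=
  max (max (⨆ t ∈ Icc 0 T, sobolevNorm a b 2 (ψ t))
      (⨆ t ∈ Icc 0 T, ‖derivWithin ψ (Icc 0 T) t‖ₑ))
    (max (⨆ t ∈ Icc 0 T, eLpNorm (ψ t) ∞ (boxMeasure a b))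
      (eLpNorm V ∞ (boxMeasure a b)))

/-- The frequency `μ_l`, with components `2 π l_j / (b_j - a_j)`. -/
def freq {d : ℕ} (a b : Fin d → ℝ) (l : Fin d → ℤ) (j : Fin d) : ℝ :=
  2 * Real.pi * (l j : ℝ) / (b j - a j)

/-- `|μ_l|²`. -/
def freqSq {d : ℕ} (a b : Fin d → ℝ) (l : Fin d → ℤ) : ℝ :=
  ∑ j, freq a b l j ^ 2

/-- The Fourier mode `e^{i μ_l · (x - a)}`. -/
def mode {d : ℕ} (a b : Fin d → ℝ) (l : Fin d → ℤ) (x : Fin d → ℝ) : ℂ :=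
  Complex.exp (Complex.I * ((∑ j, freq a b l j * (x j - a j) : ℝ) : ℂ))

/-- The Fourier coefficient `|Ω|⁻¹ ∫_Ω φ(x) e^{-i μ_l · (x - a)} dx`. -/
def fourierCoef {d : ℕ} (a b : Fin d → ℝ) (φ : (Fin d → ℝ) → ℂ) (l : Fin d → ℤ) : ℂ :=
  ((∏ j, (b j - a j) : ℝ) : ℂ)⁻¹ *
    ∫ x, φ x * Complex.exp (-Complex.I * ((∑ j, freq a b l j * (x j - a j) : ℝ) : ℂ))
      ∂(boxMeasure a b)

/-- The frequency indices `-N_j/2 ≤ l_j ≤ N_j/2 - 1` (used for even `N_j`). -/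
def freqIndex {d : ℕ} (N : Fin d → ℕ) : Finset (Fin d → ℤ) :=
  Fintype.piFinset fun j => Finset.Ico (-((N j / 2 : ℕ) : ℤ)) ((N j / 2 : ℕ) : ℤ)

/-- The mesh size in the `j`-th direction. -/
def meshWidth {d : ℕ} (a b : Fin d → ℝ) (N : Fin d → ℕ) (j : Fin d) : ℝ :=
  (b j - a j) / (N j : ℝ)

/-- The mesh size `h`, the largest of the mesh sizes in the coordinate directions. -/
def meshSize {d : ℕ} (a b : Fin d → ℝ) (N : Fin d → ℕ) : ℝ :=
  ⨆ j, meshWidth a b N j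

/-- `φ₁(z) = (e^z - 1) / z`, with `φ₁(0) = 1`. -/
def phi1 (z : ℂ) : ℂ :=
  if z = 0 then 1 else (Complex.exp z - 1) / z

/-- The exponential wave integrator Fourier spectral method with time step `τ`. -/
def ewiFS {d : ℕ} (a b : Fin d → ℝ) (V : (Fin d → ℝ) → ℝ) (lam : ℝ) (N : Fin d → ℕ) (τ : ℝ)
    (ψ₀ : (Fin d → ℝ) → ℂ) : ℕ → (Fin d → ℝ) → ℂ
  | 0 => fun x => ∑ l ∈ freqIndex N, fourierCoef a b ψ₀ l * mode a b l x
  | n + 1 => fun x => ∑ l ∈ freqIndex N,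
      (Complex.exp (-Complex.I * (τ : ℂ) * (freqSq a b l : ℂ)) *
          fourierCoef a b (ewiFS a b V lam N τ ψ₀ n) l
        - Complex.I * (τ : ℂ) * phi1 (-Complex.I * (τ : ℂ) * (freqSq a b l : ℂ)) *
          fourierCoef a b (opB V lam (ewiFS a b V lam N τ ψ₀ n)) l) * mode a b l x

end LogSE

end

open LogSE

/-! On the Fourier side one step of the scheme is a diagonal unitary map plus `-iτφ₁` times the
projected nonlinearity, so everything is an estimate for finite vectors of coefficients. The
obstacle is that `z ln|z|²` is not Lipschitz at `0`. Two facts replace the Lipschitz bound. The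
Cazenave–Haraux inequality bounds the imaginary part of `conj (u - v) * (B u - B v)` by `2|λ||u -
v|²` with no logarithm. In modulus, `|B u - B v| ≤ KΛ(|u - v| + ε)`, where `Λ ≥ 1` dominates `|ln
ε|` and the logarithm of a common bound of `|u|` and `|v|` (`norm_opB_sub_le`).

Stability (`norm_sq_ewiStep_opB_le`). In the square of the norm of the difference of two steps, the
term of order `τ` is exactly the imaginary part above, up to replacing `e^{iθ}φ₁(-iθ)` by `1`, which
costs `2|θ|` with `θ = τ|μ_l|² ≲ τ/h²`. The remainders are of size `τ·(τ/h²)·KΛ` and `τ²(KΛ)²`. With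
`ε = τ` and `Λ ~ |ln τ|` both are `O(τ)`, because `τ|ln τ| ≲ h²` and `τ|ln τ|² ≤ 4`. So the
amplification factor is `1 + O(τ)`.

A priori bound (`norm_scheme_le`). `Λ` must contain the logarithm of the maximum of the numerical
solution. The inverse inequality bounds that maximum by `h^{-3/2}` times the `L²` norm, and the
logarithm of `h^{-3/2}` is `O(|ln τ|)`. The `L²` norm is bounded by comparison with the zero
solution: since only its logarithm `Z` enters the growth rate, a bound of the form `e^Z` is
reproduced with `Z` multiplied by `1 + O(τ)`. This bounds the norm doubly exponentially in `T`,
without any smallness of `τ` and `h` depending on `M`.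

Consistency (`norm_consistency_le`). By Duhamel's formula the local error is `τ` times the variation
of `B(ψ)` over a step, `O(τ|ln τ|)`, plus the effect of projecting the argument of `B`, `O(h²|ln
h|)`. Gronwall's inequality gives the coefficient error `O(τ|ln τ| + h²|ln h|)`. The Sobolev bounds
follow by splitting frequencies: inverse inequalities on the resolved modes, `H²` regularity of `ψ`
on the others.

Finiteness of `M(ψ, V)` comes from compactness of `[0,T]` and from the embedding of `H²` in `L^∞`,
which needs `d ≤ 3`. -/

noncomputable section

/-! ### The box, its parametrization by the torus, and Parseval's identity. -/

namespace LogSE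

/-- The volume of the box. -/
def boxVol {d : ℕ} (a b : Fin d → ℝ) : ℝ := ∏ j, (b j - a j)

lemma boxVol_pos {d : ℕ} {a b : Fin d → ℝ} (hab : ∀ j, a j < b j) : 0 < boxVol a b :=
  Finset.prod_pos fun j _ => sub_pos.2 (hab j)

/-- The affine parametrization of the box by the unit box. -/
def boxAffine {d : ℕ} (a b : Fin d → ℝ) (x : Fin d → ℝ) : Fin d → ℝ :=
  fun j => a j + (b j - a j) * x j

lemma measurable_boxAffine {d : ℕ} (a b : Fin d → ℝ) : Measurable (boxAffine a b) := by
  unfold boxAffine; fun_prop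

/-- Affine change of variables with determinant `boxVol a b`. The half-open cell is the fundamental
domain used for the torus; it differs from the open one by a null set. -/
lemma boxMeasure_eq_map {d : ℕ} {a b : Fin d → ℝ} (hab : ∀ j, a j < b j) :
    boxMeasure a b = ENNReal.ofReal (boxVol a b) •
      Measure.map (boxAffine a b)
        (volume.restrict {x : Fin d → ℝ | ∀ i, x i ∈ Ioc (0 : ℝ) (0 + 1)}) := by
  classical
  have hpos := boxVol_pos hab
  have hdet : Matrix.det (Matrix.diagonal fun j => b j - a j) = boxVol a b := by
    simp [boxVol, Matrix.det_diagonal]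
  have h1 := Real.smul_map_diagonal_volume_pi (D := fun j => b j - a j)
    (by rw [hdet]; exact hpos.ne')
  rw [hdet, abs_of_pos hpos] at h1
  have h2 : Measure.map (fun x => a + x) (volume : Measure (Fin d → ℝ)) = volume :=
    (measurePreserving_add_left volume a).map_eq
  have hm : Measurable (Matrix.toLin' (Matrix.diagonal fun j => b j - a j)) :=
    (LinearMap.continuous_on_pi _).measurable
  have h3 : (volume : Measure (Fin d → ℝ)) = ENNReal.ofReal (boxVol a b) •
      Measure.map (boxAffine a b) volume := by
    conv_lhs => rw [← h2, ← h1]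
    rw [Measure.map_smul, Measure.map_map (by fun_prop) hm]
    congr 2
    ext x j
    simp [boxAffine, Matrix.mulVec_diagonal]
  have hbox : MeasurableSet (box a b) := MeasurableSet.univ_pi fun _ => measurableSet_Ioo
  unfold boxMeasure
  conv_lhs => rw [h3]
  rw [Measure.restrict_smul, Measure.restrict_map (measurable_boxAffine a b) hbox]
  congr 2
  apply Measure.restrict_congr_set
  have h4 : boxAffine a b ⁻¹' box a b = Set.pi univ fun _ => Ioo (0 : ℝ) 1 := by
    ext x
    simp only [boxAffine, box, mem_preimage, Set.mem_pi, mem_univ, true_imp_iff, mem_Ioo]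
    refine forall_congr' fun j => ?_
    have := sub_pos.2 (hab j)
    constructor
    · rintro ⟨h, h'⟩
      exact ⟨by nlinarith, by nlinarith⟩
    · rintro ⟨h, h'⟩
      exact ⟨by nlinarith, by nlinarith⟩
  have h5 : {x : Fin d → ℝ | ∀ i, x i ∈ Ioc (0 : ℝ) (0 + 1)}
      = Set.pi univ fun _ => Ioc (0 : ℝ) 1 := by
    ext x; simp
  rw [h4, h5]
  exact Measure.univ_pi_Ioo_ae_eq_Icc.trans Measure.univ_pi_Ioc_ae_eq_Icc.symm

lemma integral_boxMeasure {d : ℕ} {a b : Fin d → ℝ} (hab : ∀ j, a j < b j)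
    {f : (Fin d → ℝ) → ℂ} (hf : StronglyMeasurable f) :
    ∫ x, f x ∂(boxMeasure a b) = (boxVol a b : ℂ) *
      ∫ x in {x : Fin d → ℝ | ∀ i, x i ∈ Ioc (0 : ℝ) (0 + 1)}, f (boxAffine a b x) := by
  rw [boxMeasure_eq_map hab, integral_smul_measure, ENNReal.toReal_ofReal (boxVol_pos hab).le,
    integral_map (measurable_boxAffine a b).aemeasurable hf.aestronglyMeasurable]
  simp

lemma lintegral_boxMeasure {d : ℕ} {a b : Fin d → ℝ} (hab : ∀ j, a j < b j)
    {f : (Fin d → ℝ) → ℝ≥0∞} (hf : Measurable f) :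
    ∫⁻ x, f x ∂(boxMeasure a b) = ENNReal.ofReal (boxVol a b) *
      ∫⁻ x in {x : Fin d → ℝ | ∀ i, x i ∈ Ioc (0 : ℝ) (0 + 1)}, f (boxAffine a b x) := by
  rw [boxMeasure_eq_map hab, lintegral_smul_measure,
    lintegral_map hf (measurable_boxAffine a b)]
  simp

lemma eLpNorm_two_sq {α : Type*} [MeasurableSpace α] {μ : Measure α} (f : α → ℂ) :
    eLpNorm f 2 μ ^ 2 = ∫⁻ x, ‖f x‖ₑ ^ 2 ∂μ := by
  have := eLpNorm_nnreal_pow_eq_lintegral (μ := μ) (f := f) (p := 2) (by norm_num)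
  simpa using this

lemma fourierCoef_congr {d : ℕ} {a b : Fin d → ℝ} {f g : (Fin d → ℝ) → ℂ}
    (h : f =ᵐ[boxMeasure a b] g) (l : Fin d → ℤ) : fourierCoef a b f l = fourierCoef a b g l := by
  unfold fourierCoef
  congr 1
  apply integral_congr_ae
  filter_upwards [h] with x hx
  rw [hx]

section Torus

local instance : MeasureSpace UnitAddCircle := ⟨AddCircle.haarAddCircle⟩

/-- The parametrization of the box by the torus. -/
def boxOfTorus {d : ℕ} (a b : Fin d → ℝ) (θ : UnitAddTorus (Fin d)) : Fin d → ℝ :=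
  boxAffine a b fun j => (AddCircle.equivIoc (1 : ℝ) 0 (θ j)).1

lemma measurable_boxOfTorus {d : ℕ} (a b : Fin d → ℝ) : Measurable (boxOfTorus a b) :=
  (measurable_boxAffine a b).comp (measurable_pi_lambda _ fun j =>
    measurable_subtype_coe.comp
      ((AddCircle.measurableEquivIoc (1 : ℝ) 0).measurable.comp (measurable_pi_apply j)))

lemma boxOfTorus_coe {d : ℕ} (a b : Fin d → ℝ) {x : Fin d → ℝ}
    (hx : x ∈ {x : Fin d → ℝ | ∀ i, x i ∈ Ioc (0 : ℝ) (0 + 1)}) :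
    boxOfTorus a b (fun i => (x i : UnitAddCircle)) = boxAffine a b x := by
  unfold boxOfTorus
  congr 1
  ext j
  rw [AddCircle.equivIoc_coe_of_mem]
  exact hx j

/-- Transport to the torus, where Parseval's identity is known. Strong measurability makes `u ∘
boxOfTorus` measurable without following null sets; `parseval` removes it by choosing a
representative. -/
lemma parseval_of_stronglyMeasurable {d : ℕ} {a b : Fin d → ℝ} (hab : ∀ j, a j < b j)
    {u : (Fin d → ℝ) → ℂ} (hu : StronglyMeasurable u) (hu2 : MemLp u 2 (boxMeasure a b)) :
    ENNReal.ofReal (boxVol a b) * ∑' l, ‖fourierCoef a b u l‖ₑ ^ 2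
      = eLpNorm u 2 (boxMeasure a b) ^ 2 := by
  have hvol := boxVol_pos hab
  set U : UnitAddTorus (Fin d) → ℂ := fun θ => u (boxOfTorus a b θ) with hU
  have hUm : StronglyMeasurable U := hu.comp_measurable (measurable_boxOfTorus a b)
  have hset : MeasurableSet {x : Fin d → ℝ | ∀ i, x i ∈ Ioc (0 : ℝ) (0 + 1)} :=
    MeasurableSet.univ_pi' fun i => measurableSet_Ioc
  have hnorm : ENNReal.ofReal (boxVol a b) * ∫⁻ θ, ‖U θ‖ₑ ^ 2
      = eLpNorm u 2 (boxMeasure a b) ^ 2 := by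
    rw [eLpNorm_two_sq, lintegral_boxMeasure hab (hu.measurable.enorm.pow_const 2),
      UnitAddTorus.lintegral_preimage _ (0 : Fin d → ℝ)]
    congr 1
    refine setLIntegral_congr_fun hset fun x hx => ?_
    simp only [hU]
    rw [boxOfTorus_coe a b hx]
  have hU2 : MemLp U 2 := by
    refine ⟨hUm.aestronglyMeasurable, ?_⟩
    have h1 : eLpNorm U 2 volume ^ 2 < ⊤ := by
      rw [eLpNorm_two_sq]
      have h2 : ENNReal.ofReal (boxVol a b) * ∫⁻ θ, ‖U θ‖ₑ ^ 2 < ⊤ := by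
        rw [hnorm]; exact ENNReal.pow_lt_top hu2.2
      exact ENNReal.lt_top_of_mul_ne_top_right h2.ne (by simpa using hvol)
    by_contra h
    rw [not_lt, top_le_iff] at h
    simp [h] at h1
  have hcoef : ∀ l, UnitAddTorus.mFourierCoeff U l = fourierCoef a b u l := by
    intro l
    rw [UnitAddTorus.mFourierCoeff_eq_integral U l 0]
    unfold fourierCoef
    rw [integral_boxMeasure hab, ← mul_assoc]
    · have : (((∏ j, (b j - a j) : ℝ) : ℂ)⁻¹ * (boxVol a b : ℂ)) = 1 := by
        unfold boxVol
        apply inv_mul_cancel₀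
        exact_mod_cast hvol.ne'
      rw [this, one_mul]
      refine setIntegral_congr_fun hset fun x hx => ?_
      simp only [hU, smul_eq_mul]
      rw [boxOfTorus_coe a b hx, mul_comm]
      congr 1
      simp only [UnitAddTorus.mFourier, ContinuousMap.coe_mk, fourier_coe_apply]
      rw [← Complex.exp_sum]
      congr 1
      push_cast
      rw [Finset.mul_sum]
      refine Finset.sum_congr rfl fun j _ => ?_
      have hj : ((b j : ℂ) - a j) ≠ 0 := by
        exact_mod_cast (sub_pos.2 (hab j)).ne'
      simp only [freq, boxAffine, Pi.neg_apply]
      push_cast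
      field_simp
      ring
    · refine hu.mul (Continuous.stronglyMeasurable ?_)
      fun_prop
  have hsum := UnitAddTorus.hasSum_sq_mFourierCoeff (hU2.toLp U)
  have hcoef' : ∀ l, UnitAddTorus.mFourierCoeff (hU2.toLp U) l = fourierCoef a b u l := by
    intro l
    rw [← hcoef]
    unfold UnitAddTorus.mFourierCoeff
    apply integral_congr_ae
    filter_upwards [hU2.coeFn_toLp] with θ hθ
    rw [hθ]
  simp only [hcoef'] at hsum
  rw [← hnorm]
  congr 1
  have h3 : ∑' l, ‖fourierCoef a b u l‖ₑ ^ 2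
      = ENNReal.ofReal (∑' l, ‖fourierCoef a b u l‖ ^ 2) := by
    rw [ENNReal.ofReal_tsum_of_nonneg (fun _ => by positivity) hsum.summable]
    refine tsum_congr fun l => ?_
    rw [ENNReal.ofReal_pow (norm_nonneg _), ofReal_norm]
  rw [h3, hsum.tsum_eq, ofReal_integral_eq_lintegral_ofReal]
  · refine lintegral_congr_ae ?_
    filter_upwards [hU2.coeFn_toLp] with θ hθ
    rw [hθ, ENNReal.ofReal_pow (norm_nonneg _), ofReal_norm]
  · exact (memLp_two_iff_integrable_sq_norm (Lp.aestronglyMeasurable _)).1 (Lp.memLp _)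
  · exact ae_of_all _ fun _ => by positivity

end Torus

/-- Parseval's identity on the box. -/
lemma parseval {d : ℕ} {a b : Fin d → ℝ} (hab : ∀ j, a j < b j)
    {u : (Fin d → ℝ) → ℂ} (hu : MemLp u 2 (boxMeasure a b)) :
    ENNReal.ofReal (boxVol a b) * ∑' l, ‖fourierCoef a b u l‖ₑ ^ 2
      = eLpNorm u 2 (boxMeasure a b) ^ 2 := by
  have h := hu.1.ae_eq_mk
  have h2 : MemLp (hu.1.mk u) 2 (boxMeasure a b) := hu.ae_eq h
  have h3 := parseval_of_stronglyMeasurable hab hu.1.stronglyMeasurable_mk h2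
  rw [eLpNorm_congr_ae h, ← h3]
  simp only [fourierCoef_congr h]

end LogSE

end

/-! ### Fourier modes, periodic weak derivatives, and Sobolev norms as weighted sums. -/

noncomputable section

namespace LogSE

variable {d : ℕ} {a b : Fin d → ℝ}

lemma isCompact_closedBox (a b : Fin d → ℝ) : IsCompact (Icc a b) := isCompact_Icc

lemma boxMeasure_eq_restrict_Icc (a b : Fin d → ℝ) :
    boxMeasure a b = volume.restrict (Icc a b) :=
  Measure.restrict_congr_set Measure.univ_pi_Ioo_ae_eq_Icc

instance (a b : Fin d → ℝ) : IsFiniteMeasure (boxMeasure a b) := by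
  rw [boxMeasure_eq_restrict_Icc]
  exact ⟨by rw [Measure.restrict_apply_univ]; exact (isCompact_closedBox a b).measure_lt_top⟩

lemma boxMeasure_univ (hab : ∀ j, a j < b j) :
    boxMeasure a b univ = ENNReal.ofReal (boxVol a b) := by
  rw [boxMeasure_eq_restrict_Icc, Measure.restrict_apply_univ, Real.volume_Icc_pi, boxVol,
    ENNReal.ofReal_prod_of_nonneg fun j _ => (sub_pos.2 (hab j)).le]

lemma memLp_of_continuous {f : (Fin d → ℝ) → ℂ} (hf : Continuous f) (p : ℝ≥0∞) :
    MemLp f p (boxMeasure a b) := by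
  obtain ⟨C, hC⟩ := (isCompact_closedBox a b).exists_bound_of_continuousOn hf.continuousOn
  refine MemLp.of_bound hf.aestronglyMeasurable C ?_
  rw [boxMeasure_eq_restrict_Icc]
  exact (ae_restrict_mem measurableSet_Icc).mono hC

lemma integrable_of_continuous {f : (Fin d → ℝ) → ℂ} (hf : Continuous f) :
    Integrable f (boxMeasure a b) :=
  memLp_one_iff_integrable.1 (memLp_of_continuous hf 1)

/-- Divergence theorem for the field whose only component is `f`, in direction `j`: opposite faces
cancel by periodicity. Applied to products with a mode, this is the only integration by parts
needed. -/
lemma integral_fderiv_periodic (hab : ∀ j, a j < b j) {f : (Fin d → ℝ) → ℂ}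
    (hf : IsPeriodicTest a b f) (j : Fin d) :
    ∫ x, fderiv ℝ f x (Pi.single j 1) ∂(boxMeasure a b) = 0 := by
  cases d with
  | zero => exact j.elim0
  | succ n =>
    have hdiff : Differentiable ℝ f := hf.1.differentiable (by simp)
    have hcont : Continuous fun x => fderiv ℝ f x (Pi.single j (1 : ℝ)) :=
      (hf.1.continuous_fderiv (by simp)).clm_apply continuous_const
    have key := integral_divergence_of_hasFDerivAt_off_countable' a b (fun i => (hab i).le)
      (fun i x => if i = j then f x else 0) (fun i x => if i = j then fderiv ℝ f x else 0) ∅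
      countable_empty
      (fun i => by
        by_cases h : i = j
        · simpa [h] using hdiff.continuous.continuousOn
        · simpa [h] using continuousOn_const)
      (fun x _ i => by
        by_cases h : i = j
        · simpa [h] using (hdiff x).hasFDerivAt
        · simpa [h] using hasFDerivAt_const (0 : ℂ) x)
      (by
        have : (fun x => ∑ i : Fin (n + 1),
            (if i = j then fderiv ℝ f x else 0) (Pi.single i (1 : ℝ)))
            = fun x => fderiv ℝ f x (Pi.single j (1 : ℝ)) := by
          ext x
          rw [Finset.sum_eq_single j]
          · simp
          · intro i _ hi; simp [hi]
          · simp
        rw [this]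
        exact hcont.continuousOn.integrableOn_compact (isCompact_closedBox a b))
    rw [boxMeasure_eq_restrict_Icc]
    have h1 : ∀ x, ∑ i : Fin (n + 1),
            (if i = j then fderiv ℝ f x else 0) (Pi.single i (1 : ℝ))
            = fderiv ℝ f x (Pi.single j (1 : ℝ)) := by
      intro x
      rw [Finset.sum_eq_single j]
      · simp
      · intro i _ hi; simp [hi]
      · simp
    simp only [h1] at key
    rw [key]
    refine Finset.sum_eq_zero fun i _ => ?_
    by_cases h : i = j
    · subst h
      rw [sub_eq_zero]
      simp only [if_true]
      refine integral_congr_ae (ae_of_all _ fun x => ?_)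
      have : i.insertNth (b i) x = (i.insertNth (a i) x : Fin (n + 1) → ℝ)
          + Pi.single i (b i - a i) := by
        ext k
        refine Fin.succAboveCases i ?_ (fun k => ?_) k
        · simp
        · simp
      simp only [this]
      exact hf.2 i _
    · simp [h]

lemma freq_neg (l : Fin d → ℤ) (j : Fin d) : freq a b (-l) j = -freq a b l j := by
  simp [freq, neg_div]

lemma mode_add (l m : Fin d → ℤ) (x : Fin d → ℝ) :
    mode a b (l + m) x = mode a b l x * mode a b m x := by
  unfold mode
  rw [← Complex.exp_add, ← mul_add, ← Complex.ofReal_add, ← Finset.sum_add_distrib]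
  congr 3
  refine Finset.sum_congr rfl fun j _ => ?_
  simp only [freq, Pi.add_apply]
  push_cast
  ring

lemma mode_zero (x : Fin d → ℝ) : mode a b 0 x = 1 := by
  simp [mode, freq]

lemma norm_mode (l : Fin d → ℤ) (x : Fin d → ℝ) : ‖mode a b l x‖ = 1 := by
  unfold mode
  rw [Complex.norm_exp_I_mul_ofReal]

lemma mode_neg (l : Fin d → ℤ) (x : Fin d → ℝ) :
    mode a b (-l) x = Complex.exp (-Complex.I * ((∑ j, freq a b l j * (x j - a j) : ℝ) : ℂ)) := by
  unfold mode
  simp only [freq_neg, neg_mul, Finset.sum_neg_distrib]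
  push_cast
  ring_nf

lemma conj_mode (l : Fin d → ℤ) (x : Fin d → ℝ) :
    (starRingEnd ℂ) (mode a b l x) = mode a b (-l) x := by
  rw [mode_neg, mode, ← Complex.exp_conj]
  simp

lemma fourierCoef_eq (f : (Fin d → ℝ) → ℂ) (l : Fin d → ℤ) :
    fourierCoef a b f l
      = (boxVol a b : ℂ)⁻¹ * ∫ x, f x * mode a b (-l) x ∂(boxMeasure a b) := by
  simp only [mode_neg]; rfl

lemma contDiff_mode (l : Fin d → ℤ) : ContDiff ℝ ∞ (mode a b l) := by
  unfold mode
  have h : ContDiff ℝ ∞ fun x : Fin d → ℝ => ((∑ j, freq a b l j * (x j - a j) : ℝ) : ℂ) := by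
    have h' : ContDiff ℝ ∞ fun x : Fin d → ℝ => ∑ j, freq a b l j * (x j - a j) :=
      ContDiff.sum fun j _ => contDiff_const.mul ((contDiff_apply ℝ ℝ j).sub contDiff_const)
    exact Complex.ofRealCLM.contDiff.comp h'
  exact (contDiff_const.mul h).cexp

lemma continuous_mode (l : Fin d → ℤ) : Continuous (mode a b l) := (contDiff_mode l).continuous

lemma isPeriodicTest_mode (hab : ∀ j, a j < b j) (l : Fin d → ℤ) :
    IsPeriodicTest a b (mode a b l) := by
  refine ⟨contDiff_mode l, fun j x => ?_⟩
  unfold mode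
  rw [Complex.exp_eq_exp_iff_exists_int]
  refine ⟨l j, ?_⟩
  have h : ∑ i, freq a b l i * ((x + Pi.single j (b j - a j) : Fin d → ℝ) i - a i)
      = ∑ i, freq a b l i * (x i - a i) + 2 * Real.pi * l j := by
    have : ∀ i, freq a b l i * ((x + Pi.single j (b j - a j) : Fin d → ℝ) i - a i)
        = freq a b l i * (x i - a i)
          + freq a b l i * (Pi.single j (b j - a j) : Fin d → ℝ) i := by
      intro i; simp only [Pi.add_apply]; ring
    simp only [this, Finset.sum_add_distrib]
    congr 1
    rw [Finset.sum_eq_single j]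
    · have := (sub_pos.2 (hab j)).ne'
      simp only [Pi.single_eq_same, freq]
      field_simp
    · intro i _ hi
      simp [Pi.single_eq_of_ne hi]
    · simp
  rw [h]
  push_cast
  ring

lemma fderiv_mode (l : Fin d → ℤ) (x : Fin d → ℝ) (j : Fin d) :
    fderiv ℝ (mode a b l) x (Pi.single j 1) = Complex.I * freq a b l j * mode a b l x := by
  have hline : HasDerivAt (fun t : ℝ => mode a b l (x + t • Pi.single j (1 : ℝ)))
      (Complex.I * freq a b l j * mode a b l x) 0 := by
    have h1 : ∀ t : ℝ, mode a b l (x + t • Pi.single j (1 : ℝ))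
        = Complex.exp (Complex.I * ((∑ i, freq a b l i * (x i - a i) : ℝ) : ℂ)
          + Complex.I * freq a b l j * t) := by
      intro t
      unfold mode
      congr 1
      rw [mul_assoc, ← mul_add]
      congr 1
      rw [← Complex.ofReal_mul, ← Complex.ofReal_add]
      congr 1
      have : ∀ i, freq a b l i * ((x + t • Pi.single j (1 : ℝ) : Fin d → ℝ) i - a i)
          = freq a b l i * (x i - a i)
            + freq a b l i * (t * (Pi.single j (1 : ℝ) : Fin d → ℝ) i) := by
        intro i; simp only [Pi.add_apply, Pi.smul_apply, smul_eq_mul]; ring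
      simp only [this, Finset.sum_add_distrib]
      congr 1
      rw [Finset.sum_eq_single j]
      · simp
      · intro i _ hi
        simp [Pi.single_eq_of_ne hi]
      · simp
    simp only [h1]
    have h2 : HasDerivAt (fun t : ℝ => Complex.I * ((∑ i, freq a b l i * (x i - a i) : ℝ) : ℂ)
          + Complex.I * freq a b l j * (t : ℂ)) (Complex.I * freq a b l j * 1) 0 :=
      ((hasDerivAt_id (0 : ℝ)).ofReal_comp.const_mul _).const_add _
    have h3 := h2.cexp
    unfold mode
    convert h3 using 1
    simp
    ring
  have hd : HasFDerivAt (mode a b l) (fderiv ℝ (mode a b l) x) x :=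
    ((contDiff_mode l).differentiable (by simp) x).hasFDerivAt
  have h4 := hd.hasLineDerivAt (Pi.single j (1 : ℝ))
  exact h4.unique hline

lemma IsPeriodicTest.mul {f g : (Fin d → ℝ) → ℂ} (hf : IsPeriodicTest a b f)
    (hg : IsPeriodicTest a b g) : IsPeriodicTest a b fun x => f x * g x :=
  ⟨hf.1.mul hg.1, fun j x => by simp only [hf.2 j x, hg.2 j x]⟩

lemma IsPeriodicTest.fderiv {f : (Fin d → ℝ) → ℂ} (hf : IsPeriodicTest a b f) (v : Fin d → ℝ) :
    IsPeriodicTest a b fun x => fderiv ℝ f x v := by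
  refine ⟨(hf.1.fderiv_right (by simp)).clm_apply contDiff_const, fun j x => ?_⟩
  dsimp only
  rw [← fderiv_comp_add_right]
  simp only [hf.2 j]

/-- Peeling off the outermost derivative reduces inductions on the order to first derivatives of
periodic test functions. -/
lemma iteratedFDeriv_succ_eq {f : (Fin d → ℝ) → ℂ} (hf : ContDiff ℝ ∞ f) {k : ℕ}
    (m : Fin (k + 1) → Fin d → ℝ) (x : Fin d → ℝ) :
    iteratedFDeriv ℝ (k + 1) f x m
      = fderiv ℝ (fun y => iteratedFDeriv ℝ k f y (Fin.tail m)) x (m 0) := by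
  rw [iteratedFDeriv_succ_apply_left, fderiv_continuousMultilinear_apply_const_apply]
  exact (hf.iteratedFDeriv_right (m := 1) (by exact_mod_cast le_top)).differentiable (by simp) x

lemma IsPeriodicTest.iteratedFDeriv {f : (Fin d → ℝ) → ℂ} (hf : IsPeriodicTest a b f) {k : ℕ}
    (m : Fin k → Fin d → ℝ) : IsPeriodicTest a b fun x => iteratedFDeriv ℝ k f x m := by
  induction k with
  | zero => simpa using hf
  | succ k ih =>
    have : (fun x => _root_.iteratedFDeriv ℝ (k + 1) f x m) = fun x =>
        _root_.fderiv ℝ (fun y => _root_.iteratedFDeriv ℝ k f y (Fin.tail m)) x (m 0) :=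
      funext fun x => iteratedFDeriv_succ_eq hf.1 m x
    rw [this]
    exact (ih (Fin.tail m)).fderiv (m 0)

lemma iteratedFDeriv_mode (l : Fin d → ℤ) {k : ℕ} (s : Fin k → Fin d) (x : Fin d → ℝ) :
    iteratedFDeriv ℝ k (mode a b l) x (fun i => Pi.single (s i) (1 : ℝ))
      = (∏ i, Complex.I * freq a b l (s i)) * mode a b l x := by
  induction k generalizing x with
  | zero => simp
  | succ k ih =>
    rw [iteratedFDeriv_succ_eq (contDiff_mode l)]
    have : (fun y => iteratedFDeriv ℝ k (mode a b l) y
        (Fin.tail fun i => (Pi.single (s i) (1 : ℝ) : Fin d → ℝ)))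
        = fun y => (∏ i, Complex.I * freq a b l (s (Fin.succ i))) * mode a b l y := by
      ext y
      exact ih (fun i => s i.succ) y
    rw [this, fderiv_const_mul ((contDiff_mode l).differentiable (by simp) x)]
    simp only [smul_apply, fderiv_mode, Fin.prod_univ_succ, smul_eq_mul]
    ring

lemma integral_mode_mul_fderiv (hab : ∀ j, a j < b j) (l : Fin d → ℤ) {η : (Fin d → ℝ) → ℂ}
    (hη : IsPeriodicTest a b η) (j : Fin d) :
    ∫ x, mode a b l x * fderiv ℝ η x (Pi.single j 1) ∂(boxMeasure a b)
      = -(Complex.I * freq a b l j) * ∫ x, mode a b l x * η x ∂(boxMeasure a b) := by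
  have h := integral_fderiv_periodic hab ((isPeriodicTest_mode hab l).mul hη) j
  have h1 : ∀ x, fderiv ℝ (fun x => mode a b l x * η x) x (Pi.single j 1)
      = mode a b l x * fderiv ℝ η x (Pi.single j 1)
        + Complex.I * freq a b l j * (mode a b l x * η x) := by
    intro x
    rw [fderiv_fun_mul ((contDiff_mode l).differentiable (by simp) x)
      (hη.1.differentiable (by simp) x)]
    simp only [add_apply, smul_apply, fderiv_mode,
      smul_eq_mul]
    ring
  simp only [h1] at h
  rw [integral_add, integral_const_mul] at h
  · linear_combination h
  · exact integrable_of_continuous ((continuous_mode l).mul (hη.fderiv _).1.continuous)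
  · exact integrable_of_continuous
      (continuous_const.mul ((continuous_mode l).mul hη.1.continuous))

lemma integral_mode_mul_iteratedFDeriv (hab : ∀ j, a j < b j) (l : Fin d → ℤ)
    {η : (Fin d → ℝ) → ℂ} (hη : IsPeriodicTest a b η) {k : ℕ} (s : Fin k → Fin d) :
    ∫ x, mode a b l x * iteratedFDeriv ℝ k η x (fun i => Pi.single (s i) (1 : ℝ))
        ∂(boxMeasure a b)
      = (-1) ^ k * ((∏ i, Complex.I * freq a b l (s i))
        * ∫ x, mode a b l x * η x ∂(boxMeasure a b)) := by
  induction k with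
  | zero => simp
  | succ k ih =>
    simp only [iteratedFDeriv_succ_eq hη.1]
    have h1 := integral_mode_mul_fderiv hab l
      (hη.iteratedFDeriv (Fin.tail fun i => (Pi.single (s i) (1 : ℝ) : Fin d → ℝ))) (s 0)
    rw [h1]
    have h2 := ih fun i => s i.succ
    unfold Fin.tail
    rw [h2, Fin.prod_univ_succ]
    ring

lemma integral_mode (hab : ∀ j, a j < b j) (l : Fin d → ℤ) :
    ∫ x, mode a b l x ∂(boxMeasure a b) = if l = 0 then (boxVol a b : ℂ) else 0 := by
  split_ifs with h
  · subst h
    simp only [mode_zero]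
    rw [integral_const, Measure.real, boxMeasure_univ hab,
      ENNReal.toReal_ofReal (boxVol_pos hab).le]
    simp
  · obtain ⟨j, hj⟩ : ∃ j, l j ≠ 0 := by
      by_contra! h'
      exact h (funext h')
    have h1 := integral_fderiv_periodic hab (isPeriodicTest_mode hab l) j
    simp only [fderiv_mode] at h1
    rw [integral_const_mul] at h1
    refine (mul_eq_zero.1 h1).resolve_left ?_
    have h2 : freq a b l j ≠ 0 := by
      unfold freq
      have := (sub_pos.2 (hab j)).ne'
      have := Real.pi_ne_zero
      have : (l j : ℝ) ≠ 0 := by exact_mod_cast hj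
      positivity
    simpa using h2

lemma fourierCoef_mode (hab : ∀ j, a j < b j) (l m : Fin d → ℤ) :
    fourierCoef a b (mode a b m) l = if l = m then 1 else 0 := by
  rw [fourierCoef_eq]
  simp only [← mode_add]
  rw [integral_mode hab]
  have := (boxVol_pos hab).ne'
  by_cases h : l = m
  · simp [h, this]
  · have : m + -l ≠ 0 := fun h' => h (by rw [← sub_eq_add_neg, sub_eq_zero] at h'; exact h'.symm)
    simp [h, this]

lemma integrable_mul_mode {f : (Fin d → ℝ) → ℂ} (hf : MemLp f 2 (boxMeasure a b))
    (l : Fin d → ℤ) : Integrable (fun x => f x * mode a b l x) (boxMeasure a b) :=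
  MemLp.integrable_mul hf (memLp_of_continuous (continuous_mode l) 2)

lemma fourierCoef_sub {f g : (Fin d → ℝ) → ℂ} (hf : MemLp f 2 (boxMeasure a b))
    (hg : MemLp g 2 (boxMeasure a b)) (l : Fin d → ℤ) :
    fourierCoef a b (fun x => f x - g x) l = fourierCoef a b f l - fourierCoef a b g l := by
  simp only [fourierCoef_eq, sub_mul]
  rw [integral_sub (integrable_mul_mode hf _) (integrable_mul_mode hg _)]
  ring

lemma fourierCoef_add {f g : (Fin d → ℝ) → ℂ} (hf : MemLp f 2 (boxMeasure a b))
    (hg : MemLp g 2 (boxMeasure a b)) (l : Fin d → ℤ) :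
    fourierCoef a b (fun x => f x + g x) l = fourierCoef a b f l + fourierCoef a b g l := by
  simp only [fourierCoef_eq, add_mul]
  rw [integral_add (integrable_mul_mode hf _) (integrable_mul_mode hg _)]
  ring

lemma fourierCoef_const_mul (c : ℂ) (f : (Fin d → ℝ) → ℂ) (l : Fin d → ℤ) :
    fourierCoef a b (fun x => c * f x) l = c * fourierCoef a b f l := by
  simp only [fourierCoef_eq, mul_assoc]
  rw [integral_const_mul]
  ring

lemma fourierCoef_sum {ι : Type*} (S : Finset ι) {f : ι → (Fin d → ℝ) → ℂ}
    (hf : ∀ i ∈ S, MemLp (f i) 2 (boxMeasure a b)) (l : Fin d → ℤ) :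
    fourierCoef a b (fun x => ∑ i ∈ S, f i x) l = ∑ i ∈ S, fourierCoef a b (f i) l := by
  simp only [fourierCoef_eq, Finset.sum_mul]
  rw [integral_finsetSum _ fun i hi => integrable_mul_mode (hf i hi) _, Finset.mul_sum]

/-- On the Fourier side a weak derivative is a multiplier. -/
lemma IsPerWeakDeriv.fourierCoef (hab : ∀ j, a j < b j) {k : ℕ} {s : Fin k → Fin d}
    {u v : (Fin d → ℝ) → ℂ} (h : IsPerWeakDeriv a b s u v) (l : Fin d → ℤ) :
    fourierCoef a b v l = (∏ i, Complex.I * freq a b l (s i)) * fourierCoef a b u l := by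
  have h1 := h.2.2 _ (isPeriodicTest_mode hab (-l))
  simp only [iteratedFDeriv_mode] at h1
  have h2 : ∀ x, u x * ((∏ i, Complex.I * freq a b (-l) (s i)) * mode a b (-l) x)
      = (-1) ^ k * (∏ i, Complex.I * freq a b l (s i)) * (u x * mode a b (-l) x) := by
    intro x
    have : ∏ i, Complex.I * (freq a b (-l) (s i) : ℂ)
        = (-1) ^ k * ∏ i, Complex.I * (freq a b l (s i) : ℂ) := by
      simp only [freq_neg]
      push_cast
      simp only [mul_neg]
      rw [Finset.prod_neg]
      simp
    rw [this]
    ring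
  simp only [h2] at h1
  rw [integral_const_mul, mul_assoc] at h1
  have h3 := mul_left_cancel₀ (pow_ne_zero k (by norm_num : (-1 : ℂ) ≠ 0)) h1
  rw [fourierCoef_eq, fourierCoef_eq, ← h3]
  ring

lemma isPerWeakDeriv_mode (hab : ∀ j, a j < b j) (l : Fin d → ℤ) {k : ℕ} (s : Fin k → Fin d) :
    IsPerWeakDeriv a b s (mode a b l)
      (fun x => (∏ i, Complex.I * freq a b l (s i)) * mode a b l x) := by
  refine ⟨memLp_of_continuous (continuous_mode l) 2,
    memLp_of_continuous (continuous_const.mul (continuous_mode l)) 2, fun η hη => ?_⟩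
  rw [integral_mode_mul_iteratedFDeriv hab l hη]
  simp only [mul_assoc]
  rw [integral_const_mul]

lemma integrable_mul_test {u η : (Fin d → ℝ) → ℂ} (hu : MemLp u 2 (boxMeasure a b))
    (hη : IsPeriodicTest a b η) : Integrable (fun x => u x * η x) (boxMeasure a b) :=
  MemLp.integrable_mul hu (memLp_of_continuous hη.1.continuous 2)

lemma IsPerWeakDeriv.add {k : ℕ} {s : Fin k → Fin d} {u v u' v' : (Fin d → ℝ) → ℂ}
    (h : IsPerWeakDeriv a b s u v) (h' : IsPerWeakDeriv a b s u' v') :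
    IsPerWeakDeriv a b s (fun x => u x + u' x) (fun x => v x + v' x) := by
  refine ⟨h.1.add h'.1, h.2.1.add h'.2.1, fun η hη => ?_⟩
  simp only [add_mul]
  rw [integral_add (integrable_mul_test h.1 (hη.iteratedFDeriv _))
    (integrable_mul_test h'.1 (hη.iteratedFDeriv _)),
    integral_add (integrable_mul_test h.2.1 hη) (integrable_mul_test h'.2.1 hη),
    h.2.2 η hη, h'.2.2 η hη]
  ring

lemma IsPerWeakDeriv.const_mul {k : ℕ} {s : Fin k → Fin d} {u v : (Fin d → ℝ) → ℂ}
    (h : IsPerWeakDeriv a b s u v) (c : ℂ) :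
    IsPerWeakDeriv a b s (fun x => c * u x) (fun x => c * v x) := by
  refine ⟨h.1.const_mul c, h.2.1.const_mul c, fun η hη => ?_⟩
  simp only [mul_assoc]
  rw [integral_const_mul, integral_const_mul, h.2.2 η hη]
  ring

lemma IsPerWeakDeriv.zero {k : ℕ} (s : Fin k → Fin d) :
    IsPerWeakDeriv a b s (fun _ => 0) (fun _ => 0) :=
  ⟨MemLp.zero, MemLp.zero, fun η _ => by simp⟩

lemma IsPerWeakDeriv.sum {ι : Type*} (S : Finset ι) {k : ℕ} {s : Fin k → Fin d}
    {u v : ι → (Fin d → ℝ) → ℂ} (h : ∀ i ∈ S, IsPerWeakDeriv a b s (u i) (v i)) :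
    IsPerWeakDeriv a b s (fun x => ∑ i ∈ S, u i x) (fun x => ∑ i ∈ S, v i x) := by
  classical
  induction S using Finset.induction_on with
  | empty => simpa using IsPerWeakDeriv.zero s
  | insert i S hi ih =>
    simp only [Finset.sum_insert hi]
    exact (h i (Finset.mem_insert_self i S)).add
      (ih fun j hj => h j (Finset.mem_insert_of_mem hj))

/-- All weak derivatives up to order `m` exist. -/
def HasWeakDerivs (a b : Fin d → ℝ) (m : ℕ) (u : (Fin d → ℝ) → ℂ) : Prop :=
  ∀ k ≤ m, ∀ s : Fin k → Fin d, ∃ v, IsPerWeakDeriv a b s u v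

lemma HasWeakDerivs.mono {m n : ℕ} {u : (Fin d → ℝ) → ℂ} (h : HasWeakDerivs a b m u)
    (hn : n ≤ m) : HasWeakDerivs a b n u := fun k hk s => h k (hk.trans hn) s

lemma HasWeakDerivs.memLp {m : ℕ} {u : (Fin d → ℝ) → ℂ} (h : HasWeakDerivs a b m u) :
    MemLp u 2 (boxMeasure a b) := by
  obtain ⟨v, hv⟩ := h 0 (Nat.zero_le m) Fin.elim0
  exact hv.1

lemma HasWeakDerivs.sub {m : ℕ} {u v : (Fin d → ℝ) → ℂ} (hu : HasWeakDerivs a b m u)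
    (hv : HasWeakDerivs a b m v) : HasWeakDerivs a b m fun x => u x - v x := by
  intro k hk s
  obtain ⟨u', hu'⟩ := hu k hk s
  obtain ⟨v', hv'⟩ := hv k hk s
  refine ⟨_, by simpa [sub_eq_add_neg] using hu'.add (hv'.const_mul (-1))⟩

lemma hasWeakDerivs_of_sobolevNorm_lt_top {m : ℕ} {u : (Fin d → ℝ) → ℂ}
    (h : sobolevNorm a b m u < ⊤) : HasWeakDerivs a b m u := by
  intro k hk s
  unfold sobolevNorm at h
  rw [ENNReal.rpow_lt_top_iff_of_pos (by norm_num), ENNReal.sum_lt_top] at h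
  have h1 := h k (Finset.mem_range.2 (by omega))
  rw [ENNReal.sum_lt_top] at h1
  have h2 := h1 s (Finset.mem_univ s)
  -- Without a weak derivative the infimum runs over the empty set and equals `⊤`.
  by_contra! hcon
  simp [hcon] at h2

/-- The weight `∑_{k ≤ m} |μ_l|^{2k}` of the `H^m` norm on the Fourier side. -/
def sobolevWeight (a b : Fin d → ℝ) (m : ℕ) (l : Fin d → ℤ) : ℝ :=
  ∑ k ∈ Finset.range (m + 1), freqSq a b l ^ k

lemma freqSq_nonneg (l : Fin d → ℤ) : 0 ≤ freqSq a b l :=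
  Finset.sum_nonneg fun _ _ => sq_nonneg _

/-- The square of the `H^m` norm in terms of the Fourier coefficients. -/
def weightedSum (a b : Fin d → ℝ) (m : ℕ) (c : (Fin d → ℤ) → ℂ) : ℝ≥0∞ :=
  ENNReal.ofReal (boxVol a b) *
    ∑' l, ENNReal.ofReal (sobolevWeight a b m l) * ‖c l‖ₑ ^ 2

/-- The right side does not involve `v`, so all candidates in the infimum defining `sobolevNorm`
have the same norm. -/
lemma IsPerWeakDeriv.eLpNorm_sq (hab : ∀ j, a j < b j) {k : ℕ} {s : Fin k → Fin d}
    {u v : (Fin d → ℝ) → ℂ} (h : IsPerWeakDeriv a b s u v) :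
    eLpNorm v 2 (boxMeasure a b) ^ 2 = ENNReal.ofReal (boxVol a b) *
      ∑' l, ENNReal.ofReal (∏ i, freq a b l (s i) ^ 2) * ‖LogSE.fourierCoef a b u l‖ₑ ^ 2 := by
  rw [← parseval hab h.2.1]
  congr 1
  refine tsum_congr fun l => ?_
  rw [h.fourierCoef hab, enorm_mul, mul_pow]
  congr 1
  rw [← ofReal_norm, ← ENNReal.ofReal_pow (norm_nonneg _), norm_prod, ← Finset.prod_pow]
  congr 1
  refine Finset.prod_congr rfl fun i _ => ?_
  simp

/-- Summing the products `∏ᵢ μ_{s i}²` over all index maps `s` of length `k` expands the power `(∑ⱼ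
μⱼ²)^k`. -/
lemma sobolevNorm_sq (hab : ∀ j, a j < b j) {m : ℕ} {u : (Fin d → ℝ) → ℂ}
    (h : HasWeakDerivs a b m u) :
    sobolevNorm a b m u ^ 2 = weightedSum a b m (fourierCoef a b u) := by
  unfold sobolevNorm weightedSum
  rw [← ENNReal.rpow_natCast, ← ENNReal.rpow_mul]
  norm_num
  have h1 : ∀ k ∈ Finset.range (m + 1), ∀ s : Fin k → Fin d,
      (⨅ (v : (Fin d → ℝ) → ℂ) (_ : IsPerWeakDeriv a b s u v),
        eLpNorm v 2 (boxMeasure a b) ^ 2) = ENNReal.ofReal (boxVol a b) *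
      ∑' l, ENNReal.ofReal (∏ i, freq a b l (s i) ^ 2) * ‖fourierCoef a b u l‖ₑ ^ 2 := by
    intro k hk s
    obtain ⟨v, hv⟩ := h k (by simpa [Nat.lt_succ_iff] using hk) s
    apply le_antisymm
    · exact (iInf₂_le v hv).trans (hv.eLpNorm_sq hab).le
    · exact le_iInf₂ fun w hw => (hw.eLpNorm_sq hab).ge
  rw [Finset.sum_congr rfl fun k hk => Finset.sum_congr rfl fun s _ => h1 k hk s]
  simp only [← Finset.mul_sum]
  congr 1
  have h2 : ∀ k, (∑ s : Fin k → Fin d, ∑' l, ENNReal.ofReal (∏ i, freq a b l (s i) ^ 2) *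
      ‖fourierCoef a b u l‖ₑ ^ 2) = ∑' l, ENNReal.ofReal (freqSq a b l ^ k) *
      ‖fourierCoef a b u l‖ₑ ^ 2 := by
    intro k
    rw [← Summable.tsum_finsetSum fun _ _ => ENNReal.summable]
    refine tsum_congr fun l => ?_
    rw [← Finset.sum_mul, ← ENNReal.ofReal_sum_of_nonneg fun s _ =>
      Finset.prod_nonneg fun i _ => sq_nonneg _]
    congr 2
    exact (Fintype.sum_pow (fun j => freq a b l j ^ 2) k).symm
  rw [Finset.sum_congr rfl fun k _ => h2 k, ← Summable.tsum_finsetSum fun _ _ => ENNReal.summable]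
  refine tsum_congr fun l => ?_
  unfold sobolevWeight
  rw [ENNReal.ofReal_sum_of_nonneg fun k _ => pow_nonneg (freqSq_nonneg l) k, Finset.sum_mul]

end LogSE

end

/-! ### The logarithmic nonlinearity: pointwise estimates. -/

noncomputable section

namespace LogSE

/-- The logarithmic nonlinearity `z ln |z|²`. -/
def logNl (z : ℂ) : ℂ := (Real.log (‖z‖ ^ 2) : ℂ) * z

lemma logNl_zero : logNl 0 = 0 := by simp [logNl]

lemma measurable_logNl : Measurable logNl := by
  unfold logNl
  exact (Complex.measurable_ofReal.comp
    (Real.measurable_log.comp (measurable_norm.pow_const 2))).mul measurable_id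

/-- This is `ln s ≤ s - 1` at `s = y / x`. The factor `x`, the smaller modulus, cancels the
singularity of the logarithm at `0`. -/
lemma abs_log_sub_log_mul_min_le {x y : ℝ} (hx : 0 < x) (hxy : x ≤ y) :
    (Real.log (y ^ 2) - Real.log (x ^ 2)) * x ≤ 2 * (y - x) := by
  have hy : 0 < y := hx.trans_le hxy
  rw [Real.log_pow, Real.log_pow]
  have h1 : Real.log y - Real.log x ≤ y / x - 1 := by
    rw [← Real.log_div hy.ne' hx.ne']
    exact Real.log_le_sub_one_of_pos (div_pos hy hx)
  have h2 : (y / x - 1) * x = y - x := by field_simp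
  push_cast
  nlinarith

/-- Split the difference as `ln|u|² (u - v) + (ln|u|² - ln|v|²) v`. Paired with `conj (u - v)`, the
first term is real; in the second the logarithms multiply the entry of smaller modulus. -/
lemma abs_im_conj_mul_logNl_sub_le_of_le {u v : ℂ} (h : ‖v‖ ≤ ‖u‖) :
    |((starRingEnd ℂ) (u - v) * (logNl u - logNl v)).im| ≤ 2 * ‖u - v‖ ^ 2 := by
  by_cases hv : v = 0
  · subst hv
    have : ((starRingEnd ℂ) (u - 0) * (logNl u - logNl 0)).im = 0 := by
      rw [logNl_zero]
      simp [logNl, Complex.mul_im, Complex.mul_re]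
      ring
    rw [this, abs_zero]
    positivity
  have hv' : 0 < ‖v‖ := norm_pos_iff.2 hv
  have h1 : ((starRingEnd ℂ) (u - v) * (logNl u - logNl v)).im
      = (Real.log (‖u‖ ^ 2) - Real.log (‖v‖ ^ 2)) * ((starRingEnd ℂ) (u - v) * v).im := by
    simp [logNl, Complex.mul_im, Complex.mul_re]
    ring
  have h2 : |((starRingEnd ℂ) (u - v) * v).im| ≤ ‖u - v‖ * ‖v‖ := by
    refine (Complex.abs_im_le_norm _).trans ?_
    rw [norm_mul, RCLike.norm_conj]
  have h3 := abs_log_sub_log_mul_min_le hv' h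
  have h4 : 0 ≤ Real.log (‖u‖ ^ 2) - Real.log (‖v‖ ^ 2) :=
    sub_nonneg.2 (Real.log_le_log (by positivity) (by gcongr))
  have h5 : ‖u‖ - ‖v‖ ≤ ‖u - v‖ := norm_sub_norm_le u v
  rw [h1, abs_mul, abs_of_nonneg h4]
  have h6 := norm_nonneg (u - v)
  calc _ ≤ (Real.log (‖u‖ ^ 2) - Real.log (‖v‖ ^ 2)) * (‖u - v‖ * ‖v‖) := by gcongr
    _ = ((Real.log (‖u‖ ^ 2) - Real.log (‖v‖ ^ 2)) * ‖v‖) * ‖u - v‖ := by ring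
    _ ≤ (2 * (‖u‖ - ‖v‖)) * ‖u - v‖ := by gcongr
    _ ≤ (2 * ‖u - v‖) * ‖u - v‖ := by gcongr
    _ = _ := by ring

/-- The Cazenave–Haraux inequality. -/
lemma abs_im_conj_mul_logNl_sub_le (u v : ℂ) :
    |((starRingEnd ℂ) (u - v) * (logNl u - logNl v)).im| ≤ 2 * ‖u - v‖ ^ 2 := by
  rcases le_total ‖v‖ ‖u‖ with h | h
  · exact abs_im_conj_mul_logNl_sub_le_of_le h
  · have := abs_im_conj_mul_logNl_sub_le_of_le h
    rw [norm_sub_rev] at this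
    convert this using 2
    rw [← neg_sub v u, ← neg_sub (logNl v) (logNl u), map_neg, neg_mul_neg]

lemma norm_logNl_le_of_lt {u : ℂ} {ε Λ : ℝ} (hε : ‖u‖ ≤ ε) (hΛ : |Real.log ε| ≤ Λ) :
    ‖logNl u‖ ≤ (2 + 2 * Λ) * ε := by
  have hΛ0 : 0 ≤ Λ := (abs_nonneg _).trans hΛ
  by_cases hu : u = 0
  · subst hu
    rw [logNl_zero, norm_zero]
    have : 0 ≤ ε := by simpa using hε
    positivity
  have hu' : 0 < ‖u‖ := norm_pos_iff.2 hu
  have hε' : 0 < ε := hu'.trans_le hε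
  have h1 := abs_log_sub_log_mul_min_le hu' hε
  have h2 : 0 ≤ Real.log (ε ^ 2) - Real.log (‖u‖ ^ 2) :=
    sub_nonneg.2 (Real.log_le_log (by positivity) (by gcongr))
  have h3 : |Real.log (‖u‖ ^ 2)| ≤ (Real.log (ε ^ 2) - Real.log (‖u‖ ^ 2)) + 2 * Λ := by
    have : |Real.log (ε ^ 2)| ≤ 2 * Λ := by
      rw [Real.log_pow, abs_mul]; push_cast; rw [abs_two]; gcongr
    have h4 := abs_sub_abs_le_abs_sub (Real.log (‖u‖ ^ 2)) (Real.log (ε ^ 2))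
    rw [abs_sub_comm, abs_of_nonneg h2] at h4
    linarith
  unfold logNl
  rw [norm_mul, Complex.norm_real, Real.norm_eq_abs]
  calc _ ≤ ((Real.log (ε ^ 2) - Real.log (‖u‖ ^ 2)) + 2 * Λ) * ‖u‖ := by gcongr
    _ = (Real.log (ε ^ 2) - Real.log (‖u‖ ^ 2)) * ‖u‖ + 2 * Λ * ‖u‖ := by ring
    _ ≤ 2 * (ε - ‖u‖) + 2 * Λ * ε := by gcongr
    _ ≤ _ := by nlinarith

/-- If `|u| ≤ ε`, both values are `O(Λε)`. Otherwise `ε ≤ |u| ≤ R` bounds `ln|u|²` by `2Λ`, and the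
same splitting as in the Cazenave–Haraux inequality applies. -/
lemma norm_logNl_sub_le_of_le {u v : ℂ} {ε Λ R : ℝ} (hε : 0 < ε) (h : ‖v‖ ≤ ‖u‖)
    (hu : ‖u‖ ≤ R) (hΛ : |Real.log ε| ≤ Λ) (hR : Real.log R ≤ Λ) :
    ‖logNl u - logNl v‖ ≤ (2 + 2 * Λ) * (‖u - v‖ + 2 * ε) := by
  have hΛ0 : 0 ≤ Λ := (abs_nonneg _).trans hΛ
  rcases le_total ‖u‖ ε with hue | hue
  · calc _ ≤ ‖logNl u‖ + ‖logNl v‖ := norm_sub_le _ _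
      _ ≤ (2 + 2 * Λ) * ε + (2 + 2 * Λ) * ε :=
        add_le_add (norm_logNl_le_of_lt hue hΛ) (norm_logNl_le_of_lt (h.trans hue) hΛ)
      _ ≤ _ := by nlinarith [mul_nonneg hΛ0 (norm_nonneg (u - v)), norm_nonneg (u - v)]
  · have hu0 : 0 < ‖u‖ := hε.trans_le hue
    have h1 : |Real.log (‖u‖ ^ 2)| ≤ 2 * Λ := by
      rw [Real.log_pow, abs_mul]; push_cast; rw [abs_two]
      refine mul_le_mul_of_nonneg_left (abs_le.2 ⟨?_, ?_⟩) (by norm_num)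
      · have := Real.log_le_log hε hue
        linarith [neg_le_of_abs_le hΛ]
      · exact (Real.log_le_log hu0 hu).trans hR
    have h2 : ‖((Real.log (‖u‖ ^ 2) - Real.log (‖v‖ ^ 2) : ℝ) : ℂ) * v‖ ≤ 2 * ‖u - v‖ := by
      by_cases hv : v = 0
      · subst hv; simp
      have hv' : 0 < ‖v‖ := norm_pos_iff.2 hv
      have h4 : 0 ≤ Real.log (‖u‖ ^ 2) - Real.log (‖v‖ ^ 2) :=
        sub_nonneg.2 (Real.log_le_log (by positivity) (by gcongr))
      rw [norm_mul, Complex.norm_real, Real.norm_eq_abs, abs_of_nonneg h4]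
      have := abs_log_sub_log_mul_min_le hv' h
      have := norm_sub_norm_le u v
      linarith
    have h3 : logNl u - logNl v = (Real.log (‖u‖ ^ 2) : ℂ) * (u - v)
        + ((Real.log (‖u‖ ^ 2) - Real.log (‖v‖ ^ 2) : ℝ) : ℂ) * v := by
      unfold logNl; push_cast; ring
    rw [h3]
    calc _ ≤ ‖(Real.log (‖u‖ ^ 2) : ℂ) * (u - v)‖ + 2 * ‖u - v‖ :=
          (norm_add_le _ _).trans (by gcongr)
      _ ≤ 2 * Λ * ‖u - v‖ + 2 * ‖u - v‖ := by
          rw [norm_mul, Complex.norm_real, Real.norm_eq_abs]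
          gcongr
      _ ≤ _ := by nlinarith [mul_nonneg hΛ0 hε.le]

/-- The nonlinearity is Lipschitz with a logarithmic constant, up to a small additive error. -/
lemma norm_logNl_sub_le {u v : ℂ} {ε Λ R : ℝ} (hε : 0 < ε) (hu : ‖u‖ ≤ R) (hv : ‖v‖ ≤ R)
    (hΛ : |Real.log ε| ≤ Λ) (hR : Real.log R ≤ Λ) :
    ‖logNl u - logNl v‖ ≤ (2 + 2 * Λ) * (‖u - v‖ + 2 * ε) := by
  rcases le_total ‖v‖ ‖u‖ with h | h
  · exact norm_logNl_sub_le_of_le hε h hu hΛ hR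
  · rw [norm_sub_rev, norm_sub_rev u v]
    exact norm_logNl_sub_le_of_le hε h hv hΛ hR

variable {d : ℕ} {a b : Fin d → ℝ}

lemma opB_eq (V : (Fin d → ℝ) → ℝ) (lam : ℝ) (φ : (Fin d → ℝ) → ℂ) (x : Fin d → ℝ) :
    opB V lam φ x = (V x : ℂ) * φ x + (lam : ℂ) * logNl (φ x) := by
  unfold opB logNl; ring

lemma aestronglyMeasurable_opB {V : (Fin d → ℝ) → ℝ} {φ : (Fin d → ℝ) → ℂ} (lam : ℝ)
    (hV : AEStronglyMeasurable V (boxMeasure a b))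
    (hφ : AEStronglyMeasurable φ (boxMeasure a b)) :
    AEStronglyMeasurable (opB V lam φ) (boxMeasure a b) := by
  have : opB V lam φ = fun x => (V x : ℂ) * φ x + (lam : ℂ) * logNl (φ x) :=
    funext (opB_eq V lam φ)
  rw [this]
  exact ((Complex.continuous_ofReal.comp_aestronglyMeasurable hV).mul hφ).add
    ((measurable_logNl.comp_aemeasurable hφ.aemeasurable).aestronglyMeasurable.const_mul _)

lemma norm_opB_sub_le {V : (Fin d → ℝ) → ℝ} {lam : ℝ} {φ χ : (Fin d → ℝ) → ℂ}
    {x : Fin d → ℝ} {ε Λ R K : ℝ} (hε : 0 < ε) (hu : ‖φ x‖ ≤ R) (hv : ‖χ x‖ ≤ R)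
    (hΛ : |Real.log ε| ≤ Λ) (hR : Real.log R ≤ Λ) (hΛ1 : 1 ≤ Λ) (hK : |V x| + 8 * |lam| ≤ K) :
    ‖opB V lam φ x - opB V lam χ x‖ ≤ K * Λ * ‖φ x - χ x‖ + K * Λ * ε := by
  have h1 : opB V lam φ x - opB V lam χ x
      = (V x : ℂ) * (φ x - χ x) + (lam : ℂ) * (logNl (φ x) - logNl (χ x)) := by
    rw [opB_eq, opB_eq]; ring
  have h2 := norm_logNl_sub_le hε hu hv hΛ hR
  rw [h1]
  have h3 := norm_nonneg (φ x - χ x)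
  have h4 := abs_nonneg (V x)
  have h5 := abs_nonneg lam
  calc _ ≤ |V x| * ‖φ x - χ x‖ + |lam| * ((2 + 2 * Λ) * (‖φ x - χ x‖ + 2 * ε)) := by
        refine (norm_add_le _ _).trans ?_
        rw [norm_mul, norm_mul, Complex.norm_real, Complex.norm_real]
        simp only [Real.norm_eq_abs]
        gcongr
    _ ≤ |V x| * ‖φ x - χ x‖ + |lam| * ((4 * Λ) * (‖φ x - χ x‖ + 2 * ε)) := by
        gcongr; linarith
    _ ≤ Λ * |V x| * ‖φ x - χ x‖ + |lam| * ((4 * Λ) * (‖φ x - χ x‖ + 2 * ε)) := by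
        gcongr; nlinarith
    _ ≤ ((|V x| + 8 * |lam|) * Λ) * (‖φ x - χ x‖ + ε) := by
        nlinarith [mul_nonneg (mul_nonneg h5 (zero_le_one.trans hΛ1)) h3,
          mul_nonneg (mul_nonneg h4 (zero_le_one.trans hΛ1)) hε.le]
    _ ≤ (K * Λ) * (‖φ x - χ x‖ + ε) := by gcongr
    _ = _ := by ring

lemma abs_im_conj_mul_opB_sub_le (V : (Fin d → ℝ) → ℝ) (lam : ℝ) (φ χ : (Fin d → ℝ) → ℂ)
    (x : Fin d → ℝ) :
    |((starRingEnd ℂ) (φ x - χ x) * (opB V lam φ x - opB V lam χ x)).im|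
      ≤ 2 * |lam| * ‖φ x - χ x‖ ^ 2 := by
  have h1 : ((starRingEnd ℂ) (φ x - χ x) * (opB V lam φ x - opB V lam χ x)).im
      = lam * ((starRingEnd ℂ) (φ x - χ x) * (logNl (φ x) - logNl (χ x))).im := by
    rw [opB_eq, opB_eq]
    simp [Complex.mul_im, Complex.mul_re]
    ring
  rw [h1, abs_mul]
  have := mul_le_mul_of_nonneg_left (abs_im_conj_mul_logNl_sub_le (φ x) (χ x)) (abs_nonneg lam)
  linarith

/-- The `L²` norm normalized by the volume of the box. -/
def avgNorm (a b : Fin d → ℝ) (f : (Fin d → ℝ) → ℂ) : ℝ :=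
  (eLpNorm f 2 (boxMeasure a b)).toReal / Real.sqrt (boxVol a b)

lemma avgNorm_nonneg (f : (Fin d → ℝ) → ℂ) : 0 ≤ avgNorm a b f := by
  unfold avgNorm; positivity

lemma eLpNorm_eq_avgNorm (hab : ∀ j, a j < b j) {f : (Fin d → ℝ) → ℂ}
    (hf : MemLp f 2 (boxMeasure a b)) :
    eLpNorm f 2 (boxMeasure a b) = ENNReal.ofReal (Real.sqrt (boxVol a b) * avgNorm a b f) := by
  have : 0 < Real.sqrt (boxVol a b) := Real.sqrt_pos.2 (boxVol_pos hab)
  unfold avgNorm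
  rw [mul_div_cancel₀ _ this.ne', ENNReal.ofReal_toReal hf.2.ne]

lemma avgNorm_le_of_eLpNorm_le (hab : ∀ j, a j < b j) {f : (Fin d → ℝ) → ℂ} {M : ℝ}
    (hM : 0 ≤ M) (h : eLpNorm f 2 (boxMeasure a b) ≤ ENNReal.ofReal M) :
    avgNorm a b f ≤ M / Real.sqrt (boxVol a b) := by
  have : 0 < Real.sqrt (boxVol a b) := Real.sqrt_pos.2 (boxVol_pos hab)
  unfold avgNorm
  gcongr
  exact ENNReal.toReal_le_of_le_ofReal hM h

/-- With the normalized norm a constant `B` contributes exactly `B`, so pointwise bounds pass to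
coefficient vectors without factors of the volume. -/
lemma avgNorm_le_of_le (hab : ∀ j, a j < b j) {f g : (Fin d → ℝ) → ℂ} {A B : ℝ}
    (hA : 0 ≤ A) (hB : 0 ≤ B) (hg : MemLp g 2 (boxMeasure a b))
    (h : ∀ᵐ x ∂(boxMeasure a b), ‖f x‖ ≤ A * ‖g x‖ + B) :
    avgNorm a b f ≤ A * avgNorm a b g + B := by
  have hs : 0 < Real.sqrt (boxVol a b) := Real.sqrt_pos.2 (boxVol_pos hab)
  have h1 : eLpNorm f 2 (boxMeasure a b)
      ≤ ENNReal.ofReal A * eLpNorm g 2 (boxMeasure a b)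
        + ENNReal.ofReal (B * Real.sqrt (boxVol a b)) := by
    calc _ ≤ eLpNorm (fun x => A * ‖g x‖ + B) 2 (boxMeasure a b) := by
          refine eLpNorm_mono_ae_real h
      _ ≤ eLpNorm (fun x => A * ‖g x‖) 2 (boxMeasure a b)
          + eLpNorm (fun _ => B) 2 (boxMeasure a b) :=
        eLpNorm_add_le (hg.1.norm.const_mul A) aestronglyMeasurable_const (by norm_num)
      _ = _ := by
        congr 1
        · have : (fun x => A * ‖g x‖) = A • fun x => ‖g x‖ := rfl
          rw [this, eLpNorm_const_smul, eLpNorm_norm, Real.enorm_eq_ofReal hA]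
        · by_cases hμ : boxMeasure a b = 0
          · exfalso
            have := boxMeasure_univ hab
            rw [hμ] at this
            simp only [Measure.coe_zero, Pi.zero_apply] at this
            have h2 := ENNReal.ofReal_pos.2 (boxVol_pos hab)
            rw [← this] at h2
            exact lt_irrefl _ h2
          rw [eLpNorm_const _ (by norm_num) hμ, boxMeasure_univ hab, Real.enorm_eq_ofReal hB,
            ENNReal.ofReal_rpow_of_pos (boxVol_pos hab), ← ENNReal.ofReal_mul hB]
          simp [Real.sqrt_eq_rpow]
  have h2 : (eLpNorm f 2 (boxMeasure a b)).toReal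
      ≤ A * (eLpNorm g 2 (boxMeasure a b)).toReal + B * Real.sqrt (boxVol a b) := by
    refine ENNReal.toReal_le_of_le_ofReal (by positivity) (h1.trans ?_)
    rw [ENNReal.ofReal_add (by positivity) (by positivity), ENNReal.ofReal_mul hA,
      ENNReal.ofReal_toReal hg.2.ne]
  unfold avgNorm
  rw [div_le_iff₀ hs, add_mul, mul_assoc, div_mul_cancel₀ _ hs.ne']
  exact h2

/-! ### Trigonometric polynomials and their coefficient vectors. -/

variable {S : Finset (Fin d → ℤ)}

/-- The vector of the Fourier coefficients with index in `S`. -/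
def coefVec (a b : Fin d → ℝ) (S : Finset (Fin d → ℤ)) (f : (Fin d → ℝ) → ℂ) :
    EuclideanSpace ℂ S :=
  WithLp.toLp 2 fun l => fourierCoef a b f l

/-- The trigonometric polynomial with given coefficients. -/
def trigPoly (a b : Fin d → ℝ) (c : EuclideanSpace ℂ S) (x : Fin d → ℝ) : ℂ :=
  ∑ l : S, c l * mode a b l x

lemma continuous_trigPoly (c : EuclideanSpace ℂ S) : Continuous (trigPoly a b c) := by
  unfold trigPoly
  exact continuous_finsetSum _ fun l _ => continuous_const.mul (continuous_mode l.1)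

lemma memLp_trigPoly (c : EuclideanSpace ℂ S) (p : ℝ≥0∞) :
    MemLp (trigPoly a b c) p (boxMeasure a b) := memLp_of_continuous (continuous_trigPoly c) p

lemma fourierCoef_trigPoly (hab : ∀ j, a j < b j) (c : EuclideanSpace ℂ S) (l : Fin d → ℤ) :
    fourierCoef a b (trigPoly a b c) l = if h : l ∈ S then c ⟨l, h⟩ else 0 := by
  unfold trigPoly
  rw [fourierCoef_sum _ fun i _ => memLp_of_continuous
    (continuous_const.mul (continuous_mode i.1)) 2]
  simp only [fourierCoef_const_mul, fourierCoef_mode hab]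
  split_ifs with h
  · rw [Finset.sum_eq_single ⟨l, h⟩]
    · simp
    · intro i _ hi
      rw [if_neg, mul_zero]
      rintro rfl
      exact hi rfl
    · simp
  · refine Finset.sum_eq_zero fun i _ => ?_
    rw [if_neg, mul_zero]
    rintro rfl
    exact h i.2

lemma coefVec_trigPoly (hab : ∀ j, a j < b j) (c : EuclideanSpace ℂ S) :
    coefVec a b S (trigPoly a b c) = c := by
  ext l
  simp [coefVec, fourierCoef_trigPoly hab]

lemma coefVec_sub {f g : (Fin d → ℝ) → ℂ} (hf : MemLp f 2 (boxMeasure a b))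
    (hg : MemLp g 2 (boxMeasure a b)) :
    coefVec a b S (fun x => f x - g x) = coefVec a b S f - coefVec a b S g := by
  ext l
  simp [coefVec, fourierCoef_sub hf hg]

lemma trigPoly_sub (c c' : EuclideanSpace ℂ S) (x : Fin d → ℝ) :
    trigPoly a b (c - c') x = trigPoly a b c x - trigPoly a b c' x := by
  simp [trigPoly, sub_mul]

lemma trigPoly_zero (x : Fin d → ℝ) : trigPoly a b (0 : EuclideanSpace ℂ S) x = 0 := by
  simp [trigPoly]

lemma hasWeakDerivs_trigPoly (hab : ∀ j, a j < b j) (c : EuclideanSpace ℂ S) (m : ℕ) :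
    HasWeakDerivs a b m (trigPoly a b c) := fun _ _ s =>
  ⟨_, IsPerWeakDeriv.sum Finset.univ fun l _ => (isPerWeakDeriv_mode hab l.1 s).const_mul (c l)⟩

lemma tsum_enorm_subtype (c : (Fin d → ℤ) → ℂ) :
    ∑ l ∈ S, ‖c l‖ₑ ^ 2 = ENNReal.ofReal (‖(WithLp.toLp 2 fun l : S => c l :
      EuclideanSpace ℂ S)‖ ^ 2) := by
  rw [EuclideanSpace.norm_sq_eq, ENNReal.ofReal_sum_of_nonneg fun _ _ => by positivity,
    ← Finset.sum_coe_sort]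
  refine Finset.sum_congr rfl fun l _ => ?_
  rw [ENNReal.ofReal_pow (norm_nonneg _), ofReal_norm]

lemma sq_avgNorm (hab : ∀ j, a j < b j) {f : (Fin d → ℝ) → ℂ}
    (hf : MemLp f 2 (boxMeasure a b)) :
    ENNReal.ofReal (avgNorm a b f ^ 2) = ∑' l, ‖fourierCoef a b f l‖ₑ ^ 2 := by
  have hpos := boxVol_pos hab
  have h := parseval hab hf
  rw [eLpNorm_eq_avgNorm hab hf, ← ENNReal.ofReal_pow
    (mul_nonneg (Real.sqrt_nonneg _) (avgNorm_nonneg f)), mul_pow, Real.sq_sqrt hpos.le,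
    ENNReal.ofReal_mul hpos.le] at h
  exact ((ENNReal.mul_right_inj (by simpa using hpos) ENNReal.ofReal_ne_top).1 h).symm

/-- Bessel's inequality. -/
lemma norm_coefVec_le (hab : ∀ j, a j < b j) {f : (Fin d → ℝ) → ℂ}
    (hf : MemLp f 2 (boxMeasure a b)) : ‖coefVec a b S f‖ ≤ avgNorm a b f := by
  have h1 := ENNReal.sum_le_tsum (f := fun l => ‖fourierCoef a b f l‖ₑ ^ 2) S
  rw [← sq_avgNorm hab hf, tsum_enorm_subtype, ENNReal.ofReal_le_ofReal_iff (sq_nonneg _)] at h1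
  exact le_of_sq_le_sq h1 (avgNorm_nonneg f)

lemma avgNorm_trigPoly (hab : ∀ j, a j < b j) (c : EuclideanSpace ℂ S) :
    avgNorm a b (trigPoly a b c) = ‖c‖ := by
  have h := sq_avgNorm hab (memLp_trigPoly (a := a) (b := b) c 2)
  rw [tsum_eq_sum (s := S) fun l hl => by simp [fourierCoef_trigPoly hab, hl],
    tsum_enorm_subtype] at h
  have h2 : (WithLp.toLp 2 fun l : S => fourierCoef a b (trigPoly a b c) l :
      EuclideanSpace ℂ S) = c := coefVec_trigPoly hab c
  rw [h2, ENNReal.ofReal_eq_ofReal_iff (by positivity) (by positivity)] at h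
  exact (sq_eq_sq₀ (avgNorm_nonneg _) (norm_nonneg _)).1 h

/-- Pairing a trigonometric polynomial with the projection of `f` is pairing it with `f` itself.
This lets the pointwise Cazenave–Haraux inequality survive the projection. -/
lemma sum_conj_mul_coefVec (c : EuclideanSpace ℂ S) {f : (Fin d → ℝ) → ℂ}
    (hf : MemLp f 2 (boxMeasure a b)) :
    ∑ l : S, (starRingEnd ℂ) (c l) * coefVec a b S f l
      = (boxVol a b : ℂ)⁻¹ *
        ∫ x, (starRingEnd ℂ) (trigPoly a b c x) * f x ∂(boxMeasure a b) := by
  have h1 : ∀ x, (starRingEnd ℂ) (trigPoly a b c x) * f x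
      = ∑ l : S, (starRingEnd ℂ) (c l) * (f x * mode a b (-l.1) x) := by
    intro x
    unfold trigPoly
    rw [map_sum, Finset.sum_mul]
    refine Finset.sum_congr rfl fun l _ => ?_
    rw [map_mul, conj_mode]
    ring
  simp only [h1]
  rw [integral_finsetSum _ fun l _ => (integrable_mul_mode hf _).const_mul _, Finset.mul_sum]
  refine Finset.sum_congr rfl fun l _ => ?_
  rw [integral_const_mul]
  simp only [coefVec, fourierCoef_eq]
  ring

lemma integral_norm_sq_trigPoly (hab : ∀ j, a j < b j) (c : EuclideanSpace ℂ S) :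
    ∫ x, ‖trigPoly a b c x‖ ^ 2 ∂(boxMeasure a b) = boxVol a b * ‖c‖ ^ 2 := by
  have hpos := boxVol_pos hab
  have h := sum_conj_mul_coefVec (a := a) (b := b) c (memLp_trigPoly c 2)
  rw [coefVec_trigPoly hab] at h
  have h1 : ∀ z : ℂ, (starRingEnd ℂ) z * z = ((‖z‖ ^ 2 : ℝ) : ℂ) := fun z => by
    rw [← Complex.normSq_eq_conj_mul_self, Complex.normSq_eq_norm_sq]
  simp only [h1] at h
  rw [integral_complex_ofReal, ← Complex.ofReal_sum, ← EuclideanSpace.norm_sq_eq] at h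
  rw [← Complex.ofReal_inv, ← Complex.ofReal_mul, Complex.ofReal_inj] at h
  rw [h]
  field_simp

/-- The inverse inequality from `L²` to `L^∞`, by Cauchy–Schwarz. Its power loss is harmless: only
the logarithm of the bound enters the error estimates. -/
lemma norm_trigPoly_le (c : EuclideanSpace ℂ S) (x : Fin d → ℝ) :
    ‖trigPoly a b c x‖ ≤ Real.sqrt S.card * ‖c‖ := by
  have h1 : ‖trigPoly a b c x‖ ≤ ∑ l : S, 1 * ‖c l‖ := by
    refine (norm_sum_le _ _).trans (Finset.sum_le_sum fun l _ => ?_)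
    rw [norm_mul, norm_mode, mul_one, one_mul]
  refine h1.trans ((Real.sum_mul_le_sqrt_mul_sqrt _ _ _).trans ?_)
  rw [EuclideanSpace.norm_eq]
  simp

/-- A uniform bound of a trigonometric polynomial makes `B` square integrable. -/
lemma memLp_opB {V : (Fin d → ℝ) → ℝ} (lam : ℝ) {φ : (Fin d → ℝ) → ℂ} {R : ℝ}
    (hV : MemLp V ∞ (boxMeasure a b)) (hφ : AEStronglyMeasurable φ (boxMeasure a b))
    (hR : ∀ᵐ x ∂(boxMeasure a b), ‖φ x‖ ≤ R) : MemLp (opB V lam φ) 2 (boxMeasure a b) := by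
  obtain ⟨K, hK⟩ : ∃ K : ℝ, ∀ᵐ x ∂(boxMeasure a b), |V x| ≤ K := by
    refine ⟨(eLpNorm V ∞ (boxMeasure a b)).toReal, ?_⟩
    filter_upwards [ae_le_eLpNormEssSup (f := V) (μ := boxMeasure a b)] with x hx
    rw [← Real.norm_eq_abs, ← toReal_enorm, eLpNorm_exponent_top]
    exact ENNReal.toReal_mono (by simpa using hV.2.ne) hx
  set Λ := max 1 (Real.log (max R 1))
  refine MemLp.of_bound (aestronglyMeasurable_opB lam hV.1 hφ)
    ((K + 8 * |lam|) * Λ * (max R 1) + (K + 8 * |lam|) * Λ * 1) ?_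
  filter_upwards [hR, hK] with x hx hKx
  have h := norm_opB_sub_le (V := V) (lam := lam) (φ := φ) (χ := fun _ => 0) (x := x) (ε := 1)
    (Λ := Λ) (R := max R 1) (K := K + 8 * |lam|) one_pos (hx.trans (le_max_left _ _)) (by simp)
    (by simp [Λ]) (le_max_right _ _) (le_max_left _ _) (by linarith)
  have h0 : opB V lam (fun _ => 0) x = 0 := by simp [opB]
  rw [h0, sub_zero, sub_zero] at h
  refine h.trans ?_
  have hKn : 0 ≤ K := (abs_nonneg _).trans hKx
  have : 0 ≤ Λ := zero_le_one.trans (le_max_left _ _)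
  gcongr
  exact hx.trans (le_max_left _ _)

lemma ae_abs_le_of_eLpNorm_le {α E : Type*} [MeasurableSpace α] {μ : Measure α}
    [NormedAddCommGroup E] {f : α → E} {M : ℝ} (hM : 0 ≤ M)
    (h : eLpNorm f ∞ μ ≤ ENNReal.ofReal M) : ∀ᵐ x ∂μ, ‖f x‖ ≤ M := by
  filter_upwards [ae_le_eLpNormEssSup (f := f) (μ := μ)] with x hx
  rw [← toReal_enorm]
  rw [eLpNorm_exponent_top] at h
  exact ENNReal.toReal_le_of_le_ofReal hM (hx.trans h)

end LogSE

end

/-! ### One step of the integrator: stability and local error. -/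

noncomputable section

namespace LogSE

lemma norm_exp_I_mul_sub_one_le (θ : ℝ) : ‖Complex.exp (Complex.I * θ) - 1‖ ≤ |θ| :=
  Real.norm_exp_I_mul_ofReal_sub_one_le

lemma norm_phi1_le (θ : ℝ) : ‖phi1 (-Complex.I * θ)‖ ≤ 1 := by
  unfold phi1
  split_ifs with h
  · simp
  · have hθ : θ ≠ 0 := by rintro rfl; simp at h
    rw [norm_div]
    have h1 := norm_exp_I_mul_sub_one_le (-θ)
    have h2 : Complex.I * ((-θ : ℝ) : ℂ) = -Complex.I * θ := by push_cast; ring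
    rw [h2, abs_neg] at h1
    have h3 : ‖-Complex.I * (θ : ℂ)‖ = |θ| := by simp
    rw [h3]
    exact div_le_one_of_le₀ h1 (abs_nonneg _)

/-- For `θ ≠ 0` the product is `(e^{iθ} - 1)/(iθ)`. For `|θ| ≤ 1` use `|e^z - 1 - z| ≤ |z|²`; for
`|θ| ≥ 1` both terms have modulus at most `1`. -/
lemma norm_exp_mul_phi1_sub_one_le (θ : ℝ) :
    ‖Complex.exp (Complex.I * θ) * phi1 (-Complex.I * θ) - 1‖ ≤ 2 * |θ| := by
  by_cases hθ : θ = 0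
  · subst hθ; simp [phi1]
  have hθ' : (θ : ℂ) ≠ 0 := by exact_mod_cast hθ
  rcases le_total |θ| 1 with h | h
  · have h0 : -Complex.I * (θ : ℂ) ≠ 0 := by simp [hθ]
    have h1 : Complex.exp (Complex.I * θ) * phi1 (-Complex.I * θ) - 1
        = (Complex.exp (Complex.I * θ) - 1 - Complex.I * θ) / (Complex.I * θ) := by
      unfold phi1
      rw [if_neg h0]
      have h2 : Complex.exp (Complex.I * θ) * Complex.exp (-(Complex.I * θ)) = 1 := by
        rw [← Complex.exp_add]; simp
      field_simp
      linear_combination (-1 : ℂ) * h2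
    have h3 : ‖Complex.I * (θ : ℂ)‖ = |θ| := by simp
    have h4 := Complex.norm_exp_sub_one_sub_id_le (x := Complex.I * θ) (by rw [h3]; exact h)
    rw [h1, norm_div, h3]
    rw [h3] at h4
    have h5 : 0 < |θ| := abs_pos.2 hθ
    rw [div_le_iff₀ h5]
    nlinarith
  · have h1 : ‖Complex.exp (Complex.I * θ)‖ = 1 := Complex.norm_exp_I_mul_ofReal θ
    calc _ ≤ ‖Complex.exp (Complex.I * θ) * phi1 (-Complex.I * θ)‖ + ‖(1 : ℂ)‖ := norm_sub_le _ _
      _ ≤ 1 + 1 := by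
        rw [norm_mul, h1, one_mul, norm_one]
        gcongr
        exact norm_phi1_le θ
      _ ≤ _ := by linarith

/-- Removing the unitary factor leaves `|c - iτqg|²` with `q = e^{iθ}φ₁(-iθ)`. Its cross term with
`q = 1` is exactly `2τ Im (conj c * g)`, the quantity that Cazenave–Haraux controls; the defect `q -
1` costs the term with `|θ|`. -/
lemma norm_sq_mode_step_le (θ τ : ℝ) (hτ : 0 ≤ τ) (c g : ℂ) :
    ‖Complex.exp (-Complex.I * θ) * c - Complex.I * τ * phi1 (-Complex.I * θ) * g‖ ^ 2
      ≤ ‖c‖ ^ 2 + 2 * τ * ((starRingEnd ℂ) c * g).im + 4 * τ * |θ| * (‖c‖ * ‖g‖)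
        + τ ^ 2 * ‖g‖ ^ 2 := by
  set q := Complex.exp (Complex.I * θ) * phi1 (-Complex.I * θ) with hq
  have hq1 : ‖q - 1‖ ≤ 2 * |θ| := norm_exp_mul_phi1_sub_one_le θ
  have hq2 : ‖q‖ ≤ 1 := by
    rw [hq, norm_mul, Complex.norm_exp_I_mul_ofReal, one_mul]
    exact norm_phi1_le θ
  have h1 : ‖Complex.exp (-Complex.I * θ) * c - Complex.I * τ * phi1 (-Complex.I * θ) * g‖
      = ‖c - Complex.I * τ * (q * g)‖ := by
    have h2 : Complex.exp (Complex.I * θ) * Complex.exp (-Complex.I * θ) = 1 := by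
      rw [← Complex.exp_add]; simp
    have h3 : c - Complex.I * τ * (q * g) = Complex.exp (Complex.I * θ) *
        (Complex.exp (-Complex.I * θ) * c - Complex.I * τ * phi1 (-Complex.I * θ) * g) := by
      rw [hq]; linear_combination (-c) * h2
    rw [h3, norm_mul, Complex.norm_exp_I_mul_ofReal, one_mul]
  rw [h1, ← Complex.normSq_eq_norm_sq, Complex.normSq_sub, Complex.normSq_eq_norm_sq,
    Complex.normSq_eq_norm_sq]
  have h4 : (c * (starRingEnd ℂ) (Complex.I * τ * (q * g))).re
      = -τ * ((starRingEnd ℂ) c * g).im - τ * ((starRingEnd ℂ) c * ((q - 1) * g)).im := by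
    simp [Complex.mul_re, Complex.mul_im]
    ring
  have h5 : |((starRingEnd ℂ) c * ((q - 1) * g)).im| ≤ 2 * |θ| * (‖c‖ * ‖g‖) := by
    refine (Complex.abs_im_le_norm _).trans ?_
    rw [norm_mul, norm_mul, RCLike.norm_conj]
    calc ‖c‖ * (‖q - 1‖ * ‖g‖) ≤ ‖c‖ * (2 * |θ| * ‖g‖) := by gcongr
      _ = _ := by ring
  have h6 : ‖Complex.I * (τ : ℂ) * (q * g)‖ ^ 2 ≤ τ ^ 2 * ‖g‖ ^ 2 := by
    have : ‖Complex.I * (τ : ℂ) * (q * g)‖ ≤ τ * ‖g‖ := by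
      simp only [norm_mul, Complex.norm_I, Complex.norm_real, Real.norm_eq_abs, abs_of_nonneg hτ,
        one_mul]
      gcongr
      nlinarith [norm_nonneg g]
    calc _ ≤ (τ * ‖g‖) ^ 2 := by gcongr
      _ = _ := by ring
  rw [h4]
  have h7 := mul_le_mul_of_nonneg_left ((le_abs_self _).trans h5) hτ
  linarith

variable {d : ℕ} {a b : Fin d → ℝ} {S : Finset (Fin d → ℤ)}

/-- One step of the exponential wave integrator on the Fourier side. -/
def ewiStep (a b : Fin d → ℝ) (τ : ℝ) (c g : EuclideanSpace ℂ S) : EuclideanSpace ℂ S :=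
  WithLp.toLp 2 fun l => Complex.exp (-Complex.I * (τ : ℂ) * (freqSq a b l : ℂ)) * c l
    - Complex.I * (τ : ℂ) * phi1 (-Complex.I * (τ : ℂ) * (freqSq a b l : ℂ)) * g l

lemma ewiStep_sub (τ : ℝ) (c g c' g' : EuclideanSpace ℂ S) :
    ewiStep a b τ c g - ewiStep a b τ c' g' = ewiStep a b τ (c - c') (g - g') := by
  ext l
  simp [ewiStep]
  ring

lemma norm_sq_ewiStep_le {τ : ℝ} (hτ : 0 ≤ τ) {A : ℝ} (hA : ∀ l ∈ S, freqSq a b l ≤ A)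
    (hA0 : 0 ≤ A) (c g : EuclideanSpace ℂ S) :
    ‖ewiStep a b τ c g‖ ^ 2 ≤ ‖c‖ ^ 2 + 2 * τ * (∑ l : S, (starRingEnd ℂ) (c l) * g l).im
      + 4 * τ ^ 2 * A * (‖c‖ * ‖g‖) + τ ^ 2 * ‖g‖ ^ 2 := by
  have h1 : ∀ l : S, ‖(ewiStep a b τ c g) l‖ ^ 2
      ≤ ‖c l‖ ^ 2 + 2 * τ * ((starRingEnd ℂ) (c l) * g l).im + 4 * τ ^ 2 * A * (‖c l‖ * ‖g l‖)
        + τ ^ 2 * ‖g l‖ ^ 2 := by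
    intro l
    have h2 := norm_sq_mode_step_le (τ * freqSq a b l) τ hτ (c l) (g l)
    rw [abs_of_nonneg (mul_nonneg hτ (freqSq_nonneg _))] at h2
    have h3 : -Complex.I * ((τ * freqSq a b l.1 : ℝ) : ℂ)
        = -Complex.I * (τ : ℂ) * (freqSq a b l.1 : ℂ) := by push_cast; ring
    rw [h3] at h2
    refine h2.trans ?_
    have h4 : 4 * τ * (τ * freqSq a b l.1) * (‖c l‖ * ‖g l‖) ≤ 4 * τ ^ 2 * A * (‖c l‖ * ‖g l‖) := by
      have := hA l.1 l.2
      calc _ = 4 * τ ^ 2 * freqSq a b l.1 * (‖c l‖ * ‖g l‖) := by ring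
        _ ≤ _ := by gcongr
    linarith
  rw [EuclideanSpace.norm_sq_eq]
  refine (Finset.sum_le_sum fun l _ => h1 l).trans ?_
  simp only [Finset.sum_add_distrib, ← Finset.mul_sum]
  rw [← EuclideanSpace.norm_sq_eq, ← EuclideanSpace.norm_sq_eq, Complex.im_sum]
  have h5 : ∑ l : S, ‖c l‖ * ‖g l‖ ≤ ‖c‖ * ‖g‖ := by
    rw [EuclideanSpace.norm_eq, EuclideanSpace.norm_eq]
    exact Real.sum_mul_le_sqrt_mul_sqrt _ _ _
  gcongr

lemma norm_ewiStep_zero_le {τ : ℝ} (hτ : 0 ≤ τ) (g : EuclideanSpace ℂ S) :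
    ‖ewiStep a b τ 0 g‖ ≤ τ * ‖g‖ := by
  have h1 : ‖ewiStep a b τ 0 g‖ ^ 2 ≤ (τ * ‖g‖) ^ 2 := by
    rw [mul_pow, EuclideanSpace.norm_sq_eq, EuclideanSpace.norm_sq_eq, Finset.mul_sum]
    refine Finset.sum_le_sum fun l _ => ?_
    have h3 : -Complex.I * (τ : ℂ) * (freqSq a b l.1 : ℂ)
        = -Complex.I * ((τ * freqSq a b l.1 : ℝ) : ℂ) := by push_cast; ring
    have h2 := norm_phi1_le (τ * freqSq a b l.1)
    rw [← mul_pow]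
    refine pow_le_pow_left₀ (norm_nonneg _) ?_ 2
    simp only [ewiStep, PiLp.zero_apply, mul_zero, zero_sub, norm_neg, norm_mul, Complex.norm_I,
      Complex.norm_real, Real.norm_eq_abs, abs_of_nonneg hτ, one_mul]
    rw [h3]
    have := mul_le_mul_of_nonneg_left h2 hτ
    rw [mul_one] at this
    gcongr
  exact le_of_sq_le_sq h1 (by positivity)

/-- The integral `∫₀^σ e^{i s A} ds`. -/
def expPrimitive (A σ : ℝ) : ℂ :=
  if A = 0 then (σ : ℂ) else (Complex.exp (Complex.I * A * σ) - 1) / (Complex.I * A)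

lemma hasDerivAt_exp_I_mul (A σ : ℝ) :
    HasDerivAt (fun σ : ℝ => Complex.exp (Complex.I * A * σ))
      (Complex.I * A * Complex.exp (Complex.I * A * σ)) σ := by
  have h := ((hasDerivAt_id' σ).ofReal_comp.const_mul (Complex.I * (A : ℂ))).cexp
  exact h.congr_deriv (by push_cast; ring)

lemma hasDerivAt_expPrimitive (A σ : ℝ) :
    HasDerivAt (expPrimitive A) (Complex.exp (Complex.I * A * σ)) σ := by
  unfold expPrimitive
  by_cases hA : A = 0
  · subst hA
    simpa using (hasDerivAt_id σ).ofReal_comp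
  · simp only [if_neg hA]
    have h := ((hasDerivAt_exp_I_mul A σ).sub_const 1).div_const (Complex.I * (A : ℂ))
    have : Complex.I * (A : ℂ) ≠ 0 := by simp [hA]
    exact h.congr_deriv (mul_div_cancel_left₀ _ this)

lemma expPrimitive_zero (A : ℝ) : expPrimitive A 0 = 0 := by
  simp [expPrimitive]

lemma exp_neg_mul_expPrimitive (A τ : ℝ) (hτ : τ ≠ 0) :
    Complex.exp (-Complex.I * τ * A) * expPrimitive A τ
      = τ * phi1 (-Complex.I * τ * A) := by
  unfold expPrimitive phi1
  by_cases hA : A = 0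
  · subst hA; simp
  · have h0 : -Complex.I * (τ : ℂ) * (A : ℂ) ≠ 0 := by simp [hA, hτ]
    rw [if_neg hA, if_neg h0]
    have h2 : Complex.exp (-(Complex.I * τ * A)) * Complex.exp (Complex.I * τ * A) = 1 := by
      rw [← Complex.exp_add, neg_add_cancel, Complex.exp_zero]
    have hτ' : (τ : ℂ) ≠ 0 := by exact_mod_cast hτ
    have hA' : (A : ℂ) ≠ 0 := by exact_mod_cast hA
    field_simp
    linear_combination h2

/-- The local error of the exponential integrator, from Duhamel's formula. -/
lemma norm_sub_ewiStep_le {p g : ℝ → EuclideanSpace ℂ S} {g₀ : EuclideanSpace ℂ S}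
    {t τ δ : ℝ} (hτ : 0 < τ) (hcont : ContinuousOn p (Icc t (t + τ)))
    (hderiv : ∀ s ∈ Ioo t (t + τ), ∀ l, HasDerivAt (fun s => p s l)
      (-Complex.I * freqSq a b l * p s l - Complex.I * g s l) s)
    (hg : ∀ s ∈ Ioo t (t + τ), ‖g s - g₀‖ ≤ δ) :
    ‖p (t + τ) - ewiStep a b τ (p t) g₀‖ ≤ τ * δ := by
  -- The solution in rotating coordinates plus the primitive of the frozen forcing `g₀`. Its
  -- derivative sees only `g s - g₀`, and its increment over the step is the local error up to a
  -- unitary factor.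
  set G : ℝ → EuclideanSpace ℂ S := fun s => WithLp.toLp 2 fun l =>
    Complex.exp (Complex.I * freqSq a b l * ((s - t : ℝ) : ℂ)) * p s l
      + Complex.I * expPrimitive (freqSq a b l) (s - t) * g₀ l with hG
  have hGcont : ContinuousOn G (Icc t (t + τ)) := by
    refine (PiLp.continuous_toLp 2 _).comp_continuousOn (continuousOn_pi.2 fun l => ?_)
    have h1 : ContinuousOn (fun s => p s l) (Icc t (t + τ)) :=
      (EuclideanSpace.proj l : EuclideanSpace ℂ S →L[ℂ] ℂ).continuous.comp_continuousOn hcont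
    have h2 : Continuous (expPrimitive (freqSq a b l.1)) :=
      continuous_iff_continuousAt.2 fun σ => (hasDerivAt_expPrimitive _ σ).continuousAt
    have h3 : Continuous fun s : ℝ => Complex.exp (Complex.I * freqSq a b l.1 * ((s - t : ℝ) : ℂ)) := by
      fun_prop
    have h4 : Continuous fun s : ℝ => Complex.I * expPrimitive (freqSq a b l.1) (s - t) * g₀ l :=
      (continuous_const.mul (h2.comp (by fun_prop))).mul continuous_const
    exact (h3.continuousOn.mul h1).add h4.continuousOn
  set G' : ℝ → EuclideanSpace ℂ S := fun s => WithLp.toLp 2 fun l =>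
    -Complex.I * Complex.exp (Complex.I * freqSq a b l * ((s - t : ℝ) : ℂ)) * (g s - g₀) l with hG'
  have hGderiv : ∀ s ∈ Ioo t (t + τ), HasDerivWithinAt G (G' s) (Ioo t (t + τ)) s := by
    intro s hs
    apply HasDerivAt.hasDerivWithinAt
    have h0 : HasDerivAt (fun s => (fun l : S =>
        Complex.exp (Complex.I * freqSq a b l * ((s - t : ℝ) : ℂ)) * p s l
          + Complex.I * expPrimitive (freqSq a b l) (s - t) * g₀ l))
        (fun l : S => -Complex.I * Complex.exp (Complex.I * freqSq a b l * ((s - t : ℝ) : ℂ))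
          * (g s - g₀) l) s := by
      refine hasDerivAt_pi.2 fun l => ?_
      have h1 := (hasDerivAt_exp_I_mul (freqSq a b l.1) (s - t)).comp_sub_const s t
      have h2 := (hasDerivAt_expPrimitive (freqSq a b l.1) (s - t)).comp_sub_const s t
      have h3 := (h1.fun_mul (hderiv s hs l)).fun_add
        ((h2.const_mul Complex.I).mul_const (g₀ l))
      refine h3.congr_deriv ?_
      simp only [PiLp.sub_apply]
      ring
    exact ((PiLp.continuousLinearEquiv 2 ℝ (fun _ : S => ℂ)).symm.hasFDerivAt.comp_hasDerivAt s h0)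
  have hG'le : ∀ s ∈ Ioo t (t + τ), ‖G' s‖ ≤ δ := by
    intro s hs
    refine le_trans (le_of_eq ?_) (hg s hs)
    rw [EuclideanSpace.norm_eq, EuclideanSpace.norm_eq]
    congr 1
    refine Finset.sum_congr rfl fun l _ => ?_
    have : Complex.I * (freqSq a b l.1 : ℂ) * ((s - t : ℝ) : ℂ)
        = Complex.I * ((freqSq a b l.1 * (s - t) : ℝ) : ℂ) := by push_cast; ring
    simp only [hG']
    rw [norm_mul, norm_mul, this, Complex.norm_exp_I_mul_ofReal]
    simp
  -- The derivative is available only inside the interval: the mean value inequality is proved there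
  -- and extended to the endpoints by continuity.
  have hlip : ∀ z ∈ Ioo t (t + τ) ×ˢ Ioo t (t + τ), ‖G z.2 - G z.1‖ ≤ δ * ‖z.2 - z.1‖ :=
    fun z hz => (convex_Ioo t (t + τ)).norm_image_sub_le_of_norm_hasDerivWithin_le hGderiv hG'le
      hz.1 hz.2
  have hcl : closure (Ioo t (t + τ) ×ˢ Ioo t (t + τ)) = Icc t (t + τ) ×ˢ Icc t (t + τ) := by
    rw [closure_prod_eq, closure_Ioo (by linarith)]
  have hfin := le_on_closure hlip
    (by
      rw [hcl]
      exact ((hGcont.comp continuousOn_snd fun z hz => hz.2).sub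
        (hGcont.comp continuousOn_fst fun z hz => hz.1)).norm)
    (by fun_prop) (x := (t, t + τ))
    (by rw [hcl]; exact ⟨⟨le_rfl, by linarith⟩, ⟨by linarith, le_rfl⟩⟩)
  simp only [add_sub_cancel_left, Real.norm_eq_abs, abs_of_pos hτ] at hfin
  rw [mul_comm]
  refine le_trans (le_of_eq ?_) hfin
  rw [EuclideanSpace.norm_eq, EuclideanSpace.norm_eq]
  congr 1
  refine Finset.sum_congr rfl fun l _ => ?_
  have h1 : (p (t + τ) - ewiStep a b τ (p t) g₀) l
      = Complex.exp (-Complex.I * τ * freqSq a b l.1) * (G (t + τ) - G t) l := by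
    simp only [hG, ewiStep, PiLp.sub_apply, sub_self, add_sub_cancel_left, expPrimitive_zero]
    have h2 : Complex.exp (-Complex.I * τ * freqSq a b l.1)
        * Complex.exp (Complex.I * freqSq a b l.1 * τ) = 1 := by
      rw [← Complex.exp_add]
      have : -Complex.I * (τ : ℂ) * freqSq a b l.1 + Complex.I * freqSq a b l.1 * τ = 0 := by ring
      rw [this, Complex.exp_zero]
    have h3 := exp_neg_mul_expPrimitive (freqSq a b l.1) τ hτ.ne'
    simp only [Complex.ofReal_zero, mul_zero, Complex.exp_zero]
    linear_combination (-(p (t + τ) l)) * h2 - (Complex.I * g₀ l) * h3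
  rw [h1, norm_mul]
  have : -Complex.I * (τ : ℂ) * freqSq a b l.1
      = Complex.I * ((-(τ * freqSq a b l.1) : ℝ) : ℂ) := by push_cast; ring
  rw [this, Complex.norm_exp_I_mul_ofReal, one_mul]

/-- Stability of one step: the difference of two numerical solutions. -/
lemma norm_sq_ewiStep_opB_le (hab : ∀ j, a j < b j) {V : (Fin d → ℝ) → ℝ} {lam : ℝ}
    (hV : MemLp V ∞ (boxMeasure a b)) {τ A : ℝ} (hτ : 0 ≤ τ)
    (hA : ∀ l ∈ S, freqSq a b l ≤ A) (hA0 : 0 ≤ A) {c c' : EuclideanSpace ℂ S} {ε Λ R K : ℝ}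
    (hε : 0 < ε) (hc : ∀ x, ‖trigPoly a b c x‖ ≤ R) (hc' : ∀ x, ‖trigPoly a b c' x‖ ≤ R)
    (hΛ : |Real.log ε| ≤ Λ) (hR : Real.log R ≤ Λ) (hΛ1 : 1 ≤ Λ)
    (hK : ∀ᵐ x ∂(boxMeasure a b), |V x| + 8 * |lam| ≤ K) (hK0 : 0 ≤ K) :
    ‖ewiStep a b τ c (coefVec a b S (opB V lam (trigPoly a b c)))
        - ewiStep a b τ c' (coefVec a b S (opB V lam (trigPoly a b c')))‖ ^ 2 + ε ^ 2
      ≤ (1 + τ * (4 * |lam| + 8 * τ * A * (K * Λ) + 2 * τ * (K * Λ) ^ 2))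
        * (‖c - c'‖ ^ 2 + ε ^ 2) := by
  have hB := memLp_opB lam hV (continuous_trigPoly (a := a) (b := b) c).aestronglyMeasurable
    (ae_of_all _ hc)
  have hB' := memLp_opB lam hV (continuous_trigPoly (a := a) (b := b) c').aestronglyMeasurable
    (ae_of_all _ hc')
  rw [ewiStep_sub, ← coefVec_sub hB hB']
  set D := fun x => opB V lam (trigPoly a b c) x - opB V lam (trigPoly a b c') x with hD
  have hDm : MemLp D 2 (boxMeasure a b) := hB.sub hB'
  have hKΛ : 0 ≤ K * Λ := mul_nonneg hK0 (zero_le_one.trans hΛ1)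
  have hg : ‖coefVec a b S D‖ ≤ K * Λ * ‖c - c'‖ + K * Λ * ε := by
    refine (norm_coefVec_le hab hDm).trans ?_
    rw [← avgNorm_trigPoly hab (c - c')]
    refine avgNorm_le_of_le hab hKΛ (by positivity) (memLp_trigPoly _ 2) ?_
    filter_upwards [hK] with x hx
    rw [trigPoly_sub]
    exact norm_opB_sub_le hε (hc x) (hc' x) hΛ hR hΛ1 hx
  have him : (∑ l : S, (starRingEnd ℂ) ((c - c') l) * coefVec a b S D l).im
      ≤ 2 * |lam| * ‖c - c'‖ ^ 2 := by
    have hpos := boxVol_pos hab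
    rw [sum_conj_mul_coefVec _ hDm, ← Complex.ofReal_inv, Complex.im_ofReal_mul]
    have hint : Integrable (fun x => (starRingEnd ℂ) (trigPoly a b (c - c') x) * D x)
        (boxMeasure a b) :=
      MemLp.integrable_mul (p := 2) (q := 2)
        (memLp_of_continuous (Complex.continuous_conj.comp (continuous_trigPoly (c - c'))) 2) hDm
    have h1 : (∫ x, (starRingEnd ℂ) (trigPoly a b (c - c') x) * D x ∂(boxMeasure a b)).im
        = ∫ x, ((starRingEnd ℂ) (trigPoly a b (c - c') x) * D x).im ∂(boxMeasure a b) :=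
      (integral_im hint).symm
    rw [h1]
    have h2 : ∫ x, ((starRingEnd ℂ) (trigPoly a b (c - c') x) * D x).im ∂(boxMeasure a b)
        ≤ ∫ x, 2 * |lam| * ‖trigPoly a b (c - c') x‖ ^ 2 ∂(boxMeasure a b) := by
      refine integral_mono hint.im ?_ fun x => ?_
      · exact ((memLp_trigPoly (c - c') 2).integrable_norm_pow (by norm_num)).const_mul _
      · simp only [hD]
        rw [trigPoly_sub]
        exact (le_abs_self _).trans (abs_im_conj_mul_opB_sub_le V lam _ _ x)
    rw [integral_const_mul, integral_norm_sq_trigPoly hab] at h2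
    calc _ ≤ (boxVol a b)⁻¹ * (2 * |lam| * (boxVol a b * ‖c - c'‖ ^ 2)) := by gcongr
      _ = _ := by field_simp
  have hmain := norm_sq_ewiStep_le (a := a) (b := b) hτ hA hA0 (c - c') (coefVec a b S D)
  set e := ‖c - c'‖ with he
  have he0 : 0 ≤ e := norm_nonneg _
  set γ := ‖coefVec a b S D‖ with hγ
  have hγ0 : 0 ≤ γ := norm_nonneg _
  -- Carrying `ε ^ 2` along with the squared error absorbs the additive term `KΛε`, so that the
  -- recursion becomes homogeneous.
  have h3 : e * γ ≤ K * Λ * (2 * (e ^ 2 + ε ^ 2)) := by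
    calc e * γ ≤ e * (K * Λ * e + K * Λ * ε) := by gcongr
      _ = K * Λ * (e ^ 2 + e * ε) := by ring
      _ ≤ _ := by gcongr; nlinarith [sq_nonneg (e - ε)]
  have h4 : γ ^ 2 ≤ (K * Λ) ^ 2 * (2 * (e ^ 2 + ε ^ 2)) := by
    calc γ ^ 2 ≤ (K * Λ * e + K * Λ * ε) ^ 2 := by gcongr
      _ = (K * Λ) ^ 2 * (e + ε) ^ 2 := by ring
      _ ≤ _ := by gcongr; nlinarith [sq_nonneg (e - ε)]
  have h5 : 2 * τ * (∑ l : S, (starRingEnd ℂ) ((c - c') l) * coefVec a b S D l).im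
      ≤ 2 * τ * (2 * |lam| * e ^ 2) := by gcongr
  have h6 : 4 * τ ^ 2 * A * (e * γ) ≤ 4 * τ ^ 2 * A * (K * Λ * (2 * (e ^ 2 + ε ^ 2))) := by gcongr
  have h7 : τ ^ 2 * γ ^ 2 ≤ τ ^ 2 * ((K * Λ) ^ 2 * (2 * (e ^ 2 + ε ^ 2))) := by gcongr
  have h8 : 0 ≤ τ * |lam| * ε ^ 2 := by positivity
  nlinarith

end LogSE

end

/-! ### Frequencies and mesh size. -/

noncomputable section

namespace LogSE

section Mesh

variable {d : ℕ} {a b : Fin d → ℝ} {N : Fin d → ℕ} {h κ : ℝ}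

lemma meshWidth_pos (hab : ∀ j, a j < b j) (hN : ∀ j, 0 < N j ∧ Even (N j)) (j : Fin d) :
    0 < meshWidth a b N j :=
  div_pos (sub_pos.2 (hab j)) (by exact_mod_cast (hN j).1)

lemma meshWidth_le_meshSize (j : Fin d) : meshWidth a b N j ≤ meshSize a b N :=
  le_ciSup (Set.finite_range _).bddAbove j

lemma inv_meshWidth_le (hab : ∀ j, a j < b j) (hN : ∀ j, 0 < N j ∧ Even (N j)) (hh : 0 < h)
    (hκ : ∀ j, h ≤ κ * meshWidth a b N j) (j : Fin d) : (meshWidth a b N j)⁻¹ ≤ κ / h := by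
  have hm := meshWidth_pos hab hN j
  rw [inv_le_iff_one_le_mul₀ hm, div_mul_eq_mul_div, le_div_iff₀ hh, one_mul]
  exact hκ j

lemma half_cast {n : ℕ} (hn : Even n) : ((n / 2 : ℕ) : ℝ) = n / 2 := by
  obtain ⟨k, rfl⟩ := hn
  rw [← two_mul, Nat.mul_div_cancel_left _ two_pos]
  push_cast
  ring

lemma abs_freq_eq (hab : ∀ j, a j < b j) (hN : ∀ j, 0 < N j ∧ Even (N j)) (l : Fin d → ℤ)
    (j : Fin d) :
    |freq a b l j| = Real.pi * (|(l j : ℝ)| / ((N j : ℝ) / 2)) * (meshWidth a b N j)⁻¹ := by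
  have h1 := sub_pos.2 (hab j)
  have h2 : (0 : ℝ) < N j := by exact_mod_cast (hN j).1
  unfold freq meshWidth
  rw [abs_div, abs_mul, abs_mul, abs_two, abs_of_pos Real.pi_pos, abs_of_pos h1]
  field_simp

/-- Each resolved component is at most `π / h_j`, and quasi-uniformity gives `1 / h_j ≤ κ / h`. -/
lemma freqSq_le_of_mem (hab : ∀ j, a j < b j) (hN : ∀ j, 0 < N j ∧ Even (N j)) (hh : 0 < h)
    (hκ : ∀ j, h ≤ κ * meshWidth a b N j) {l : Fin d → ℤ} (hl : l ∈ freqIndex N) :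
    freqSq a b l ≤ d * (Real.pi * κ) ^ 2 / h ^ 2 := by
  have h1 : ∀ j, freq a b l j ^ 2 ≤ (Real.pi * κ) ^ 2 / h ^ 2 := by
    intro j
    have h2 : (0 : ℝ) < N j := by exact_mod_cast (hN j).1
    have h3 : |(l j : ℝ)| ≤ (N j : ℝ) / 2 := by
      rw [← half_cast (hN j).2]
      have := Fintype.mem_piFinset.1 hl j
      rw [Finset.mem_Ico] at this
      rw [abs_le]
      constructor
      · have h := (Int.cast_le (R := ℝ)).2 this.1
        rwa [Int.cast_neg, Int.cast_natCast] at h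
      · have h := (Int.cast_le (R := ℝ)).2 this.2.le
        rwa [Int.cast_natCast] at h
    have h4 : |freq a b l j| ≤ Real.pi * κ / h := by
      rw [abs_freq_eq hab hN]
      have h5 : |(l j : ℝ)| / ((N j : ℝ) / 2) ≤ 1 := div_le_one_of_le₀ h3 (by positivity)
      have h6 := inv_meshWidth_le hab hN hh hκ j
      have h7 := meshWidth_pos hab hN j
      calc _ ≤ Real.pi * 1 * (κ / h) := by
            have := Real.pi_pos
            gcongr
        _ = _ := by ring
    rw [← sq_abs, ← div_pow]
    gcongr
  unfold freqSq
  calc _ ≤ ∑ _j : Fin d, (Real.pi * κ) ^ 2 / h ^ 2 := Finset.sum_le_sum fun j _ => h1 j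
    _ = _ := by simp; ring

/-- Some component has `|l_j| ≥ N_j/2` (equality occurs at the excluded right end), so its frequency
is at least `π / h_j ≥ 1 / h`. -/
lemma inv_sq_le_freqSq_of_notMem (hab : ∀ j, a j < b j) (hN : ∀ j, 0 < N j ∧ Even (N j))
    (hh : h = meshSize a b N) {l : Fin d → ℤ} (hl : l ∉ freqIndex N) :
    (h ^ 2)⁻¹ ≤ freqSq a b l := by
  obtain ⟨j, hj⟩ : ∃ j, l j ∉ Finset.Ico (-((N j / 2 : ℕ) : ℤ)) ((N j / 2 : ℕ) : ℤ) := by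
    by_contra! h'
    exact hl (Fintype.mem_piFinset.2 h')
  have h2 : (0 : ℝ) < N j := by exact_mod_cast (hN j).1
  have h3 : (N j : ℝ) / 2 ≤ |(l j : ℝ)| := by
    rw [← half_cast (hN j).2]
    rw [Finset.mem_Ico, not_and_or, not_le, not_lt] at hj
    rcases hj with hj | hj
    · have := (Int.cast_lt (R := ℝ)).2 hj
      rw [Int.cast_neg, Int.cast_natCast] at this
      exact le_trans (by linarith) (neg_le_abs _)
    · have := (Int.cast_le (R := ℝ)).2 hj
      rw [Int.cast_natCast] at this
      exact this.trans (le_abs_self _)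
  have h7 := meshWidth_pos hab hN j
  have hpos : 0 < h := hh ▸ h7.trans_le (meshWidth_le_meshSize j)
  have h4 : h⁻¹ ≤ |freq a b l j| := by
    rw [abs_freq_eq hab hN]
    have h5 : 1 ≤ |(l j : ℝ)| / ((N j : ℝ) / 2) := (one_le_div (by positivity)).2 h3
    have h6 : h⁻¹ ≤ (meshWidth a b N j)⁻¹ := by
      rw [hh]
      exact inv_anti₀ h7 (meshWidth_le_meshSize j)
    have h8 : 1 ≤ Real.pi := by linarith [Real.pi_gt_three]
    calc h⁻¹ = 1 * 1 * h⁻¹ := by ring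
      _ ≤ _ := by gcongr
  calc (h ^ 2)⁻¹ = h⁻¹ ^ 2 := by rw [inv_pow]
    _ ≤ |freq a b l j| ^ 2 := by gcongr
    _ = freq a b l j ^ 2 := sq_abs _
    _ ≤ _ := Finset.single_le_sum (f := fun j => freq a b l j ^ 2)
      (fun i _ => sq_nonneg _) (Finset.mem_univ j)

/-- The cardinality is `∏ N_j`, of order `h^{-d}`; for `h ≤ 1` this is weakened to `h^{-3}` so that
one exponent serves all dimensions. -/
lemma card_freqIndex_le (hd3 : d ≤ 3) (hab : ∀ j, a j < b j) (hN : ∀ j, 0 < N j ∧ Even (N j))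
    (hh : 0 < h) (hh1 : h ≤ 1) (hκ : ∀ j, h ≤ κ * meshWidth a b N j) :
    ((freqIndex N).card : ℝ) ≤ (boxVol a b * |κ| ^ d) / h ^ 3 := by
  have h1 : ((freqIndex N).card : ℝ) = ∏ j, (N j : ℝ) := by
    unfold freqIndex
    rw [Fintype.card_piFinset, Nat.cast_prod]
    refine Finset.prod_congr rfl fun j _ => ?_
    rw [Int.card_Ico]
    have h2 : (((N j / 2 : ℕ) : ℤ) - -((N j / 2 : ℕ) : ℤ)).toNat = N j := by
      obtain ⟨k, hk⟩ := (hN j).2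
      omega
    rw [h2]
  have h2 : ∀ j, (N j : ℝ) ≤ (b j - a j) * (|κ| / h) := by
    intro j
    have h3 := inv_meshWidth_le hab hN hh hκ j
    have h4 : (N j : ℝ) = (b j - a j) * (meshWidth a b N j)⁻¹ := by
      have h1 := sub_pos.2 (hab j)
      have h2 : (0 : ℝ) < N j := by exact_mod_cast (hN j).1
      unfold meshWidth
      field_simp
    have := sub_pos.2 (hab j)
    rw [h4]
    gcongr
    exact h3.trans (by gcongr; exact le_abs_self κ)
  rw [h1]
  calc _ ≤ ∏ j, (b j - a j) * (|κ| / h) := Finset.prod_le_prod (fun j _ => by positivity) fun j _ => h2 j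
    _ = boxVol a b * |κ| ^ d / h ^ d := by
      rw [Finset.prod_mul_distrib, Finset.prod_const, Finset.card_univ, Fintype.card_fin, div_pow,
        boxVol]
      ring
    _ ≤ _ := by
      have := boxVol_pos hab
      gcongr _ / ?_
      exact pow_le_pow_of_le_one hh.le hh1 hd3

end Mesh

/-! ### Inequalities between `τ`, `h` and their logarithms; Gronwall. -/

section Scalar

lemma one_le_abs_log {x : ℝ} (h0 : 0 < x) (h1 : x < Real.exp (-1)) : 1 ≤ |Real.log x| := by
  have h2 := Real.log_lt_log h0 h1
  rw [Real.log_exp] at h2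
  rw [abs_of_neg (by linarith)]
  linarith

lemma abs_log_eq_neg {x : ℝ} (h0 : 0 < x) (h1 : x < Real.exp (-1)) :
    |Real.log x| = -Real.log x := by
  have h2 := Real.log_lt_log h0 h1
  rw [Real.log_exp] at h2
  rw [abs_of_neg (by linarith)]

lemma lt_one_of_lt_exp {x : ℝ} (h1 : x < Real.exp (-1)) : x < 1 :=
  h1.trans (by rw [Real.exp_lt_one_iff]; norm_num)

lemma mul_abs_log_sq_le {x : ℝ} (h0 : 0 < x) (h1 : x ≤ 1) : x * |Real.log x| ^ 2 ≤ 4 := by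
  have h2 := (Real.abs_log_mul_self_rpow_lt x (1 / 2) h0 h1 (by norm_num)).le
  have h3 : x * |Real.log x| ^ 2 = |Real.log x * x ^ (1 / 2 : ℝ)| ^ 2 := by
    rw [abs_mul, mul_pow, sq_abs (x ^ (1 / 2 : ℝ)), ← Real.rpow_natCast (x ^ (1 / 2 : ℝ)),
      ← Real.rpow_mul h0.le]
    norm_num
    ring
  rw [h3]
  calc _ ≤ (1 / (1 / 2 : ℝ)) ^ 2 := by gcongr
    _ = 4 := by norm_num

variable {τ h Ct : ℝ}

lemma tau_mul_log_mul_log_le (hh : 0 < h) (hh1 : h < Real.exp (-1))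
    (hCt : τ * |Real.log τ| ≤ Ct * h ^ 2 / |Real.log h|) :
    τ * |Real.log τ| * |Real.log h| ≤ Ct * h ^ 2 :=
  (le_div_iff₀ (zero_lt_one.trans_le (one_le_abs_log hh hh1))).1 hCt

lemma tau_mul_log_le (hτ : 0 < τ) (hh : 0 < h) (hh1 : h < Real.exp (-1))
    (hCt : τ * |Real.log τ| ≤ Ct * h ^ 2 / |Real.log h|) :
    τ * |Real.log τ| ≤ Ct * h ^ 2 := by
  have h1 := tau_mul_log_mul_log_le hh hh1 hCt
  have h2 := one_le_abs_log hh hh1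
  have : 0 ≤ τ * |Real.log τ| := by positivity
  nlinarith

lemma tau_le (hτ : 0 < τ) (hτ1 : τ < Real.exp (-1)) (hh : 0 < h) (hh1 : h < Real.exp (-1))
    (hCt : τ * |Real.log τ| ≤ Ct * h ^ 2 / |Real.log h|) : τ ≤ Ct * h ^ 2 := by
  have h1 := tau_mul_log_le hτ hh hh1 hCt
  have h2 := one_le_abs_log hτ hτ1
  nlinarith

/-- Logarithms in `τ ≤ Ct h²` give `2|ln h| ≤ |ln τ| + ln Ct`. Hence every `|ln h|` from the inverse
inequality is absorbed into `|ln τ|`. -/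
lemma abs_log_h_le (hCt0 : 0 < Ct) (hτ : 0 < τ) (hτ1 : τ < Real.exp (-1)) (hh : 0 < h)
    (hh1 : h < Real.exp (-1)) (hCt : τ * |Real.log τ| ≤ Ct * h ^ 2 / |Real.log h|) :
    |Real.log h| ≤ (1 + |Real.log Ct|) * |Real.log τ| := by
  have h1 := Real.log_le_log hτ (tau_le hτ hτ1 hh hh1 hCt)
  rw [Real.log_mul hCt0.ne' (by positivity), Real.log_pow] at h1
  push_cast at h1
  have h2 := one_le_abs_log hτ hτ1
  have h3 := abs_log_eq_neg hτ hτ1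
  have h4 := abs_log_eq_neg hh hh1
  have h5 := le_abs_self (Real.log Ct)
  have h6 := abs_nonneg (Real.log Ct)
  have h7 := one_le_abs_log hh hh1
  nlinarith

/-- The logarithm of the bound given by the inverse inequality. -/
lemma log_sqrt_mul_le {Q ρ : ℝ} (hQ : 0 < Q) (hρ : 0 < ρ) (hh : 0 < h)
    (hh1 : h < Real.exp (-1)) :
    Real.log (Real.sqrt (Q / h ^ 3) * ρ) ≤ (2 + |Real.log Q|) * |Real.log h| + Real.log ρ := by
  have h1 : 0 < Q / h ^ 3 := by positivity
  rw [Real.log_mul (Real.sqrt_pos.2 h1).ne' hρ.ne', Real.log_sqrt h1.le,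
    Real.log_div hQ.ne' (by positivity), Real.log_pow]
  push_cast
  have h4 := abs_log_eq_neg hh hh1
  have h5 := le_abs_self (Real.log Q)
  have h6 := abs_nonneg (Real.log Q)
  have h7 := one_le_abs_log hh hh1
  nlinarith

/-- A discrete Gronwall inequality. -/
lemma discrete_gronwall {Y : ℕ → ℝ} {γ τ D T : ℝ} (hγ : 0 ≤ γ) (hτ : 0 ≤ τ) (hD : 0 ≤ D)
    (hstep : ∀ n : ℕ, ((n + 1 : ℕ) : ℝ) * τ ≤ T → Y (n + 1) ≤ (1 + τ * γ) * Y n + τ * D) (n : ℕ)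
    (hn : (n : ℝ) * τ ≤ T) : Y n ≤ Real.exp (γ * (n * τ)) * (|Y 0| + n * τ * D) := by
  induction n with
  | zero => simp [le_abs_self]
  | succ n ih =>
    have hn' : (n : ℝ) * τ ≤ T := le_trans (by push_cast; nlinarith) hn
    have h1 := ih hn'
    have h2 := hstep n hn
    have h3 : 1 + τ * γ ≤ Real.exp (τ * γ) := by
      rw [add_comm]; exact Real.add_one_le_exp _
    have h4 : Real.exp (γ * ((n + 1 : ℕ) * τ)) = Real.exp (τ * γ) * Real.exp (γ * (n * τ)) := by
      rw [← Real.exp_add]; congr 1; push_cast; ring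
    have h5 : 1 ≤ Real.exp (τ * γ) * Real.exp (γ * (n * τ)) := by
      rw [← h4, Real.one_le_exp_iff]; positivity
    have h6 : 0 ≤ 1 + τ * γ := by positivity
    calc Y (n + 1) ≤ (1 + τ * γ) * Y n + τ * D := h2
      _ ≤ (1 + τ * γ) * (Real.exp (γ * (n * τ)) * (|Y 0| + n * τ * D)) + τ * D := by gcongr
      _ ≤ Real.exp (τ * γ) * (Real.exp (γ * (n * τ)) * (|Y 0| + n * τ * D))
          + (Real.exp (τ * γ) * Real.exp (γ * (n * τ))) * (τ * D) := by
        refine add_le_add (by gcongr) ?_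
        exact le_mul_of_one_le_left (by positivity) h5
      _ = _ := by rw [h4]; push_cast; ring

/-- From `(1 + y)² ≤ e^{2y}`. A quadratic term is paid for by an exponent linear in `y`, which keeps
the a priori recursion for the logarithm of the norm linear. -/
lemma one_add_add_sq_le_exp {x y : ℝ} (hy : 0 ≤ y) (hx : 0 ≤ x) :
    1 + x + y ^ 2 ≤ Real.exp (x + 2 * y) := by
  have h1 := Real.add_one_le_exp x
  have h2 := Real.add_one_le_exp y
  rw [Real.exp_add, two_mul, Real.exp_add]
  have h3 : (y + 1) * (y + 1) ≤ Real.exp y * Real.exp y := by gcongr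
  calc 1 + x + y ^ 2 ≤ (x + 1) * ((y + 1) * (y + 1)) := by nlinarith [mul_nonneg hx hy, mul_nonneg hx (sq_nonneg y)]
    _ ≤ _ := by gcongr

end Scalar

end LogSE

end

/-! ### The exact solution on the Fourier side; projection errors. -/

noncomputable section

namespace LogSE

variable {d : ℕ} {a b : Fin d → ℝ} {S : Finset (Fin d → ℤ)}

lemma avgNorm_coe (f : L2 a b) : avgNorm a b f = ‖f‖ / Real.sqrt (boxVol a b) := by
  rw [avgNorm, Lp.norm_def]

lemma avgNorm_sub_coe (f g : L2 a b) :
    avgNorm a b (fun x => f x - g x) = ‖f - g‖ / Real.sqrt (boxVol a b) := by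
  rw [← avgNorm_coe]
  unfold avgNorm
  congr 2
  exact eLpNorm_congr_ae (Lp.coeFn_sub f g).symm

lemma coefVec_add_coe (f g : L2 a b) :
    coefVec a b S (f + g : L2 a b) = coefVec a b S f + coefVec a b S g := by
  ext l
  have h : fourierCoef a b (f + g : L2 a b) l = fourierCoef a b (fun x => f x + g x) l :=
    fourierCoef_congr (Lp.coeFn_add f g) l
  rw [fourierCoef_add (Lp.memLp f) (Lp.memLp g)] at h
  exact h

lemma coefVec_smul_coe (c : ℝ) (f : L2 a b) :
    coefVec a b S (c • f : L2 a b) = c • coefVec a b S f := by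
  ext l
  have h : fourierCoef a b (c • f : L2 a b) l = fourierCoef a b (fun x => (c : ℂ) * f x) l :=
    fourierCoef_congr ((Lp.coeFn_smul c f).trans (ae_of_all _ fun x => Complex.real_smul)) l
  rw [fourierCoef_const_mul] at h
  simpa [coefVec] using h

lemma norm_coefVec_coe_le (hab : ∀ j, a j < b j) (f : L2 a b) :
    ‖coefVec a b S f‖ ≤ 1 / Real.sqrt (boxVol a b) * ‖f‖ := by
  have h := norm_coefVec_le (S := S) hab (Lp.memLp f)
  rw [avgNorm_coe] at h
  exact h.trans (le_of_eq (by ring))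

/-- The vector of the Fourier coefficients as a linear map. -/
def coefLin (a b : Fin d → ℝ) (S : Finset (Fin d → ℤ)) : L2 a b →ₗ[ℝ] EuclideanSpace ℂ S where
  toFun f := coefVec a b S f
  map_add' := coefVec_add_coe
  map_smul' := coefVec_smul_coe

/-- The vector of the Fourier coefficients as a continuous linear map. -/
def coefCLM (hab : ∀ j, a j < b j) (S : Finset (Fin d → ℤ)) :
    L2 a b →L[ℝ] EuclideanSpace ℂ S :=
  (coefLin a b S).mkContinuous (1 / Real.sqrt (boxVol a b)) (norm_coefVec_coe_le hab)

section Exact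

variable {V : (Fin d → ℝ) → ℝ} {lam T M : ℝ} {ψ₀ : L2 a b} {ψ : ℝ → L2 a b}

lemma ae_norm_potential_le (hM0 : 0 ≤ M) (hM : solutionBound a b V T ψ ≤ ENNReal.ofReal M) :
    ∀ᵐ x ∂(boxMeasure a b), |V x| ≤ M :=
  ae_abs_le_of_eLpNorm_le hM0 ((le_max_right _ _).trans ((le_max_right _ _).trans hM))

lemma ae_norm_solution_le (hM0 : 0 ≤ M) (hM : solutionBound a b V T ψ ≤ ENNReal.ofReal M)
    {t : ℝ} (ht : t ∈ Icc 0 T) : ∀ᵐ x ∂(boxMeasure a b), ‖ψ t x‖ ≤ M := by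
  refine ae_abs_le_of_eLpNorm_le hM0 (le_trans ?_ hM)
  refine le_trans ?_ (le_max_right _ _)
  refine le_trans ?_ (le_max_left _ _)
  exact le_iSup₂ (f := fun t (_ : t ∈ Icc 0 T) => eLpNorm (ψ t) ∞ (boxMeasure a b)) t ht

lemma sobolevNorm_solution_le (hM : solutionBound a b V T ψ ≤ ENNReal.ofReal M)
    {t : ℝ} (ht : t ∈ Icc 0 T) : sobolevNorm a b 2 (ψ t) ≤ ENNReal.ofReal M := by
  refine le_trans ?_ hM
  refine le_trans ?_ (le_max_left _ _)
  refine le_trans ?_ (le_max_left _ _)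
  exact le_iSup₂ (f := fun t (_ : t ∈ Icc 0 T) => sobolevNorm a b 2 (ψ t)) t ht

lemma norm_derivWithin_solution_le (hM0 : 0 ≤ M)
    (hM : solutionBound a b V T ψ ≤ ENNReal.ofReal M)
    {t : ℝ} (ht : t ∈ Icc 0 T) : ‖derivWithin ψ (Icc 0 T) t‖ ≤ M := by
  have h : ‖derivWithin ψ (Icc 0 T) t‖ₑ ≤ ENNReal.ofReal M := by
    refine le_trans ?_ hM
    refine le_trans ?_ (le_max_left _ _)
    refine le_trans ?_ (le_max_right _ _)
    exact le_iSup₂ (f := fun t (_ : t ∈ Icc 0 T) => ‖derivWithin ψ (Icc 0 T) t‖ₑ) t ht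
  rw [← toReal_enorm]
  exact ENNReal.toReal_le_of_le_ofReal hM0 h

lemma hasWeakDerivs_solution (hψ : IsExactSolution a b V lam T ψ₀ ψ) {t : ℝ}
    (ht : t ∈ Icc 0 T) : HasWeakDerivs a b 2 (ψ t) :=
  hasWeakDerivs_of_sobolevNorm_lt_top (hψ.mem_H2 t ht)

lemma weightedSum_solution_le (hab : ∀ j, a j < b j) (hψ : IsExactSolution a b V lam T ψ₀ ψ)
    (hM0 : 0 ≤ M) (hM : solutionBound a b V T ψ ≤ ENNReal.ofReal M) {t : ℝ}
    (ht : t ∈ Icc 0 T) : weightedSum a b 2 (fourierCoef a b (ψ t)) ≤ ENNReal.ofReal (M ^ 2) := by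
  rw [← sobolevNorm_sq hab (hasWeakDerivs_solution hψ ht), ENNReal.ofReal_pow hM0]
  gcongr
  exact sobolevNorm_solution_le hM ht

lemma avgNorm_solution_sub_le (hψ : IsExactSolution a b V lam T ψ₀ ψ)
    (hM0 : 0 ≤ M) (hM : solutionBound a b V T ψ ≤ ENNReal.ofReal M) {s t : ℝ}
    (hs : s ∈ Icc 0 T) (ht : t ∈ Icc 0 T) :
    avgNorm a b (fun x => ψ t x - ψ s x) ≤ M / Real.sqrt (boxVol a b) * |t - s| := by
  rw [avgNorm_sub_coe, div_mul_eq_mul_div]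
  gcongr
  exact (convex_Icc 0 T).norm_image_sub_le_of_norm_derivWithin_le
    (hψ.contDiff_L2.differentiableOn (by simp))
    (fun x hx => norm_derivWithin_solution_le hM0 hM hx) hs ht

lemma avgNorm_solution_le (hab : ∀ j, a j < b j) (hM0 : 0 ≤ M)
    (hM : solutionBound a b V T ψ ≤ ENNReal.ofReal M) {t : ℝ} (ht : t ∈ Icc 0 T) :
    avgNorm a b (ψ t) ≤ M := by
  have h := avgNorm_le_of_le (f := ψ t) hab zero_le_one hM0 (MemLp.zero (p := 2) (ε := ℂ))
    ((ae_norm_solution_le hM0 hM ht).mono fun x hx => by simpa using hx)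
  simpa [avgNorm] using h

lemma fourierCoef_laplacian (hab : ∀ j, a j < b j) {u w : (Fin d → ℝ) → ℂ}
    (h : IsPerLaplacian a b u w) :
    MemLp w 2 (boxMeasure a b) ∧
      ∀ l, fourierCoef a b w l = -(freqSq a b l : ℂ) * fourierCoef a b u l := by
  obtain ⟨D, hD, hw⟩ := h
  have hw' : w = fun x => ∑ j, D j x := funext hw
  subst hw'
  refine ⟨memLp_finsetSum _ fun j _ => (hD j).2.1, fun l => ?_⟩
  rw [fourierCoef_sum _ fun j _ => (hD j).2.1]
  simp only [fun j => (hD j).fourierCoef hab l, ← Finset.sum_mul]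
  congr 1
  unfold freqSq
  push_cast
  rw [← Finset.sum_neg_distrib]
  refine Finset.sum_congr rfl fun j _ => ?_
  rw [Fin.prod_univ_two]
  simp only [Matrix.cons_val_zero, Matrix.cons_val_one]
  linear_combination (freq a b l j : ℂ) ^ 2 * Complex.I_mul_I

lemma fourierCoef_derivWithin (hab : ∀ j, a j < b j) (hψ : IsExactSolution a b V lam T ψ₀ ψ)
    {t : ℝ} (hB : MemLp (opB V lam (ψ t)) 2 (boxMeasure a b)) (ht : t ∈ Ioc 0 T)
    (l : Fin d → ℤ) :
    fourierCoef a b (derivWithin ψ (Icc 0 T) t : L2 a b) l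
      = -Complex.I * freqSq a b l * fourierCoef a b (ψ t) l
        - Complex.I * fourierCoef a b (opB V lam (ψ t)) l := by
  obtain ⟨w, hw, heq⟩ := hψ.equation t ht
  obtain ⟨hw2, hwl⟩ := fourierCoef_laplacian hab hw
  have h1 := fourierCoef_congr heq l
  have h2 : fourierCoef a b (fun x => -w x + opB V lam (ψ t) x) l
      = fourierCoef a b (opB V lam (ψ t)) l - fourierCoef a b w l := by
    rw [← fourierCoef_sub hB hw2]
    congr 1
    ext x
    ring
  rw [fourierCoef_const_mul, h2, hwl] at h1
  linear_combination (-Complex.I) * h1 +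
    (fourierCoef a b (derivWithin ψ (Icc 0 T) t : L2 a b) l) * Complex.I_mul_I

lemma memLp_opB_solution (hV : MemLp V ∞ (boxMeasure a b)) (hM0 : 0 ≤ M)
    (hM : solutionBound a b V T ψ ≤ ENNReal.ofReal M) {t : ℝ} (ht : t ∈ Icc 0 T) :
    MemLp (opB V lam (ψ t)) 2 (boxMeasure a b) :=
  memLp_opB lam hV (Lp.aestronglyMeasurable _) (ae_norm_solution_le hM0 hM ht)

lemma continuousOn_coefVec_solution (hab : ∀ j, a j < b j)
    (hψ : IsExactSolution a b V lam T ψ₀ ψ) :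
    ContinuousOn (fun t => coefVec a b S (ψ t)) (Icc 0 T) :=
  (coefCLM hab S).continuous.comp_continuousOn hψ.contDiff_L2.continuousOn

lemma hasDerivAt_coefVec_solution (hab : ∀ j, a j < b j) (hV : MemLp V ∞ (boxMeasure a b))
    (hψ : IsExactSolution a b V lam T ψ₀ ψ) (hM0 : 0 ≤ M)
    (hM : solutionBound a b V T ψ ≤ ENNReal.ofReal M) {t : ℝ} (ht : t ∈ Ioo 0 T) (l : S) :
    HasDerivAt (fun t => coefVec a b S (ψ t) l)
      (-Complex.I * freqSq a b l * coefVec a b S (ψ t) l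
        - Complex.I * coefVec a b S (opB V lam (ψ t)) l) t := by
  have h1 : HasDerivAt ψ (derivWithin ψ (Icc 0 T) t) t :=
    ((hψ.contDiff_L2.differentiableOn (by simp) t (Ioo_subset_Icc_self ht)).hasDerivWithinAt).hasDerivAt
      (Icc_mem_nhds ht.1 ht.2)
  have h2 := (((EuclideanSpace.proj l : EuclideanSpace ℂ S →L[ℂ] ℂ).restrictScalars ℝ).comp
    (coefCLM hab S)).hasFDerivAt.comp_hasDerivAt t h1
  refine h2.congr_deriv ?_
  exact fourierCoef_derivWithin hab hψ
    (memLp_opB_solution hV hM0 hM (Ioo_subset_Icc_self ht)) ⟨ht.1, ht.2.le⟩ l.1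

end Exact

/-- Comparison of the nonlinear term at two functions. -/
lemma norm_coefVec_opB_sub_le (hab : ∀ j, a j < b j) {V : (Fin d → ℝ) → ℝ} {lam : ℝ}
    (hV : MemLp V ∞ (boxMeasure a b)) {φ χ : (Fin d → ℝ) → ℂ} {ε Λ R K : ℝ}
    (hφ2 : MemLp φ 2 (boxMeasure a b)) (hχ2 : MemLp χ 2 (boxMeasure a b))
    (hε : 0 < ε) (hφ : ∀ᵐ x ∂(boxMeasure a b), ‖φ x‖ ≤ R)
    (hχ : ∀ᵐ x ∂(boxMeasure a b), ‖χ x‖ ≤ R)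
    (hΛ : |Real.log ε| ≤ Λ) (hR : Real.log R ≤ Λ) (hΛ1 : 1 ≤ Λ)
    (hK : ∀ᵐ x ∂(boxMeasure a b), |V x| + 8 * |lam| ≤ K) (hK0 : 0 ≤ K) :
    ‖coefVec a b S (opB V lam φ) - coefVec a b S (opB V lam χ)‖
      ≤ K * Λ * (avgNorm a b (fun x => φ x - χ x) + ε) := by
  have hB := memLp_opB lam hV hφ2.1 hφ
  have hB' := memLp_opB lam hV hχ2.1 hχ
  have hKΛ : 0 ≤ K * Λ := mul_nonneg hK0 (zero_le_one.trans hΛ1)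
  rw [← coefVec_sub hB hB', mul_add]
  refine (norm_coefVec_le hab (hB.sub hB')).trans ?_
  refine avgNorm_le_of_le hab hKΛ (by positivity) (hφ2.sub hχ2) ?_
  filter_upwards [hK, hφ, hχ] with x hx h1 h2
  exact norm_opB_sub_le hε h1 h2 hΛ hR hΛ1 hx

lemma one_le_sobolevWeight (m : ℕ) (l : Fin d → ℤ) : 1 ≤ sobolevWeight a b m l := by
  unfold sobolevWeight
  calc (1 : ℝ) = freqSq a b l ^ 0 := (pow_zero _).symm
    _ ≤ _ := Finset.single_le_sum (f := fun k => freqSq a b l ^ k)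
      (fun k _ => pow_nonneg (freqSq_nonneg l) k) (by simp)

/-- On unresolved modes `1 ≤ h²|μ_l|²`, so each derivative given up gains a factor `h²` in the
squared norm. -/
lemma sobolevWeight_le_mul {m : ℕ} (hm : m ≤ 2) {l : Fin d → ℤ} {h : ℝ} (hh : 0 < h)
    (hl : (h ^ 2)⁻¹ ≤ freqSq a b l) :
    sobolevWeight a b m l ≤ h ^ (2 * (2 - m)) * sobolevWeight a b 2 l := by
  have h1 : 1 ≤ h ^ 2 * freqSq a b l := by
    have := mul_le_mul_of_nonneg_left hl (sq_nonneg h)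
    rwa [mul_inv_cancel₀ (by positivity)] at this
  set A := freqSq a b l
  have hA : 0 ≤ A := freqSq_nonneg l
  interval_cases m
  · simp only [sobolevWeight, Finset.sum_range_succ, Finset.range_zero, Finset.sum_empty]
    norm_num
    have h2 : 1 ≤ h ^ 4 * A ^ 2 := by
      calc (1 : ℝ) ≤ (h ^ 2 * A) ^ 2 := one_le_pow₀ h1
        _ = _ := by ring
    have : 0 ≤ h ^ 4 * (1 + A) := by positivity
    change 1 ≤ h ^ 4 * (1 + A + A ^ 2)
    linarith
  · simp only [sobolevWeight, Finset.sum_range_succ, Finset.range_zero, Finset.sum_empty]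
    norm_num
    change 1 + A ≤ h ^ 2 * (1 + A + A ^ 2)
    nlinarith [mul_le_mul_of_nonneg_right h1 hA, sq_nonneg h]
  · simp

/-- The Sobolev norm of a function with prescribed low modes. -/
lemma weightedSum_le_of_split {m : ℕ} (hm : m ≤ 2) (hab : ∀ j, a j < b j)
    {u r : (Fin d → ℤ) → ℂ} {h W : ℝ} (hh : 0 < h)
    (hS : ∀ l ∉ S, (h ^ 2)⁻¹ ≤ freqSq a b l) (hW : ∀ l ∈ S, sobolevWeight a b m l ≤ W)
    (e : EuclideanSpace ℂ S) (hr : ∀ l (hl : l ∈ S), ‖r l‖ = ‖e ⟨l, hl⟩‖)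
    (hu : ∀ l ∉ S, r l = u l) (hW0 : 0 ≤ W) :
    weightedSum a b m r ≤ ENNReal.ofReal (boxVol a b * (W * ‖e‖ ^ 2))
      + ENNReal.ofReal (h ^ (2 * (2 - m))) * weightedSum a b 2 u := by
  classical
  unfold weightedSum
  rw [ENNReal.ofReal_mul (boxVol_pos hab).le, mul_left_comm, ← mul_add]
  gcongr
  have h1 : ∀ l, ENNReal.ofReal (sobolevWeight a b m l) * ‖r l‖ₑ ^ 2
      ≤ (if l ∈ S then ENNReal.ofReal W * ‖r l‖ₑ ^ 2 else 0)
        + ENNReal.ofReal (h ^ (2 * (2 - m))) *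
          (ENNReal.ofReal (sobolevWeight a b 2 l) * ‖u l‖ₑ ^ 2) := by
    intro l
    by_cases hl : l ∈ S
    · rw [if_pos hl]
      refine le_add_right ?_
      gcongr
      exact hW l hl
    · rw [if_neg hl, zero_add, hu l hl, ← mul_assoc, ← ENNReal.ofReal_mul (by positivity)]
      gcongr
      exact sobolevWeight_le_mul hm hh (hS l hl)
  refine (ENNReal.tsum_le_tsum h1).trans ?_
  rw [ENNReal.tsum_add, ENNReal.tsum_mul_left]
  gcongr
  rw [tsum_eq_sum (s := S) fun l hl => by simp [hl]]
  rw [Finset.sum_congr rfl fun l hl => if_pos hl, ← Finset.mul_sum, tsum_enorm_subtype,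
    ← ENNReal.ofReal_mul hW0]
  gcongr
  rw [EuclideanSpace.norm_eq, EuclideanSpace.norm_eq]
  gcongr with l
  exact (hr l.1 l.2).le

lemma weightedSum_zero (c : (Fin d → ℤ) → ℂ) :
    weightedSum a b 0 c = ENNReal.ofReal (boxVol a b) * ∑' l, ‖c l‖ₑ ^ 2 := by
  simp [weightedSum, sobolevWeight]

lemma eLpNorm_sq_eq_weightedSum (hab : ∀ j, a j < b j) {f : (Fin d → ℝ) → ℂ}
    (hf : MemLp f 2 (boxMeasure a b)) :
    eLpNorm f 2 (boxMeasure a b) ^ 2 = weightedSum a b 0 (fourierCoef a b f) := by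
  rw [weightedSum_zero, parseval hab hf]

lemma le_ofReal_of_sq_le {x : ℝ≥0∞} {y : ℝ} (hy : 0 ≤ y) (h : x ^ 2 ≤ ENNReal.ofReal (y ^ 2)) :
    x ≤ ENNReal.ofReal y := by
  rw [ENNReal.ofReal_pow hy] at h
  exact (ENNReal.pow_le_pow_left_iff two_ne_zero).1 h

/-- The error of the Fourier projection. -/
lemma avgNorm_trigPoly_coefVec_sub_le (hab : ∀ j, a j < b j) {u : (Fin d → ℝ) → ℂ} {h M : ℝ}
    (hh : 0 < h) (hS : ∀ l ∉ S, (h ^ 2)⁻¹ ≤ freqSq a b l) (hu : MemLp u 2 (boxMeasure a b))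
    (hM0 : 0 ≤ M) (hM : weightedSum a b 2 (fourierCoef a b u) ≤ ENNReal.ofReal (M ^ 2)) :
    avgNorm a b (fun x => trigPoly a b (coefVec a b S u) x - u x)
      ≤ h ^ 2 * (M / Real.sqrt (boxVol a b)) := by
  have hm : MemLp (fun x => trigPoly a b (coefVec a b S u) x - u x) 2 (boxMeasure a b) :=
    (memLp_trigPoly _ 2).sub hu
  -- The low modes of the projection error vanish, hence the zero vector; only the high modes
  -- contribute.
  have h1 := weightedSum_le_of_split (m := 0) (W := 1) (S := S) (by norm_num) hab
    (u := fun l => -fourierCoef a b u l)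
    (r := fourierCoef a b (fun x => trigPoly a b (coefVec a b S u) x - u x)) hh hS
    (fun l _ => by simp [sobolevWeight]) (0 : EuclideanSpace ℂ S)
    (fun l hl => by
      rw [fourierCoef_sub (memLp_trigPoly _ 2) hu, fourierCoef_trigPoly hab, dif_pos hl]
      simp [coefVec])
    (fun l hl => by
      rw [fourierCoef_sub (memLp_trigPoly _ 2) hu, fourierCoef_trigPoly hab, dif_neg hl]
      simp) zero_le_one
  rw [← eLpNorm_sq_eq_weightedSum hab hm] at h1
  have h2 : weightedSum a b 2 (fun l => -fourierCoef a b u l)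
      = weightedSum a b 2 (fourierCoef a b u) := by simp [weightedSum]
  rw [h2] at h1
  have h3 : eLpNorm (fun x => trigPoly a b (coefVec a b S u) x - u x) 2 (boxMeasure a b)
      ≤ ENNReal.ofReal (h ^ 2 * M) := by
    refine le_ofReal_of_sq_le (by positivity) (h1.trans ?_)
    have h5 : (h ^ 2 * M) ^ 2 = h ^ (2 * (2 - 0)) * M ^ 2 := by ring
    rw [norm_zero, h5, ENNReal.ofReal_mul (p := h ^ (2 * (2 - 0))) (by positivity)]
    simp only [ne_eq, OfNat.ofNat_ne_zero, not_false_eq_true, zero_pow, mul_zero,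
      ENNReal.ofReal_zero, zero_add]
    gcongr
  have h4 := avgNorm_le_of_eLpNorm_le hab (by positivity) h3
  rwa [mul_div_assoc] at h4

end LogSE

end

/-! ### The scheme as a recursion on coefficient vectors. -/

noncomputable section

namespace LogSE

variable {d : ℕ} {a b : Fin d → ℝ}

section Scheme

variable {V : (Fin d → ℝ) → ℝ} {lam τ : ℝ} {N : Fin d → ℕ} {ψ₀ : (Fin d → ℝ) → ℂ}

lemma sum_freqIndex_eq_trigPoly (S : Finset (Fin d → ℤ)) (f : (Fin d → ℤ) → ℂ)
    (x : Fin d → ℝ) : ∑ l ∈ S, f l * mode a b l x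
      = trigPoly a b (WithLp.toLp 2 fun l : S => f l : EuclideanSpace ℂ S) x := by
  unfold trigPoly
  rw [← Finset.sum_coe_sort]

lemma ewiFS_zero_eq : ewiFS a b V lam N τ ψ₀ 0
    = trigPoly a b (coefVec a b (freqIndex N) ψ₀) := by
  ext x
  exact sum_freqIndex_eq_trigPoly (freqIndex N) (fourierCoef a b ψ₀) x

lemma ewiFS_succ_eq (n : ℕ) : ewiFS a b V lam N τ ψ₀ (n + 1)
    = trigPoly a b (ewiStep a b τ (coefVec a b (freqIndex N) (ewiFS a b V lam N τ ψ₀ n))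
      (coefVec a b (freqIndex N) (opB V lam (ewiFS a b V lam N τ ψ₀ n)))) := by
  ext x
  exact sum_freqIndex_eq_trigPoly (freqIndex N) (fun l =>
    (Complex.exp (-Complex.I * (τ : ℂ) * (freqSq a b l : ℂ)) *
          fourierCoef a b (ewiFS a b V lam N τ ψ₀ n) l
        - Complex.I * (τ : ℂ) * phi1 (-Complex.I * (τ : ℂ) * (freqSq a b l : ℂ)) *
          fourierCoef a b (opB V lam (ewiFS a b V lam N τ ψ₀ n)) l)) x

/-- The Fourier coefficients of the numerical solution. -/
def ewiCoef (a b : Fin d → ℝ) (V : (Fin d → ℝ) → ℝ) (lam : ℝ) (N : Fin d → ℕ) (τ : ℝ)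
    (ψ₀ : (Fin d → ℝ) → ℂ) (n : ℕ) : EuclideanSpace ℂ (freqIndex N) :=
  coefVec a b (freqIndex N) (ewiFS a b V lam N τ ψ₀ n)

lemma ewiFS_eq_trigPoly (hab : ∀ j, a j < b j) (n : ℕ) :
    ewiFS a b V lam N τ ψ₀ n = trigPoly a b (ewiCoef a b V lam N τ ψ₀ n) := by
  unfold ewiCoef
  cases n with
  | zero => rw [ewiFS_zero_eq, coefVec_trigPoly hab]
  | succ n => rw [ewiFS_succ_eq, coefVec_trigPoly hab]

lemma ewiCoef_zero (hab : ∀ j, a j < b j) :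
    ewiCoef a b V lam N τ ψ₀ 0 = coefVec a b (freqIndex N) ψ₀ := by
  unfold ewiCoef
  rw [ewiFS_zero_eq, coefVec_trigPoly hab]

lemma ewiCoef_succ (hab : ∀ j, a j < b j) (n : ℕ) :
    ewiCoef a b V lam N τ ψ₀ (n + 1) = ewiStep a b τ (ewiCoef a b V lam N τ ψ₀ n)
      (coefVec a b (freqIndex N)
        (opB V lam (trigPoly a b (ewiCoef a b V lam N τ ψ₀ n)))) := by
  rw [← ewiFS_eq_trigPoly hab]
  conv_lhs => unfold ewiCoef
  rw [ewiFS_succ_eq, coefVec_trigPoly hab]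
  rfl

end Scheme

/-! ### A priori bound of the numerical solution. -/

variable {S : Finset (Fin d → ℤ)}

lemma norm_trigPoly_le_of_card {Q h ρ : ℝ} (hcard : (S.card : ℝ) ≤ Q / h ^ 3)
    {c : EuclideanSpace ℂ S} (hc : ‖c‖ ≤ ρ) (x : Fin d → ℝ) :
    ‖trigPoly a b c x‖ ≤ Real.sqrt (Q / h ^ 3) * ρ :=
  (norm_trigPoly_le c x).trans (by gcongr)

/-- The rate in the a priori bound of the numerical solution. -/
def stabRate (lam Ci K Ct c₁ : ℝ) : ℝ :=
  4 * |lam| + 8 * Ci * K * Ct * (c₁ + 1) + 16 * K ^ 2 * c₁ ^ 2 + 4 * K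

/-- Here `Z` is the logarithm of the current bound and `c₁ * L + Z` plays the role of `Λ`. All terms
are at most linear in `Z` except `(2τKZ)²`, which `one_add_add_sq_le_exp` absorbs as `4τKZ` in the
exponent; this is the summand `4 * K` of the rate. -/
lemma stab_scalar {lam Ci K Ct c₁ τ h L Z : ℝ} (hτ : 0 < τ) (hh : 0 < h) (hCi : 0 ≤ Ci)
    (hK : 0 ≤ K) (hc : 0 ≤ c₁) (hCt : 0 ≤ Ct) (hZ : 1 ≤ Z) (hL : 0 ≤ L)
    (h1 : τ * L ≤ Ct * h ^ 2)
    (h2 : τ ≤ Ct * h ^ 2) (h3 : τ * L ^ 2 ≤ 4) :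
    1 + τ * (4 * |lam| + 8 * τ * (Ci / h ^ 2) * (K * (c₁ * L + Z))
        + 2 * τ * (K * (c₁ * L + Z)) ^ 2)
      ≤ Real.exp (stabRate lam Ci K Ct c₁ * τ * Z) := by
  have hh2 : 0 < h ^ 2 := by positivity
  have hZ0 : 0 ≤ Z := zero_le_one.trans hZ
  have e1 : τ * L / h ^ 2 ≤ Ct := (div_le_iff₀ hh2).2 h1
  have e2 : τ / h ^ 2 ≤ Ct := (div_le_iff₀ hh2).2 h2
  have t2 : 8 * τ * (Ci / h ^ 2) * (K * (c₁ * L + Z)) ≤ 8 * Ci * K * Ct * (c₁ + 1) * Z := by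
    calc _ = 8 * Ci * K * (c₁ * (τ * L / h ^ 2) + (τ / h ^ 2) * Z) := by field_simp
      _ ≤ 8 * Ci * K * (c₁ * Ct + Ct * Z) := by gcongr
      _ = 8 * Ci * K * Ct * (c₁ + Z) := by ring
      _ ≤ 8 * Ci * K * Ct * ((c₁ + 1) * Z) := by gcongr; nlinarith
      _ = _ := by ring
  have t3 : 2 * τ * (K * (c₁ * L + Z)) ^ 2 ≤ 16 * K ^ 2 * c₁ ^ 2 * Z + 4 * τ * K ^ 2 * Z ^ 2 := by
    calc _ = 2 * τ * K ^ 2 * (c₁ * L + Z) ^ 2 := by ring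
      _ ≤ 2 * τ * K ^ 2 * (2 * (c₁ * L) ^ 2 + 2 * Z ^ 2) := by
        gcongr; nlinarith [sq_nonneg (c₁ * L - Z)]
      _ = 4 * K ^ 2 * c₁ ^ 2 * (τ * L ^ 2) + 4 * τ * K ^ 2 * Z ^ 2 := by ring
      _ ≤ 4 * K ^ 2 * c₁ ^ 2 * 4 + 4 * τ * K ^ 2 * Z ^ 2 := by gcongr
      _ ≤ _ := by
        have : 0 ≤ 16 * K ^ 2 * c₁ ^ 2 := by positivity
        nlinarith
  have t1 : 4 * |lam| ≤ 4 * |lam| * Z := le_mul_of_one_le_right (by positivity) hZ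
  have h4 := one_add_add_sq_le_exp (x := τ * Z * (4 * |lam| + 8 * Ci * K * Ct * (c₁ + 1)
    + 16 * K ^ 2 * c₁ ^ 2)) (y := 2 * τ * K * Z) (by positivity) (by positivity)
  have h5 : τ * Z * (4 * |lam| + 8 * Ci * K * Ct * (c₁ + 1) + 16 * K ^ 2 * c₁ ^ 2)
      + 2 * (2 * τ * K * Z) = stabRate lam Ci K Ct c₁ * τ * Z := by
    unfold stabRate; ring
  rw [h5] at h4
  refine le_trans ?_ h4
  have h6 := mul_le_mul_of_nonneg_left (add_le_add (add_le_add t1 t2) t3) hτ.le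
  refine (add_le_add_right h6 1).trans (le_of_eq ?_)
  ring

lemma opB_zero (V : (Fin d → ℝ) → ℝ) (lam : ℝ) : opB V lam (fun _ => 0) = fun _ => 0 := by
  ext x; simp [opB]

/-- Zero is a fixed point of the scheme, so stability of differences also bounds single solutions.
-/
lemma ewiStep_zero_opB (τ : ℝ) (V : (Fin d → ℝ) → ℝ) (lam : ℝ) :
    ewiStep a b τ (0 : EuclideanSpace ℂ S)
      (coefVec a b S (opB V lam (trigPoly a b (0 : EuclideanSpace ℂ S)))) = 0 := by
  have h1 : trigPoly a b (0 : EuclideanSpace ℂ S) = fun _ => 0 := funext trigPoly_zero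
  rw [h1, opB_zero]
  ext l
  simp [ewiStep, coefVec, fourierCoef]

/-- A priori bound of the numerical solution. -/
lemma norm_scheme_le (hab : ∀ j, a j < b j) {V : (Fin d → ℝ) → ℝ} {lam : ℝ}
    (hV : MemLp V ∞ (boxMeasure a b)) {τ h Ct Ci Q K M₁ T : ℝ} (hτ : 0 < τ)
    (hτ1 : τ < Real.exp (-1)) (hh : 0 < h) (hh1 : h < Real.exp (-1)) (hCt0 : 0 < Ct)
    (hCt : τ * |Real.log τ| ≤ Ct * h ^ 2 / |Real.log h|)
    (hCi : 0 ≤ Ci) (hA : ∀ l ∈ S, freqSq a b l ≤ Ci / h ^ 2)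
    (hQ : 0 < Q) (hcard : (S.card : ℝ) ≤ Q / h ^ 3)
    (hK : ∀ᵐ x ∂(boxMeasure a b), |V x| + 8 * |lam| ≤ K) (hK0 : 0 ≤ K)
    {c : ℕ → EuclideanSpace ℂ S} (hc0 : ‖c 0‖ ≤ M₁)
    (hrec : ∀ n, c (n + 1)
      = ewiStep a b τ (c n) (coefVec a b S (opB V lam (trigPoly a b (c n)))))
    (n : ℕ) (hn : (n : ℝ) * τ ≤ T) :
    ‖c n‖ ≤ Real.exp ((M₁ ^ 2 + 1) * Real.exp (stabRate lam Ci K Ct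
      ((2 + |Real.log Q|) * (1 + |Real.log Ct|)) * T)) := by
  set c₁ := (2 + |Real.log Q|) * (1 + |Real.log Ct|) with hc₁
  have hc₁1 : 1 ≤ c₁ := by
    have := abs_nonneg (Real.log Q)
    have := abs_nonneg (Real.log Ct)
    nlinarith
  set B := stabRate lam Ci K Ct c₁ with hB
  have hB0 : 0 ≤ B := by
    have : 0 ≤ c₁ := by linarith
    unfold B stabRate; positivity
  set L := |Real.log τ| with hL
  have hL1 : 1 ≤ L := one_le_abs_log hτ hτ1
  have hτ1' := (lt_one_of_lt_exp hτ1).le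
  -- The growth rate depends on the bound itself through its logarithm. An exponent that grows
  -- geometrically closes the induction.
  have key : ∀ n : ℕ, ‖c n‖ ^ 2 + τ ^ 2
      ≤ Real.exp ((M₁ ^ 2 + 1) * (1 + B * τ) ^ n) := by
    intro n
    induction n with
    | zero =>
      rw [pow_zero, mul_one]
      have h1 := Real.add_one_le_exp (M₁ ^ 2 + 1)
      have h2 : ‖c 0‖ ^ 2 ≤ M₁ ^ 2 := by gcongr
      have h3 : τ ^ 2 ≤ 1 := pow_le_one₀ hτ.le hτ1'
      linarith
    | succ n ih =>
      set Z := (M₁ ^ 2 + 1) * (1 + B * τ) ^ n with hZ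
      have hZ1 : 1 ≤ Z := by
        have h1 : 1 ≤ (1 + B * τ) ^ n := one_le_pow₀ (by nlinarith [mul_nonneg hB0 hτ.le])
        have h2 : 1 ≤ M₁ ^ 2 + 1 := by nlinarith [sq_nonneg M₁]
        exact one_le_mul_of_one_le_of_one_le h2 h1
      have hcn : ‖c n‖ ≤ Real.exp Z := by
        have h1 : ‖c n‖ ^ 2 ≤ Real.exp Z ^ 2 := by
          have h2 : 1 ≤ Real.exp Z := Real.one_le_exp (zero_le_one.trans hZ1)
          nlinarith [sq_nonneg τ]
        exact le_of_sq_le_sq h1 (Real.exp_pos _).le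
      -- The inverse inequality adds only a multiple of `|ln h|`, hence of `|ln τ|`, to `Z`.
      have hLog : Real.log (Real.sqrt (Q / h ^ 3) * Real.exp Z) ≤ c₁ * L + Z := by
        refine (log_sqrt_mul_le hQ (Real.exp_pos _) hh hh1).trans ?_
        rw [Real.log_exp]
        have := abs_log_h_le hCt0 hτ hτ1 hh hh1 hCt
        have h2 := abs_nonneg (Real.log Q)
        have h3 : (2 + |Real.log Q|) * |Real.log h| ≤ c₁ * L := by
          rw [hc₁, mul_assoc]; gcongr
        linarith
      have hLZ : L ≤ c₁ * L := le_mul_of_one_le_left (by linarith) hc₁1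
      have hstep := norm_sq_ewiStep_opB_le (S := S) hab (lam := lam) hV hτ.le hA (by positivity)
        (c := c n) (c' := 0) hτ (norm_trigPoly_le_of_card hcard hcn)
        (norm_trigPoly_le_of_card hcard (by rw [norm_zero]; positivity))
        (Λ := c₁ * L + Z) (by linarith) hLog (by linarith) hK hK0
      rw [ewiStep_zero_opB, sub_zero, sub_zero, ← hrec] at hstep
      have hs := stab_scalar (lam := lam) hτ hh hCi hK0 (by linarith : 0 ≤ c₁) hCt0.le hZ1
        (by linarith : 0 ≤ L) (tau_mul_log_le hτ hh hh1 hCt) (tau_le hτ hτ1 hh hh1 hCt)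
        (mul_abs_log_sq_le hτ hτ1')
      calc _ ≤ _ := hstep
        -- The exponents add up to `(1 + Bτ)Z`, the next exponent.
        _ ≤ Real.exp (B * τ * Z) * Real.exp Z := by gcongr
        _ = _ := by
          rw [← Real.exp_add, hZ]
          congr 1
          ring
  have h1 := key n
  have hpow : (1 + B * τ) ^ n ≤ Real.exp (B * T) := by
    calc (1 + B * τ) ^ n ≤ Real.exp (B * τ) ^ n := by
          have := Real.add_one_le_exp (B * τ)
          have := mul_nonneg hB0 hτ.le
          gcongr
          linarith
      _ = Real.exp (B * (n * τ)) := by rw [← Real.exp_nat_mul]; congr 1; ring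
      _ ≤ _ := by gcongr
  set Z := (M₁ ^ 2 + 1) * Real.exp (B * T) with hZ
  have h2 : ‖c n‖ ^ 2 ≤ Real.exp Z := by
    refine le_trans (by nlinarith [sq_nonneg τ]) (h1.trans ?_)
    exact Real.exp_le_exp.2 (mul_le_mul_of_nonneg_left hpow (by positivity))
  have hZ0 : 0 ≤ Z := by positivity
  have h3 : ‖c n‖ ^ 2 ≤ Real.exp Z ^ 2 := by
    have := Real.one_le_exp hZ0
    nlinarith
  exact le_of_sq_le_sq h3 (Real.exp_pos _).le

/-! ### Consistency and the error of the coefficients. -/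

/-- One step of the error recursion, for a perturbed recursion. -/
lemma perturbed_step {X r τ γ Y D : ℝ} (hX : X ^ 2 + τ ^ 2 ≤ (1 + τ * γ) * Y) (hγ : 0 ≤ γ)
    (hY : 0 ≤ Y) (hτ : 0 < τ) (hτ1 : τ ≤ 1) (hX0 : 0 ≤ X) (hr0 : 0 ≤ r) (hr : r ≤ τ * D) {e : ℝ}
    (he0 : 0 ≤ e) (he : e ≤ X + r) :
    e ^ 2 + τ ^ 2 ≤ (1 + τ * (1 + 2 * γ)) * Y + τ * (2 * D ^ 2) := by
  have h1 : e ^ 2 ≤ (X + r) ^ 2 := by gcongr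
  have h2 : r ^ 2 ≤ τ ^ 2 * D ^ 2 := by
    calc r ^ 2 ≤ (τ * D) ^ 2 := by gcongr
      _ = _ := by ring
  have hD : 0 ≤ D := by
    by_contra hD
    have := mul_neg_of_pos_of_neg hτ (not_le.1 hD)
    linarith
  -- Young's inequality: since `r` carries a factor `τ`, so does every term it produces.
  have h3 : 2 * X * r ≤ τ * X ^ 2 + τ * D ^ 2 := by
    have : 2 * X * r ≤ 2 * X * (τ * D) := by gcongr
    nlinarith [mul_nonneg hτ.le (sq_nonneg (X - D))]
  have h4 : (1 + τ) * (X ^ 2 + τ ^ 2) ≤ (1 + τ) * ((1 + τ * γ) * Y) := by gcongr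
  have h5 : (1 + τ) * ((1 + τ * γ) * Y) ≤ (1 + τ * (1 + 2 * γ)) * Y := by
    have : (1 + τ) * (1 + τ * γ) ≤ 1 + τ * (1 + 2 * γ) := by
      nlinarith [mul_nonneg hτ.le hγ, mul_nonneg (mul_nonneg hτ.le hγ) (sub_nonneg.2 hτ1)]
    calc _ = ((1 + τ) * (1 + τ * γ)) * Y := by ring
      _ ≤ _ := by gcongr
  have h6 : τ ^ 2 * D ^ 2 ≤ τ * D ^ 2 := by
    have : τ ^ 2 ≤ τ := by nlinarith
    gcongr
  nlinarith [mul_nonneg hτ.le (sq_nonneg τ)]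

/-- The rate in the error recursion. -/
def errRate (lam Ci K Ct c₂ : ℝ) : ℝ :=
  4 * |lam| + 8 * Ci * K * Ct * c₂ + 8 * K ^ 2 * c₂ ^ 2

/-- The a priori bound now permits `Λ = c₂ * L` with a fixed `c₂`; the mesh condition and `τL² ≤ 4`
remove both logarithms from the rate. -/
lemma err_scalar {lam Ci K Ct c₂ τ h L : ℝ} (hh : 0 < h) (hCi : 0 ≤ Ci)
    (hK : 0 ≤ K) (hc : 0 ≤ c₂) (h1 : τ * L ≤ Ct * h ^ 2) (h3 : τ * L ^ 2 ≤ 4) :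
    4 * |lam| + 8 * τ * (Ci / h ^ 2) * (K * (c₂ * L)) + 2 * τ * (K * (c₂ * L)) ^ 2
      ≤ errRate lam Ci K Ct c₂ := by
  have hh2 : 0 < h ^ 2 := by positivity
  have e1 : τ * L / h ^ 2 ≤ Ct := (div_le_iff₀ hh2).2 h1
  have t2 : 8 * τ * (Ci / h ^ 2) * (K * (c₂ * L)) ≤ 8 * Ci * K * Ct * c₂ := by
    calc _ = 8 * Ci * K * c₂ * (τ * L / h ^ 2) := by field_simp
      _ ≤ 8 * Ci * K * c₂ * Ct := by gcongr
      _ = _ := by ring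
  have t3 : 2 * τ * (K * (c₂ * L)) ^ 2 ≤ 8 * K ^ 2 * c₂ ^ 2 := by
    calc _ = 2 * K ^ 2 * c₂ ^ 2 * (τ * L ^ 2) := by ring
      _ ≤ 2 * K ^ 2 * c₂ ^ 2 * 4 := by gcongr
      _ = _ := by ring
  unfold errRate
  linarith

/-- The consistency error of one step. -/
lemma norm_consistency_le (hab : ∀ j, a j < b j) {V : (Fin d → ℝ) → ℝ} {lam T M : ℝ}
    {ψ₀ : L2 a b} {ψ : ℝ → L2 a b} (hV : MemLp V ∞ (boxMeasure a b))
    (hψ : IsExactSolution a b V lam T ψ₀ ψ) (hM1 : 1 ≤ M)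
    (hM : solutionBound a b V T ψ ≤ ENNReal.ofReal M)
    {τ h Q K : ℝ} (hτ : 0 < τ)
    (hτ1 : τ < Real.exp (-1)) (hh : 0 < h) (hh1 : h < Real.exp (-1))
    (hS : ∀ l ∉ S, (h ^ 2)⁻¹ ≤ freqSq a b l)
    (hQ : 0 < Q) (hcard : (S.card : ℝ) ≤ Q / h ^ 3)
    (hK : ∀ᵐ x ∂(boxMeasure a b), |V x| + 8 * |lam| ≤ K) (hK0 : 0 ≤ K)
    {t : ℝ} (ht0 : 0 ≤ t) (htT : t + τ ≤ T) :
    ‖coefVec a b S (ψ (t + τ)) - ewiStep a b τ (coefVec a b S (ψ t))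
        (coefVec a b S (opB V lam (trigPoly a b (coefVec a b S (ψ t)))))‖
      ≤ τ * (K * (4 + |Real.log Q| + Real.log M) * (M / Real.sqrt (boxVol a b) + 1)
        * (τ * |Real.log τ| + h ^ 2 * |Real.log h|)) := by
  have hM0 : 0 ≤ M := zero_le_one.trans hM1
  have hlogM : 0 ≤ Real.log M := Real.log_nonneg hM1
  have ht : t ∈ Icc 0 T := ⟨ht0, by linarith⟩
  have hLτ := one_le_abs_log hτ hτ1
  have hLh := one_le_abs_log hh hh1
  have hvol : 0 < Real.sqrt (boxVol a b) := Real.sqrt_pos.2 (boxVol_pos hab)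
  have hlogQ := abs_nonneg (Real.log Q)
  set m := M / Real.sqrt (boxVol a b) with hm
  have hm0 : 0 ≤ m := by positivity
  set c := 4 + |Real.log Q| + Real.log M with hc
  -- Error of freezing `B(ψ)` at time `t`. Since `ψ` is Lipschitz in time with values in `L²`, the
  -- cutoff `ε = τ` matches its variation over a step.
  have hloc : ‖coefVec a b S (ψ (t + τ)) - ewiStep a b τ (coefVec a b S (ψ t))
      (coefVec a b S (opB V lam (ψ t)))‖ ≤ τ * (K * c * (m + 1) * (τ * |Real.log τ|)) := by
    refine norm_sub_ewiStep_le (p := fun t => coefVec a b S (ψ t))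
      (g := fun s => coefVec a b S (opB V lam (ψ s))) hτ ?_ ?_ ?_
    · exact (continuousOn_coefVec_solution hab hψ).mono (Icc_subset_Icc ht0 htT)
    · exact fun s hs l => hasDerivAt_coefVec_solution hab hV hψ hM0 hM
        ⟨ht0.trans_lt hs.1, hs.2.trans_le htT⟩ l
    · intro s hs
      have hs' : s ∈ Icc 0 T := ⟨ht0.trans hs.1.le, hs.2.le.trans htT⟩
      have h1 := norm_coefVec_opB_sub_le (S := S) hab (lam := lam) hV (Lp.memLp (ψ s))
        (Lp.memLp (ψ t)) hτ
        (ae_norm_solution_le hM0 hM hs') (ae_norm_solution_le hM0 hM ht)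
        (Λ := c * |Real.log τ|) (by nlinarith) (by nlinarith) (by nlinarith) hK hK0
      have h2 := avgNorm_solution_sub_le hψ hM0 hM ht hs'
      have h3 : |s - t| ≤ τ := by
        rw [abs_of_pos (sub_pos.2 hs.1)]; linarith [hs.2]
      refine h1.trans ?_
      calc _ ≤ K * (c * |Real.log τ|) * (m * τ + τ) := by
            gcongr
            exact h2.trans (by gcongr)
        _ = _ := by ring
  -- Error of evaluating `B` at the projected solution; `ε = h ^ 2` matches the projection error.
  -- The projection is bounded pointwise only through the inverse inequality, which costs `|ln h|`.
  have hproj : ‖coefVec a b S (opB V lam (trigPoly a b (coefVec a b S (ψ t))))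
      - coefVec a b S (opB V lam (ψ t))‖ ≤ K * c * (m + 1) * (h ^ 2 * |Real.log h|) := by
    have hp : ‖coefVec a b S (ψ t)‖ ≤ M :=
      (norm_coefVec_le hab (Lp.memLp _)).trans (avgNorm_solution_le hab hM0 hM ht)
    have hsq : 0 < Real.sqrt (Q / h ^ 3) * M := by positivity
    have h1 := norm_coefVec_opB_sub_le (S := S) hab (lam := lam) hV
      (memLp_trigPoly (a := a) (b := b) (coefVec a b S (ψ t)) 2) (Lp.memLp (ψ t))
      (ε := h ^ 2) (by positivity)
      (R := max (Real.sqrt (Q / h ^ 3) * M) M)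
      (ae_of_all _ fun x => (norm_trigPoly_le_of_card hcard hp x).trans (le_max_left _ _))
      ((ae_norm_solution_le hM0 hM ht).mono fun x hx => hx.trans (le_max_right _ _))
      (Λ := c * |Real.log h|)
      (by rw [Real.log_pow, abs_mul]; push_cast; rw [abs_two]; nlinarith)
      (by
        rcases max_cases (Real.sqrt (Q / h ^ 3) * M) M with ⟨he, _⟩ | ⟨he, _⟩
        · rw [he]
          refine (log_sqrt_mul_le hQ (by linarith) hh hh1).trans ?_
          nlinarith
        · rw [he]; nlinarith)
      (by nlinarith) hK hK0
    have h2 := avgNorm_trigPoly_coefVec_sub_le hab hh hS (Lp.memLp (ψ t)) hM0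
      (weightedSum_solution_le hab hψ hM0 hM ht)
    refine h1.trans ?_
    calc _ ≤ K * (c * |Real.log h|) * (h ^ 2 * m + h ^ 2) := by gcongr
      _ = _ := by ring
  have hsplit : coefVec a b S (ψ (t + τ)) - ewiStep a b τ (coefVec a b S (ψ t))
        (coefVec a b S (opB V lam (trigPoly a b (coefVec a b S (ψ t)))))
      = (coefVec a b S (ψ (t + τ)) - ewiStep a b τ (coefVec a b S (ψ t))
        (coefVec a b S (opB V lam (ψ t))))
        - ewiStep a b τ 0 (coefVec a b S (opB V lam (trigPoly a b (coefVec a b S (ψ t))))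
          - coefVec a b S (opB V lam (ψ t))) := by
    have := ewiStep_sub (a := a) (b := b) τ (coefVec a b S (ψ t))
      (coefVec a b S (opB V lam (trigPoly a b (coefVec a b S (ψ t))))) (coefVec a b S (ψ t))
      (coefVec a b S (opB V lam (ψ t)))
    rw [sub_self] at this
    rw [← this]
    abel
  rw [hsplit]
  refine (norm_sub_le _ _).trans ?_
  have h4 := (norm_ewiStep_zero_le (a := a) (b := b) hτ.le
    (coefVec a b S (opB V lam (trigPoly a b (coefVec a b S (ψ t))))
          - coefVec a b S (opB V lam (ψ t)))).trans
    (mul_le_mul_of_nonneg_left hproj hτ.le)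
  linarith

/-- The error of the Fourier coefficients. -/
lemma norm_scheme_sub_le (hab : ∀ j, a j < b j) (lam T M Ct Ci Q : ℝ) (hT : 0 < T) (hM1 : 1 ≤ M)
    (hCt0 : 0 < Ct) (hCi : 0 ≤ Ci) (hQ : 0 < Q) :
    ∃ C : ℝ, 0 < C ∧ ∀ (V : (Fin d → ℝ) → ℝ) (ψ₀ : L2 a b) (ψ : ℝ → L2 a b),
      MemLp V ∞ (boxMeasure a b) → IsExactSolution a b V lam T ψ₀ ψ →
      solutionBound a b V T ψ ≤ ENNReal.ofReal M →
      ∀ (S : Finset (Fin d → ℤ)) (c : ℕ → EuclideanSpace ℂ S) (τ h : ℝ), 0 < τ →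
        τ < Real.exp (-1) → 0 < h → h < Real.exp (-1) →
        τ * |Real.log τ| ≤ Ct * h ^ 2 / |Real.log h| →
        (∀ l ∈ S, freqSq a b l ≤ Ci / h ^ 2) → (∀ l ∉ S, (h ^ 2)⁻¹ ≤ freqSq a b l) →
        ((S.card : ℝ) ≤ Q / h ^ 3) → c 0 = coefVec a b S ψ₀ →
        (∀ n, c (n + 1)
          = ewiStep a b τ (c n) (coefVec a b S (opB V lam (trigPoly a b (c n))))) →
        ∀ n : ℕ, (n : ℝ) * τ ≤ T → ‖c n - coefVec a b S (ψ (n * τ))‖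
          ≤ C * (τ * |Real.log τ| + h ^ 2 * |Real.log h|) := by
  have hM0 : 0 ≤ M := zero_le_one.trans hM1
  set K := M + 8 * |lam| with hKdef
  have hK0 : 0 ≤ K := by positivity
  set c₁ := (2 + |Real.log Q|) * (1 + |Real.log Ct|) with hc₁
  -- A common bound for the coefficient vectors of the numerical and the exact solution; only
  -- `Real.log ρ` enters the rate.
  set ρ := max M (Real.exp ((M ^ 2 + 1) * Real.exp (stabRate lam Ci K Ct c₁ * T))) with hρ
  have hρ1 : 1 ≤ ρ := hM1.trans (le_max_left _ _)
  have hlogρ : 0 ≤ Real.log ρ := Real.log_nonneg hρ1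
  have hc₁1 : 1 ≤ c₁ := by
    have := abs_nonneg (Real.log Q)
    have := abs_nonneg (Real.log Ct)
    nlinarith
  set c₂ := c₁ + Real.log ρ with hc₂
  set γ := errRate lam Ci K Ct c₂ with hγ
  have hγ0 : 0 ≤ γ := by
    have : 0 ≤ c₂ := by linarith
    unfold γ errRate; positivity
  set D := K * (4 + |Real.log Q| + Real.log M) * (M / Real.sqrt (boxVol a b) + 1) with hD
  have hD0 : 0 ≤ D := by
    have := Real.log_nonneg hM1
    positivity
  refine ⟨Real.sqrt (Real.exp ((1 + 2 * γ) * T) * (1 + T * (2 * D ^ 2))),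
    Real.sqrt_pos.2 (by positivity), ?_⟩
  intro V ψ₀ ψ hV hψ hM S c τ h hτ hτ1 hh hh1 hCt hA hS hcard hc0 hrec n hn
  set η := τ * |Real.log τ| + h ^ 2 * |Real.log h| with hη
  have hη0 : 0 ≤ η := by positivity
  have hL1 : 1 ≤ |Real.log τ| := one_le_abs_log hτ hτ1
  have hτ1' := (lt_one_of_lt_exp hτ1).le
  have hKV : ∀ᵐ x ∂(boxMeasure a b), |V x| + 8 * |lam| ≤ K :=
    (ae_norm_potential_le hM0 hM).mono fun x hx => by linarith
  have hmemT : ∀ n : ℕ, (n : ℝ) * τ ≤ T → (n : ℝ) * τ ∈ Icc 0 T := fun n hn =>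
    ⟨by positivity, hn⟩
  have hp : ∀ n : ℕ, (n : ℝ) * τ ≤ T → ‖coefVec a b S (ψ (n * τ))‖ ≤ M := fun n hn =>
    (norm_coefVec_le hab (Lp.memLp _)).trans (avgNorm_solution_le hab hM0 hM (hmemT n hn))
  have hc0' : c 0 = coefVec a b S (ψ ((0 : ℕ) * τ)) := by
    rw [hc0]
    simp only [Nat.cast_zero, zero_mul, hψ.initial]
  have hcM : ‖c 0‖ ≤ M := by
    rw [hc0']
    exact hp 0 (by simpa using hT.le)
  have hstab : ∀ n : ℕ, (n : ℝ) * τ ≤ T → ‖c n‖ ≤ ρ := fun n hn =>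
    (norm_scheme_le hab hV hτ hτ1 hh hh1 hCt0 hCt hCi hA hQ hcard hKV hK0 hcM hrec n hn).trans
      (le_max_right _ _)
  have hLog : Real.log (Real.sqrt (Q / h ^ 3) * ρ) ≤ c₂ * |Real.log τ| := by
    refine (log_sqrt_mul_le hQ (by linarith) hh hh1).trans ?_
    have := abs_log_h_le hCt0 hτ hτ1 hh hh1 hCt
    have h2 := abs_nonneg (Real.log Q)
    have h3 : (2 + |Real.log Q|) * |Real.log h| ≤ c₁ * |Real.log τ| := by
      rw [hc₁, mul_assoc]; gcongr
    have h4 : Real.log ρ ≤ Real.log ρ * |Real.log τ| := le_mul_of_one_le_right hlogρ hL1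
    rw [hc₂, add_mul]
    linarith
  have hLL : |Real.log τ| ≤ c₂ * |Real.log τ| :=
    le_mul_of_one_le_left (abs_nonneg _) (by linarith)
  -- The summand `τ ^ 2` is the `ε ^ 2` of the stability estimate with `ε = τ`. It is also the whole
  -- initial value, since the scheme starts from the projection of `ψ₀`.
  have hgr := discrete_gronwall (Y := fun n => ‖c n - coefVec a b S (ψ (n * τ))‖ ^ 2 + τ ^ 2)
    (γ := 1 + 2 * γ) (τ := τ) (D := 2 * (D * η) ^ 2) (T := T) (by positivity) hτ.le (by positivity)
    (fun n hn => by
      have hn' : (n : ℝ) * τ ≤ T :=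
        le_trans (mul_le_mul_of_nonneg_right (by simp) hτ.le) hn
      have h1 := norm_sq_ewiStep_opB_le (S := S) hab (lam := lam) hV hτ.le hA (by positivity)
        (c := c n) (c' := coefVec a b S (ψ (n * τ))) hτ
        (norm_trigPoly_le_of_card hcard (hstab n hn'))
        (norm_trigPoly_le_of_card hcard ((hp n hn').trans (le_max_left _ _)))
        (Λ := c₂ * |Real.log τ|) hLL hLog (hL1.trans hLL) hKV hK0
      have h2 := err_scalar (lam := lam) hh hCi hK0 (by linarith : 0 ≤ c₂)
        (tau_mul_log_le hτ hh hh1 hCt) (mul_abs_log_sq_le hτ hτ1')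
      have ht : ((n + 1 : ℕ) : ℝ) * τ = n * τ + τ := by push_cast; ring
      have h3 := norm_consistency_le hab hV hψ hM1 hM hτ hτ1 hh hh1 hS hQ hcard hKV hK0
        (t := n * τ) (by positivity) (by rw [← ht]; exact hn)
      refine perturbed_step (h1.trans ?_) hγ0 (by positivity) hτ hτ1' (norm_nonneg _)
        (norm_nonneg _) h3 (norm_nonneg _) ?_
      · gcongr
      · rw [hrec, ht]
        refine le_trans (le_of_eq ?_) (norm_sub_le _ _)
        congr 1
        abel) n hn
  have hY0 : ‖c 0 - coefVec a b S (ψ ((0 : ℕ) * τ))‖ ^ 2 + τ ^ 2 = τ ^ 2 := by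
    rw [← hc0', sub_self, norm_zero]; ring
  simp only [hY0] at hgr
  have hτη : τ ≤ η := by
    have h1 : 0 ≤ h ^ 2 * |Real.log h| := by positivity
    have h2 : τ ≤ τ * |Real.log τ| := le_mul_of_one_le_right hτ.le hL1
    linarith
  have hfin : ‖c n - coefVec a b S (ψ (n * τ))‖ ^ 2
      ≤ (Real.exp ((1 + 2 * γ) * T) * (1 + T * (2 * D ^ 2))) * η ^ 2 := by
    have hpos : 0 ≤ (n : ℝ) * τ := by positivity
    calc _ ≤ _ := (le_add_of_nonneg_right (sq_nonneg τ)).trans hgr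
      _ ≤ Real.exp ((1 + 2 * γ) * T) * (η ^ 2 + T * (2 * (D * η) ^ 2)) := by
        rw [abs_of_nonneg (sq_nonneg τ)]
        gcongr
      _ = _ := by ring
  refine le_of_sq_le_sq ?_ (by positivity)
  rw [mul_pow, Real.sq_sqrt (by positivity)]
  exact hfin

end LogSE

end

/-! ### Finiteness of `M(ψ, V)` and the embedding of `H²` in `L^∞`. -/

noncomputable section

namespace LogSE

variable {d : ℕ} {a b : Fin d → ℝ}

/-- A function is bounded by the sum of its Fourier coefficients. -/
lemma ae_enorm_le_tsum (hab : ∀ j, a j < b j) {u : (Fin d → ℝ) → ℂ}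
    (hu : MemLp u 2 (boxMeasure a b)) :
    ∀ᵐ x ∂(boxMeasure a b), ‖u x‖ₑ ≤ ∑' l, ‖fourierCoef a b u l‖ₑ := by
  have hsq : ∑' l, ‖fourierCoef a b u l‖ₑ ^ 2 ≠ ⊤ := by
    rw [← sq_avgNorm hab hu]; exact ENNReal.ofReal_ne_top
  have herr : ∀ S : Finset (Fin d → ℤ),
      eLpNorm (trigPoly a b (coefVec a b S u) - u) 2 (boxMeasure a b) ^ 2
        = ENNReal.ofReal (boxVol a b)
          * ∑' l : {l // l ∉ S}, ‖fourierCoef a b u l‖ₑ ^ 2 := by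
    intro S
    classical
    rw [← parseval hab ((memLp_trigPoly _ 2).sub hu)]
    congr 1
    have h2 : ∑' l : {l // l ∉ S}, ‖fourierCoef a b u l‖ₑ ^ 2
        = ∑' l, ({l | l ∉ S} : Set (Fin d → ℤ)).indicator
            (fun l => ‖fourierCoef a b u l‖ₑ ^ 2) l :=
      tsum_subtype {l | l ∉ S} fun l => ‖fourierCoef a b u l‖ₑ ^ 2
    rw [h2]
    refine tsum_congr fun l => ?_
    have h1 : fourierCoef a b (trigPoly a b (coefVec a b S u) - u) l
        = fourierCoef a b (trigPoly a b (coefVec a b S u)) l - fourierCoef a b u l :=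
      fourierCoef_sub (memLp_trigPoly _ 2) hu l
    rw [h1, fourierCoef_trigPoly hab]
    by_cases hl : l ∈ S
    · simp [hl, coefVec]
    · simp [hl]
  have hlim : Tendsto (fun S : Finset (Fin d → ℤ) =>
      eLpNorm (trigPoly a b (coefVec a b S u) - u) 2 (boxMeasure a b)) atTop (𝓝 0) := by
    have h1 := ENNReal.Tendsto.const_mul (a := ENNReal.ofReal (boxVol a b))
      (ENNReal.tendsto_tsum_compl_atTop_zero hsq) (Or.inr ENNReal.ofReal_ne_top)
    rw [mul_zero] at h1
    simp only [← herr] at h1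
    have h2 := (ENNReal.continuous_rpow_const (y := (1 / 2 : ℝ))).tendsto 0 |>.comp h1
    rw [ENNReal.zero_rpow_of_pos (by norm_num)] at h2
    refine h2.congr fun S => ?_
    simp only [Function.comp]
    rw [← ENNReal.rpow_natCast, ← ENNReal.rpow_mul]
    norm_num
  -- Convergence of the partial sums in `L²` gives a sequence of them converging almost everywhere,
  -- each bounded by the sum of the moduli of the coefficients.
  obtain ⟨ns, -, hns⟩ := (tendstoInMeasure_of_tendsto_eLpNorm two_ne_zero
    (fun S => (memLp_trigPoly (coefVec a b S u) 2).1) hu.1 hlim).exists_seq_tendsto_ae'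
  filter_upwards [hns] with x hx
  refine le_of_tendsto hx.enorm (Eventually.of_forall fun i => ?_)
  unfold trigPoly
  refine (enorm_sum_le _ _).trans ?_
  change ∑ l : ns i, ‖fourierCoef a b u l * mode a b l x‖ₑ ≤ _
  rw [Finset.sum_coe_sort (ns i) fun l => ‖fourierCoef a b u l * mode a b l x‖ₑ]
  refine le_trans (Finset.sum_le_sum fun l _ => ?_) (ENNReal.sum_le_tsum (ns i))
  rw [enorm_mul, ← ofReal_norm (mode a b l x), norm_mode]
  simp

lemma tsum_prod_le {κ : Type*} (g : Fin d → κ → ℝ≥0∞) :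
    ∑' l : Fin d → κ, ∏ j, g j (l j) ≤ ∏ j, ∑' m, g j m := by
  classical
  rw [ENNReal.tsum_eq_iSup_sum]
  refine iSup_le fun F => ?_
  calc _ ≤ ∑ l ∈ Fintype.piFinset fun j => F.image fun l => l j, ∏ j, g j (l j) := by
        refine Finset.sum_le_sum_of_subset fun l hl => ?_
        rw [Fintype.mem_piFinset]
        exact fun j => Finset.mem_image_of_mem (fun l => l j) hl
    _ = ∏ j, ∑ m ∈ F.image fun l => l j, g j m := (Finset.prod_univ_sum _ _).symm
    _ ≤ _ := Finset.prod_le_prod' fun j _ => ENNReal.sum_le_tsum _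

lemma summable_one_add_sq_rpow {c : ℝ} (hc : 0 < c) :
    Summable fun m : ℤ => (1 + (c * m) ^ 2) ^ (-(2 / 3) : ℝ) := by
  have h1 := (Real.summable_abs_int_rpow (b := 4 / 3) (by norm_num)).mul_left
    ((c ^ 2) ^ (-(2 / 3) : ℝ))
  refine Summable.of_norm_bounded_eventually h1 ?_
  have h2 : ∀ᶠ m : ℤ in cofinite, m ≠ 0 := eventually_cofinite_ne 0
  filter_upwards [h2] with m hm
  have hm' : (0 : ℝ) < |(m : ℝ)| := abs_pos.2 (by exact_mod_cast hm)
  rw [Real.norm_eq_abs, abs_of_nonneg (by positivity)]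
  have h3 : |(m : ℝ)| ^ (-(4 / 3) : ℝ) = (|(m : ℝ)| ^ 2) ^ (-(2 / 3) : ℝ) := by
    rw [← Real.rpow_natCast, ← Real.rpow_mul hm'.le]
    norm_num
  rw [h3, ← Real.mul_rpow (by positivity) (by positivity), sq_abs, ← mul_pow]
  refine Real.rpow_le_rpow_of_nonpos ?_ (by linarith) (by norm_num)
  have : (m : ℝ) ≠ 0 := by exact_mod_cast hm
  positivity

/-- With `A = |μ_l|²`, each factor `1 + μ_j²` is at most `1 + A`, so for `d ≤ 3` their product is at
most `(1 + A)³`. The power `-2/3` turns this into `(1 + A)⁻²`, which is comparable to the inverse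
weight, while each factor decays like `|l_j|^{-4/3}` and is summable. -/
lemma inv_sobolevWeight_le (hd3 : d ≤ 3) (l : Fin d → ℤ) :
    (sobolevWeight a b 2 l)⁻¹
      ≤ 2 * ∏ j, (1 + freq a b l j ^ 2) ^ (-(2 / 3) : ℝ) := by
  set A := freqSq a b l with hA
  have hA0 : 0 ≤ A := freqSq_nonneg l
  have hw : sobolevWeight a b 2 l = 1 + A + A ^ 2 := by
    simp [sobolevWeight, Finset.sum_range_succ, hA]
  have h1 : ∏ j, (1 + freq a b l j ^ 2) ≤ (1 + A) ^ 3 := by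
    calc _ ≤ ∏ _j : Fin d, (1 + A) := by
          refine Finset.prod_le_prod (fun j _ => by positivity) fun j _ => ?_
          have := Finset.single_le_sum (f := fun j => freq a b l j ^ 2)
            (fun i _ => sq_nonneg _) (Finset.mem_univ j)
          simp only [hA, freqSq]
          linarith
      _ = (1 + A) ^ d := by simp
      _ ≤ _ := pow_le_pow_right₀ (by linarith) hd3
  have h2 : ((1 + A) ^ 2)⁻¹ ≤ (∏ j, (1 + freq a b l j ^ 2)) ^ (-(2 / 3) : ℝ) := by
    have h3 : ((1 + A) ^ 2)⁻¹ = ((1 + A) ^ 3) ^ (-(2 / 3) : ℝ) := by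
      rw [← Real.rpow_natCast (1 + A) 3, ← Real.rpow_mul (by positivity)]
      norm_num
    rw [h3]
    exact Real.rpow_le_rpow_of_nonpos (Finset.prod_pos fun j _ => by positivity) h1 (by norm_num)
  rw [Real.finsetProd_rpow _ _ fun j _ => by positivity]
  have h4 : (sobolevWeight a b 2 l)⁻¹ ≤ 2 * ((1 + A) ^ 2)⁻¹ := by
    rw [hw, ← div_eq_mul_inv, inv_eq_one_div, div_le_div_iff₀ (by positivity) (by positivity)]
    nlinarith [sq_nonneg A]
  linarith

lemma tsum_inv_sobolevWeight_lt_top (hd3 : d ≤ 3) (hab : ∀ j, a j < b j) :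
    ∑' l, ENNReal.ofReal (sobolevWeight a b 2 l)⁻¹ < ⊤ := by
  set g : Fin d → ℤ → ℝ := fun j m =>
    (1 + (2 * Real.pi / (b j - a j) * m) ^ 2) ^ (-(2 / 3) : ℝ) with hg
  have hsum : ∀ j, Summable (g j) := fun j =>
    summable_one_add_sq_rpow (div_pos (by positivity) (sub_pos.2 (hab j)))
  have h1 : ∀ l, ENNReal.ofReal (sobolevWeight a b 2 l)⁻¹
      ≤ 2 * ∏ j, ENNReal.ofReal (g j (l j)) := by
    intro l
    refine (ENNReal.ofReal_le_ofReal (inv_sobolevWeight_le hd3 l)).trans (le_of_eq ?_)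
    rw [ENNReal.ofReal_mul (by norm_num), ENNReal.ofReal_prod_of_nonneg fun j _ => by positivity]
    congr 1
    · simp
    · refine Finset.prod_congr rfl fun j _ => ?_
      simp only [hg, freq]
      congr 4
      ring
  refine (ENNReal.tsum_le_tsum h1).trans_lt ?_
  rw [ENNReal.tsum_mul_left]
  refine ENNReal.mul_lt_top (by simp) ((tsum_prod_le fun j m => ENNReal.ofReal (g j m)).trans_lt ?_)
  refine ENNReal.prod_lt_top fun j _ => ?_
  exact (hsum j).tsum_ofReal_lt_top

/-- The embedding of `H²` in `L^∞` in dimension at most three. -/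
lemma eLpNorm_top_le (hab : ∀ j, a j < b j) {u : (Fin d → ℝ) → ℂ}
    (hu : HasWeakDerivs a b 2 u) :
    eLpNorm u ∞ (boxMeasure a b) ≤ ∑' l, ENNReal.ofReal (sobolevWeight a b 2 l)⁻¹
      + (ENNReal.ofReal (boxVol a b))⁻¹ * sobolevNorm a b 2 u ^ 2 := by
  -- Termwise `x ≤ 1/w + w x²` in place of Cauchy–Schwarz: the bound is quadratic in the norm,
  -- enough for finiteness.
  have h1 : ∀ l, ‖fourierCoef a b u l‖ₑ ≤ ENNReal.ofReal (sobolevWeight a b 2 l)⁻¹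
      + ENNReal.ofReal (sobolevWeight a b 2 l) * ‖fourierCoef a b u l‖ₑ ^ 2 := by
    intro l
    have hw : 0 < sobolevWeight a b 2 l := zero_lt_one.trans_le (one_le_sobolevWeight 2 l)
    rw [← ofReal_norm, ← ENNReal.ofReal_pow (norm_nonneg _), ← ENNReal.ofReal_mul hw.le,
      ← ENNReal.ofReal_add (by positivity) (by positivity)]
    refine ENNReal.ofReal_le_ofReal ?_
    set w := sobolevWeight a b 2 l
    set x := ‖fourierCoef a b u l‖
    have h2 : w * (w⁻¹ + w * x ^ 2 - x) = (w * x - 1 / 2) ^ 2 + 3 / 4 := by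
      field_simp
      ring
    have h3 : 0 ≤ w⁻¹ + w * x ^ 2 - x := by
      refine nonneg_of_mul_nonneg_right ?_ hw
      rw [h2]; positivity
    linarith
  rw [eLpNorm_exponent_top]
  refine essSup_le_of_ae_le _ ?_
  filter_upwards [ae_enorm_le_tsum hab hu.memLp] with x hx
  refine hx.trans ((ENNReal.tsum_le_tsum h1).trans ?_)
  rw [ENNReal.tsum_add, sobolevNorm_sq hab hu]
  gcongr
  unfold weightedSum
  rw [← mul_assoc, ENNReal.inv_mul_cancel (by simpa using boxVol_pos hab) ENNReal.ofReal_ne_top,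
    one_mul]

lemma enorm_sq_le_two_mul (x y : ℂ) : ‖x‖ₑ ^ 2 ≤ 2 * ‖y‖ₑ ^ 2 + 2 * ‖x - y‖ₑ ^ 2 := by
  have h2 : (2 : ℝ≥0∞) = ENNReal.ofReal 2 := by simp
  simp only [← ofReal_norm, h2]
  rw [← ENNReal.ofReal_pow (norm_nonneg _), ← ENNReal.ofReal_pow (norm_nonneg _),
    ← ENNReal.ofReal_pow (norm_nonneg _), ← ENNReal.ofReal_mul (by norm_num),
    ← ENNReal.ofReal_mul (by norm_num), ← ENNReal.ofReal_add (by positivity) (by positivity)]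
  refine ENNReal.ofReal_le_ofReal ?_
  have h1 : ‖x‖ ≤ ‖y‖ + ‖x - y‖ := by
    have := norm_add_le y (x - y)
    rwa [add_sub_cancel] at this
  calc ‖x‖ ^ 2 ≤ (‖y‖ + ‖x - y‖) ^ 2 := by gcongr
    _ ≤ _ := by nlinarith [sq_nonneg (‖y‖ - ‖x - y‖)]

lemma weightedSum_le_two_mul (m : ℕ) (c c' : (Fin d → ℤ) → ℂ) :
    weightedSum a b m c ≤ 2 * weightedSum a b m c' + 2 * weightedSum a b m fun l => c l - c' l := by
  unfold weightedSum
  calc _ ≤ ENNReal.ofReal (boxVol a b) * ∑' l,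
          (2 * (ENNReal.ofReal (sobolevWeight a b m l) * ‖c' l‖ₑ ^ 2)
            + 2 * (ENNReal.ofReal (sobolevWeight a b m l) * ‖c l - c' l‖ₑ ^ 2)) := by
        gcongr with l
        calc _ ≤ ENNReal.ofReal (sobolevWeight a b m l)
                * (2 * ‖c' l‖ₑ ^ 2 + 2 * ‖c l - c' l‖ₑ ^ 2) := by
              gcongr
              exact enorm_sq_le_two_mul _ _
          _ = _ := by ring
    _ = _ := by
        rw [ENNReal.tsum_add, ENNReal.tsum_mul_left, ENNReal.tsum_mul_left]
        ring

lemma sobolevNorm_sq_le_two_mul (hab : ∀ j, a j < b j) {u v : (Fin d → ℝ) → ℂ} {m : ℕ}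
    (hu : HasWeakDerivs a b m u) (hv : HasWeakDerivs a b m v) :
    sobolevNorm a b m u ^ 2
      ≤ 2 * sobolevNorm a b m v ^ 2 + 2 * sobolevNorm a b m (fun x => u x - v x) ^ 2 := by
  rw [sobolevNorm_sq hab hu, sobolevNorm_sq hab hv, sobolevNorm_sq hab (hu.sub hv)]
  refine (weightedSum_le_two_mul m _ (fourierCoef a b v)).trans (le_of_eq ?_)
  congr 3
  ext l
  rw [fourierCoef_sub hu.memLp hv.memLp]

/-- Continuity in `H²` bounds the norm near each time, and compactness of the time interval does the
rest. -/
lemma exists_sobolevNorm_bound (hab : ∀ j, a j < b j) {V : (Fin d → ℝ) → ℝ} {lam T : ℝ}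
    {ψ₀ : L2 a b} {ψ : ℝ → L2 a b} (hψ : IsExactSolution a b V lam T ψ₀ ψ) :
    ∃ C : ℝ≥0∞, C < ⊤ ∧ ∀ t ∈ Icc 0 T, sobolevNorm a b 2 (ψ t) ^ 2 ≤ C := by
  have key : ∃ C : ℝ≥0∞, C < ⊤ ∧ ∀ t ∈ Icc 0 T, t ∈ Icc 0 T →
      sobolevNorm a b 2 (ψ t) ^ 2 ≤ C := by
    refine isCompact_Icc.induction_on (p := fun s => ∃ C : ℝ≥0∞, C < ⊤ ∧ ∀ t ∈ s, t ∈ Icc 0 T →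
      sobolevNorm a b 2 (ψ t) ^ 2 ≤ C) ⟨0, by simp⟩ ?_ ?_ ?_
    · rintro s t hst ⟨C, hC, h⟩
      exact ⟨C, hC, fun x hx => h x (hst hx)⟩
    · rintro s t ⟨C, hC, h⟩ ⟨C', hC', h'⟩
      refine ⟨max C C', max_lt hC hC', fun x hx hxT => ?_⟩
      rcases hx with hx | hx
      · exact (h x hx hxT).trans (le_max_left _ _)
      · exact (h' x hx hxT).trans (le_max_right _ _)
    · intro t ht
      have h1 := (hψ.continuous_H2 t ht).eventually (gt_mem_nhds zero_lt_one)
      refine ⟨_, h1, 2 * sobolevNorm a b 2 (ψ t) ^ 2 + 2 * 1 ^ 2, ?_, fun s hs hsT => ?_⟩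
      · have := ENNReal.pow_lt_top (n := 2) (hψ.mem_H2 t ht)
        exact ENNReal.add_lt_top.2 ⟨ENNReal.mul_lt_top (by simp) this, by simp⟩
      · refine (sobolevNorm_sq_le_two_mul hab (hasWeakDerivs_solution hψ hsT)
          (hasWeakDerivs_solution hψ ht)).trans ?_
        have h2 : sobolevNorm a b 2 (fun x => ψ s x - ψ t x) < 1 := hs
        gcongr
  obtain ⟨C, hC, h⟩ := key
  exact ⟨C, hC, fun t ht => h t ht ht⟩

lemma solutionBound_lt_top (hd3 : d ≤ 3) (hab : ∀ j, a j < b j) {V : (Fin d → ℝ) → ℝ}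
    {lam T : ℝ} (hT : 0 < T) {ψ₀ : L2 a b} {ψ : ℝ → L2 a b} (hV : MemLp V ∞ (boxMeasure a b))
    (hψ : IsExactSolution a b V lam T ψ₀ ψ) : solutionBound a b V T ψ < ⊤ := by
  obtain ⟨C, hC, hCb⟩ := exists_sobolevNorm_bound hab hψ
  obtain ⟨D, hD⟩ := isCompact_Icc.exists_bound_of_continuousOn
    (hψ.contDiff_L2.continuousOn_derivWithin (uniqueDiffOn_Icc hT) le_rfl)
  refine max_lt (max_lt ?_ ?_) (max_lt ?_ hV.2)
  · refine (iSup₂_le (a := max C 1) fun t ht => ?_).trans_lt (max_lt hC (by simp))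
    by_contra! h
    have h1 : 1 < sobolevNorm a b 2 (ψ t) := (le_max_right _ _).trans_lt h
    have h2 : sobolevNorm a b 2 (ψ t) ≤ sobolevNorm a b 2 (ψ t) ^ 2 := by
      rw [sq]; exact le_mul_of_one_le_left' h1.le
    exact absurd ((le_max_left _ _).trans_lt h) (not_lt.2 (h2.trans (hCb t ht)))
  · refine (iSup₂_le (a := ENNReal.ofReal D) fun t ht => ?_).trans_lt ENNReal.ofReal_lt_top
    rw [← ofReal_norm]
    exact ENNReal.ofReal_le_ofReal (hD t ht)
  · refine (iSup₂_le (a := ∑' l, ENNReal.ofReal (sobolevWeight a b 2 l)⁻¹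
      + (ENNReal.ofReal (boxVol a b))⁻¹ * C) fun t ht => ?_).trans_lt ?_
    · refine (eLpNorm_top_le hab (hasWeakDerivs_solution hψ ht)).trans ?_
      gcongr
      exact hCb t ht
    · refine ENNReal.add_lt_top.2 ⟨tsum_inv_sobolevWeight_lt_top hd3 hab, ENNReal.mul_lt_top ?_ hC⟩
      simpa using boxVol_pos hab

end LogSE

end

/-! ### From the coefficient error to the Sobolev norms. -/

noncomputable section

namespace LogSE

variable {d : ℕ} {a b : Fin d → ℝ} {S : Finset (Fin d → ℤ)}

/-- The inverse inequality on resolved modes: at most three summands, each `O(h^{-2m})`. -/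
lemma sobolevWeight_le_of_freqSq_le {m : ℕ} (hm : m ≤ 2) {l : Fin d → ℤ} {h Ci : ℝ} (hh : 0 < h)
    (hh1 : h ≤ 1) (hCi : 0 ≤ Ci) (hl : freqSq a b l ≤ Ci / h ^ 2) :
    sobolevWeight a b m l ≤ 3 * (1 + Ci) ^ 2 / (h ^ m) ^ 2 := by
  have hA : 0 ≤ freqSq a b l := freqSq_nonneg l
  have h1 : ∀ k ∈ Finset.range (m + 1), freqSq a b l ^ k ≤ (1 + Ci) ^ 2 / (h ^ m) ^ 2 := by
    intro k hk
    have hkm : k ≤ m := Nat.lt_succ_iff.1 (Finset.mem_range.1 hk)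
    calc freqSq a b l ^ k ≤ (Ci / h ^ 2) ^ k := by gcongr
      _ = Ci ^ k / (h ^ k) ^ 2 := by rw [div_pow, ← pow_mul, ← pow_mul, mul_comm]
      _ ≤ (1 + Ci) ^ k / (h ^ k) ^ 2 := by gcongr; linarith
      _ ≤ _ := by
        gcongr ?_ / ?_ ^ 2
        · exact pow_le_pow_right₀ (by linarith) (hkm.trans hm)
        · exact pow_le_pow_of_le_one hh.le hh1 hkm
  unfold sobolevWeight
  refine (Finset.sum_le_card_nsmul _ _ _ h1).trans ?_
  rw [Finset.card_range, nsmul_eq_mul, mul_div_assoc]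
  have : ((m + 1 : ℕ) : ℝ) ≤ 3 := by exact_mod_cast Nat.succ_le_succ hm
  gcongr

/-- Comparison of a function with a trigonometric polynomial in the Sobolev norms. -/
lemma weightedSum_sub_trigPoly_le {m : ℕ} (hm : m ≤ 2) (hab : ∀ j, a j < b j)
    {u : (Fin d → ℝ) → ℂ} (hu : MemLp u 2 (boxMeasure a b)) {h Ci M : ℝ} (hh : 0 < h)
    (hh1 : h ≤ 1) (hCi : 0 ≤ Ci) (hM0 : 0 ≤ M) (hSi : ∀ l ∈ S, freqSq a b l ≤ Ci / h ^ 2)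
    (hSo : ∀ l ∉ S, (h ^ 2)⁻¹ ≤ freqSq a b l)
    (hM : weightedSum a b 2 (fourierCoef a b u) ≤ ENNReal.ofReal (M ^ 2))
    (c : EuclideanSpace ℂ S) :
    weightedSum a b m (fourierCoef a b fun x => u x - trigPoly a b c x)
      ≤ ENNReal.ofReal ((Real.sqrt (3 * boxVol a b) * (1 + Ci)
          * (‖c - coefVec a b S u‖ / h ^ m) + M * h ^ (2 - m)) ^ 2) := by
  have hv := boxVol_pos hab
  have hcoef : ∀ l, fourierCoef a b (fun x => u x - trigPoly a b c x) l
      = fourierCoef a b u l - fourierCoef a b (trigPoly a b c) l := fun l =>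
    fourierCoef_sub hu (memLp_trigPoly _ 2) l
  refine (weightedSum_le_of_split hm hab hh hSo
    (fun l hl => sobolevWeight_le_of_freqSq_le hm hh hh1 hCi (hSi l hl))
    (c - coefVec a b S u) (u := fourierCoef a b u) (fun l hl => ?_) (fun l hl => ?_)
    (by positivity)).trans ?_
  · rw [hcoef, fourierCoef_trigPoly hab, dif_pos hl, norm_sub_rev]
    rfl
  · rw [hcoef, fourierCoef_trigPoly hab, dif_neg hl, sub_zero]
  · refine (add_le_add_right (mul_le_mul_right hM _) _).trans ?_
    rw [← ENNReal.ofReal_mul (by positivity), ← ENNReal.ofReal_add (by positivity) (by positivity)]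
    refine ENNReal.ofReal_le_ofReal ?_
    set E := ‖c - coefVec a b S u‖
    have hE : 0 ≤ E := norm_nonneg _
    have h2 : boxVol a b * (3 * (1 + Ci) ^ 2 / (h ^ m) ^ 2 * E ^ 2)
        = (Real.sqrt (3 * boxVol a b) * (1 + Ci) * (E / h ^ m)) ^ 2 := by
      rw [mul_pow, mul_pow, Real.sq_sqrt (by positivity), div_pow]
      ring
    have h3 : h ^ (2 * (2 - m)) * M ^ 2 = (M * h ^ (2 - m)) ^ 2 := by
      rw [mul_pow, ← pow_mul]
      ring
    rw [h2, h3]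
    have h4 : 0 ≤ Real.sqrt (3 * boxVol a b) * (1 + Ci) * (E / h ^ m) := by positivity
    have h5 : 0 ≤ M * h ^ (2 - m) := by positivity
    nlinarith [mul_nonneg h4 h5]

/-- Error bounds in `L²` and `H¹` and a bound in `H²`, given an error bound for the coefficients. -/
lemma sobolev_bounds_of_coef_bound (hab : ∀ j, a j < b j) {u : (Fin d → ℝ) → ℂ}
    (hu : HasWeakDerivs a b 2 u) {τ h Ci Ct M K : ℝ} (hτ : 0 < τ) (hτ1 : τ < Real.exp (-1))
    (hh : 0 < h) (hh1 : h < Real.exp (-1)) (hCt0 : 0 < Ct)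
    (hCt : τ * |Real.log τ| ≤ Ct * h ^ 2 / |Real.log h|) (hCi : 0 ≤ Ci) (hM0 : 0 ≤ M)
    (hK : 0 ≤ K) (hSi : ∀ l ∈ S, freqSq a b l ≤ Ci / h ^ 2)
    (hSo : ∀ l ∉ S, (h ^ 2)⁻¹ ≤ freqSq a b l)
    (hM : weightedSum a b 2 (fourierCoef a b u) ≤ ENNReal.ofReal (M ^ 2))
    (c : EuclideanSpace ℂ S)
    (hc : ‖c - coefVec a b S u‖ ≤ K * (τ * |Real.log τ| + h ^ 2 * |Real.log h|)) {C : ℝ}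
    (hC : C = 2 * (2 * M + Real.sqrt (3 * boxVol a b) * (1 + Ci) * K * (Real.sqrt Ct + Ct + 1))) :
    eLpNorm (fun x => u x - trigPoly a b c x) 2 (boxMeasure a b)
        ≤ ENNReal.ofReal (C * (τ * |Real.log τ| ^ 2 + h ^ 2 * |Real.log h|)) ∧
      sobolevNorm a b 2 (trigPoly a b c) ≤ ENNReal.ofReal (C * |Real.log h|) ∧
      sobolevNorm a b 1 (fun x => u x - trigPoly a b c x)
        ≤ ENNReal.ofReal (C * (Real.sqrt τ * |Real.log τ| + h * |Real.log h|)) := by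
  have hp := hasWeakDerivs_trigPoly hab c 2
  have key := fun (m : ℕ) (hm : m ≤ 2) => weightedSum_sub_trigPoly_le hm hab hu.memLp hh
    (lt_one_of_lt_exp hh1).le hCi hM0 hSi hSo hM c
  have hL := one_le_abs_log hτ hτ1
  have hl := one_le_abs_log hh hh1
  have hτL := tau_mul_log_le hτ hh hh1 hCt
  have hτh := tau_le hτ hτ1 hh hh1 hCt
  set L := |Real.log τ|
  set q := |Real.log h|
  set E := ‖c - coefVec a b S u‖
  set A := Real.sqrt (3 * boxVol a b) * (1 + Ci) with hA
  have hA0 : 0 ≤ A := by positivity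
  have hAK : 0 ≤ A * K := by positivity
  have hC0 : 0 ≤ C := by rw [hC]; positivity
  have hsCt : 0 ≤ Real.sqrt Ct := Real.sqrt_nonneg _
  have hD1 : A * K ≤ A * K * (Real.sqrt Ct + Ct + 1) :=
    le_mul_of_one_le_right hAK (by linarith)
  have hD2 : A * K * (Real.sqrt Ct + 1) ≤ A * K * (Real.sqrt Ct + Ct + 1) := by
    gcongr; linarith
  have hD3 : A * K * (Ct + 1) ≤ A * K * (Real.sqrt Ct + Ct + 1) := by
    gcongr; linarith
  set D := A * K * (Real.sqrt Ct + Ct + 1)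
  have hD : 0 ≤ D := hAK.trans hD1
  refine ⟨?_, ?_, ?_⟩
  · refine le_ofReal_of_sq_le (by positivity) ?_
    rw [eLpNorm_sq_eq_weightedSum hab (hu.sub hp).memLp]
    refine (key 0 (by norm_num)).trans (ENNReal.ofReal_le_ofReal ?_)
    gcongr
    rw [pow_zero, div_one, Nat.sub_zero]
    -- The coefficient error has one logarithm of `τ` less than the stated rate; `L ≥ 1` makes up
    -- the difference.
    have h1 : τ * L + h ^ 2 * q ≤ τ * L ^ 2 + h ^ 2 * q := by
      gcongr
      nlinarith
    have h2 : h ^ 2 ≤ τ * L ^ 2 + h ^ 2 * q := by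
      have : h ^ 2 ≤ h ^ 2 * q := le_mul_of_one_le_right (by positivity) hl
      have : 0 ≤ τ * L ^ 2 := by positivity
      linarith
    calc A * E + M * h ^ 2 ≤ A * (K * (τ * L ^ 2 + h ^ 2 * q)) + M * (τ * L ^ 2 + h ^ 2 * q) := by
          gcongr
          exact hc.trans (by gcongr)
      _ = (A * K + M) * (τ * L ^ 2 + h ^ 2 * q) := by ring
      _ ≤ _ := by
          gcongr
          linarith
  · have h1 : A * (E / h ^ 2) + M * h ^ (2 - 2) ≤ (D + M) * q := by
      -- Two derivatives cost `h⁻²`. The condition `τL ≤ Ct h²` bounds the temporal part by a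
      -- constant, so `|ln h|` from the spatial part is all that remains.
      have h2 : E / h ^ 2 ≤ K * ((Ct + 1) * q) := by
        rw [div_le_iff₀ (by positivity)]
        refine hc.trans ?_
        have h3 : τ * L + h ^ 2 * q ≤ (Ct + 1) * q * h ^ 2 := by
          have : Ct * h ^ 2 ≤ Ct * h ^ 2 * q := le_mul_of_one_le_right (by positivity) hl
          linarith
        calc _ ≤ K * ((Ct + 1) * q * h ^ 2) := by gcongr
          _ = _ := by ring
      calc _ ≤ A * (K * ((Ct + 1) * q)) + M * q := by
            gcongr
            simpa using hl
        _ = (A * K * (Ct + 1) + M) * q := by ring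
        _ ≤ _ := by gcongr
    refine le_ofReal_of_sq_le (by positivity) ((sobolevNorm_sq_le_two_mul hab hp hu).trans ?_)
    have h5 : sobolevNorm a b 2 (fun x => trigPoly a b c x - u x) ^ 2
        = weightedSum a b 2 (fourierCoef a b fun x => u x - trigPoly a b c x) := by
      rw [sobolevNorm_sq hab (hp.sub hu)]
      unfold weightedSum
      congr 1
      refine tsum_congr fun l => ?_
      rw [fourierCoef_sub hp.memLp hu.memLp, fourierCoef_sub hu.memLp hp.memLp, ← enorm_neg,
        neg_sub]
    rw [h5, sobolevNorm_sq hab hu]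
    refine (add_le_add (mul_le_mul_right hM 2) (mul_le_mul_right (key 2 le_rfl) 2)).trans ?_
    have h6 : (2 : ℝ≥0∞) = ENNReal.ofReal 2 := by simp
    rw [h6, ← ENNReal.ofReal_mul (by norm_num), ← ENNReal.ofReal_mul (by norm_num),
      ← ENNReal.ofReal_add (by positivity) (by positivity)]
    refine ENNReal.ofReal_le_ofReal ?_
    have h7 : M ≤ M * q := le_mul_of_one_le_right hM0 hl
    calc _ ≤ 2 * (M * q) ^ 2 + 2 * ((D + M) * q) ^ 2 := by gcongr
      _ ≤ 4 * (M * q + (D + M) * q) ^ 2 := by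
          have : 0 ≤ M * q := by positivity
          have : 0 ≤ (D + M) * q := by positivity
          nlinarith [mul_nonneg ‹0 ≤ M * q› this, sq_nonneg (M * q), sq_nonneg ((D + M) * q)]
      _ = _ := by rw [hC]; ring
  · refine le_ofReal_of_sq_le (by positivity) ?_
    rw [sobolevNorm_sq hab ((hu.sub hp).mono (by norm_num))]
    refine (key 1 (by norm_num)).trans (ENNReal.ofReal_le_ofReal ?_)
    gcongr
    simp only [pow_one, Nat.add_one_sub_one]
    have h1 : Real.sqrt τ ≤ Real.sqrt Ct * h := by
      refine (Real.sqrt_le_sqrt hτh).trans (le_of_eq ?_)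
      rw [Real.sqrt_mul hCt0.le, Real.sqrt_sq hh.le]
    set R := Real.sqrt τ * L + h * q with hR
    have hsL : 0 ≤ Real.sqrt τ * L := by positivity
    have hhq : 0 ≤ h * q := by positivity
    have h2 : E / h ≤ K * ((Real.sqrt Ct + 1) * R) := by
      rw [div_le_iff₀ hh]
      refine hc.trans ?_
      -- One of the two factors `√τ` is traded for `h`, which pays for the inverse power of `h` lost
      -- by one derivative.
      have h3 : τ * L ≤ Real.sqrt Ct * (Real.sqrt τ * L) * h := by
        calc τ * L = Real.sqrt τ * Real.sqrt τ * L := by rw [Real.mul_self_sqrt hτ.le]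
          _ ≤ Real.sqrt τ * (Real.sqrt Ct * h) * L := by gcongr
          _ = _ := by ring
      have h4 : τ * L + h ^ 2 * q ≤ (Real.sqrt Ct + 1) * R * h := by
        have h5 : 0 ≤ (Real.sqrt Ct * (h * q) + Real.sqrt τ * L) * h := by positivity
        rw [hR]
        linarith
      calc _ ≤ K * ((Real.sqrt Ct + 1) * R * h) := by gcongr
        _ = _ := by ring
    have h6 : h ≤ R := by
      have : h ≤ h * q := le_mul_of_one_le_right hh.le hl
      linarith
    have hR0 : 0 ≤ R := by positivity
    calc _ ≤ A * (K * ((Real.sqrt Ct + 1) * R)) + M * R := by gcongr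
      _ = (A * K * (Real.sqrt Ct + 1) + M) * R := by ring
      _ ≤ _ := by
          gcongr
          linarith

end LogSE

end

/-! ### Assembly. -/

theorem theorem2p1
    (d : ℕ) (hd : 1 ≤ d) (hd3 : d ≤ 3) (a b : Fin d → ℝ) (hab : ∀ j, a j < b j)
    (lam : ℝ) (T : ℝ) (hT : 0 < T) (κ : ℝ) :
    (∀ (V : (Fin d → ℝ) → ℝ) (ψ₀ : L2 a b) (ψ : ℝ → L2 a b),
      MemLp V ∞ (boxMeasure a b) → IsExactSolution a b V lam T ψ₀ ψ →
      solutionBound a b V T ψ < ⊤) ∧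
    ∀ M : ℝ, ∃ τ₀ h₀ : ℝ, 0 < τ₀ ∧ τ₀ < Real.exp (-1) ∧ 0 < h₀ ∧ h₀ < Real.exp (-1) ∧
      ∀ Ct : ℝ, 0 < Ct → ∃ C : ℝ, 0 < C ∧
        ∀ (V : (Fin d → ℝ) → ℝ) (ψ₀ : L2 a b) (ψ : ℝ → L2 a b),
          MemLp V ∞ (boxMeasure a b) → IsExactSolution a b V lam T ψ₀ ψ →
          solutionBound a b V T ψ ≤ ENNReal.ofReal M →
          ∀ (N : Fin d → ℕ) (τ h : ℝ), (∀ j, 0 < N j ∧ Even (N j)) →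
            h = meshSize a b N → (∀ j, h ≤ κ * meshWidth a b N j) →
            0 < τ → τ < τ₀ → 0 < h → h < h₀ →
            τ * |Real.log τ| ≤ Ct * h ^ 2 / |Real.log h| →
            ∀ n : ℕ, (n : ℝ) ≤ T / τ →
              eLpNorm (fun x => ψ (n * τ) x - ewiFS a b V lam N τ ψ₀ n x) 2 (boxMeasure a b)
                  ≤ ENNReal.ofReal (C * (τ * |Real.log τ| ^ 2 + h ^ 2 * |Real.log h|)) ∧
              sobolevNorm a b 2 (ewiFS a b V lam N τ ψ₀ n)
                  ≤ ENNReal.ofReal (C * |Real.log h|) ∧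
              sobolevNorm a b 1 (fun x => ψ (n * τ) x - ewiFS a b V lam N τ ψ₀ n x)
                  ≤ ENNReal.ofReal
                    (C * (Real.sqrt τ * |Real.log τ| + h * |Real.log h|)) := by
  refine ⟨fun V ψ₀ ψ hV hψ => solutionBound_lt_top hd3 hab hT hV hψ, fun M => ?_⟩
  have hexp : Real.exp (-1) / 2 < Real.exp (-1) := half_lt_self (Real.exp_pos _)
  -- Only `|ln τ| ≥ 1` and `|ln h| ≥ 1` are required of the thresholds, so they do not depend on
  -- `M`; halving makes them strictly smaller than `e⁻¹`.
  refine ⟨Real.exp (-1) / 2, Real.exp (-1) / 2, by positivity, hexp, by positivity, hexp,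
    fun Ct hCt0 => ?_⟩
  have hv := boxVol_pos hab
  -- Replacing `M` by `max M 1` covers nonpositive `M` and makes `ln M` nonnegative.
  have hM1 : 1 ≤ max M 1 := le_max_right _ _
  have hM0 : 0 ≤ max M 1 := zero_le_one.trans hM1
  set Ci : ℝ := d * (Real.pi * κ) ^ 2 with hCi
  have hCi0 : 0 ≤ Ci := by positivity
  -- The summand `1` in `Q` keeps it positive when `κ = 0`.
  obtain ⟨K, hK, herr⟩ := norm_scheme_sub_le hab lam T (max M 1) Ct Ci
    (boxVol a b * |κ| ^ d + 1) hT hM1 hCt0 hCi0 (by positivity)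
  refine ⟨2 * (2 * max M 1 + Real.sqrt (3 * boxVol a b) * (1 + Ci) * K * (Real.sqrt Ct + Ct + 1)),
    by positivity, fun V ψ₀ ψ hV hψ hM N τ h hN hhN hκ hτ hτ1 hh hh1 hCt n hn => ?_⟩
  replace hM := hM.trans (ENNReal.ofReal_le_ofReal (le_max_left M 1))
  replace hτ1 := hτ1.trans hexp
  replace hh1 := hh1.trans hexp
  have hnT : (n : ℝ) * τ ≤ T := (le_div_iff₀ hτ).1 hn
  have hnt : (n : ℝ) * τ ∈ Icc 0 T := ⟨by positivity, hnT⟩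
  have hSi : ∀ l ∈ freqIndex N, freqSq a b l ≤ Ci / h ^ 2 := fun l hl =>
    freqSq_le_of_mem hab hN hh hκ hl
  have hSo : ∀ l ∉ freqIndex N, (h ^ 2)⁻¹ ≤ freqSq a b l := fun l hl =>
    inv_sq_le_freqSq_of_notMem hab hN hhN hl
  have hcard : ((freqIndex N).card : ℝ) ≤ (boxVol a b * |κ| ^ d + 1) / h ^ 3 :=
    (card_freqIndex_le hd3 hab hN hh (lt_one_of_lt_exp hh1).le hκ).trans (by gcongr; linarith)
  have hcoef := herr V ψ₀ ψ hV hψ hM (freqIndex N) (ewiCoef a b V lam N τ ψ₀) τ h hτ hτ1 hh hh1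
    hCt hSi hSo hcard (ewiCoef_zero hab) (fun n => ewiCoef_succ hab n) n hnT
  rw [ewiFS_eq_trigPoly hab]
  exact sobolev_bounds_of_coef_bound hab (hasWeakDerivs_solution hψ hnt) hτ hτ1 hh hh1 hCt0 hCt
    hCi0 hM0 hK.le hSi hSo (weightedSum_solution_le hab hψ hM0 hM hnt) _ hcoef rfl
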